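/- Let $n\ge 1$, let $\gamma$ be the standard Gaussian measure on $\mathbb R^n$ and $Y$ a random variable of law $\gamma$. For $t\ge 0$ let $$N_tf(x)=E\big[f(e^{-t}x+\sqrt{1-e^{-2t}}\,Y)\big]$$ be the Ornstein--Uhlenbeck semigroup, and for $a\in\mathbb R$ let $T_af(x)=f(e^{a/2}x)$. Functions $f:\mathbb R^n\to\mathbb R$ are measurable, and norms may be $+\infty$. (1) Let $t\ge 0$, $a\in\mathbb R$ and $1<q_1<q_2$ satisfy $q_2-1=e^{2t}(q_1e^{-a}-1)$. Then $$\|N_tf\|_{L^{q_2}(\gamma)}\le M^{n/2}\,\|T_{-a}f\|_{L^{q_1}(\gamma)},\qquad M=\Big(\frac{q_1-1}{e^{-2t}}\Big)^{1-\frac1{q_1}}\Big(\frac{q_2-1}{e^{-a}}\Big)^{\frac1{q_2}-1}\Big(\frac{1-e^{-2t}}{q_2-q_1}\Big)^{\frac1{q_2}-\frac1{q_1}}$$ (with $M=+\infty$ if $t=0$); if $T_{-a}f\in L^{q_1}(\gamma)$, then the expectation defining $N_tf(x)$ converges absolutely for every $x$, and $N_tf$ is measurable. (2) Let $t>0$ and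 $q_2=2$. As $q_1\downarrow 1$ under the constraint in (1), $-a\to\ln(e^{-2t}+1)$ and $M^{n/2}\to\big(\frac{e^{-2t}+1}{1-e^{-2t}}\big)^{n/4}$. Moreover $$\|N_tf\|_{L^2(\gamma)}\le\Big(\frac{e^{-2t}+1}{1-e^{-2t}}\Big)^{n/4}\|T_{\ln(e^{-2t}+1)}f\|_{L^1(\gamma)}=\int|f|\,V_t\,d\gamma,\qquad V_t(y)=(1-e^{-4t})^{-n/4}\exp\Big(\frac{|y|^2}{2}\,\frac1{1+e^{2t}}\Big),$$ and if the right-hand side is finite, the expectation defining $N_tf(x)$ converges absolutely for every $x$, and $N_tf$ is measurable. This bound is sharp: if $V:\mathbb R^n\to[0,\infty]$ is measurable and $\|N_tf\|_{L^2(\gamma)}\le\int|f|V\,d\gamma$ for all bounded measurable $f$, then $V\ge V_t$ $\gamma$-almost everywhere. (3) For every $t>0$ there is a unique continuous $n_t:\mathbb R^n\times\mathbb R^n\to\mathbb R$, with $n_t(x,\cdot)\in L^1(\gamma)$ for every $x$, such that $N_tf(x)=\int f(y)\,n_t(x,y)\,\gamma(dy)$ for all bounded measurable $f$ and all $x$.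 For all $t>0$ and all $x,y$, $$n_{2t}(x,y)\le V_t(x)V_t(y),\qquad n_{2t}(x,x)\le V_t(x)^2,$$ and the bound on the diagonal is sharp: $n_{2t}(x,x)=V_t(x)^2$. (4) For every $t>0$, $N_t$ is a bounded positive self-adjoint operator on $L^2(\gamma)$ of finite trace, with $$\operatorname{tr}N_t=\sum_i\langle e_i,N_te_i\rangle_{L^2(\gamma)}=\int n_t(x,x)\,d\gamma(x)=\int V_{t/2}^2\,d\gamma=(1-e^{-t})^{-n}$$ for every orthonormal (Hilbert) basis $(e_i)$ of $L^2(\gamma)$. -/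

import Mathlib

open MeasureTheory ProbabilityTheory Filter Set
open scoped ENNReal Topology

noncomputable section

/-- Dilations: `(T_a f)(x) = f (e^{a/2} x)`, for every real `a`. -/
def dilation {n : ℕ} (a : ℝ) (f : EuclideanSpace ℝ (Fin n) → ℝ) :
    EuclideanSpace ℝ (Fin n) → ℝ :=
  fun x => f (Real.exp (a / 2) • x)

/-- The point `e^{-t} x + (1 - e^{-2t})^{1/2} y` of the Mehler formula. -/
def mehlerPoint {n : ℕ} (t : ℝ) (x y : EuclideanSpace ℝ (Fin n)) :
    EuclideanSpace ℝ (Fin n) :=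
  Real.exp (-t) • x + Real.sqrt (1 - Real.exp (-2 * t)) • y

/-- The Ornstein-Uhlenbeck semigroup, by the Mehler formula:
`N_t f (x) = ∫ f (e^{-t} x + (1 - e^{-2t})^{1/2} y) dγ(y)`, with `γ` the standard Gaussian law. -/
def ouSemigroup {n : ℕ} (t : ℝ) (f : EuclideanSpace ℝ (Fin n) → ℝ) :
    EuclideanSpace ℝ (Fin n) → ℝ :=
  fun x => ∫ y, f (mehlerPoint t x y) ∂(stdGaussian (EuclideanSpace ℝ (Fin n)))

/-- The constant `M`, computed in `[0, ∞]`.  For `t > 0` and `1 < q₁ < q₂` it is a positive real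
number; at `t = 0` the last factor is a negative power of zero, hence `M = ∞`. -/
def nashConst (t a q₁ q₂ : ℝ) : ℝ≥0∞ :=
  ENNReal.ofReal ((q₁ - 1) / Real.exp (-2 * t)) ^ (1 - 1 / q₁) *
  ENNReal.ofReal ((q₂ - 1) / Real.exp (-a)) ^ (1 / q₂ - 1) *
  ENNReal.ofReal ((1 - Real.exp (-2 * t)) / (q₂ - q₁)) ^ (1 / q₂ - 1 / q₁)

/-- The weight `V_t(y) = (1 - e^{-4t})^{-n/4} exp ((|y|²/2) / (1 + e^{2t}))`. -/
def ouWeight {n : ℕ} (t : ℝ) (y : EuclideanSpace ℝ (Fin n)) : ℝ :=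
  (1 - Real.exp (-4 * t)) ^ (-(n : ℝ) / 4) *
    Real.exp (‖y‖ ^ 2 / 2 * (1 / (1 + Real.exp (2 * t))))

/-- `k` is the kernel (density) of `N_t` with respect to `γ`:
`N_t f (x) = ∫ f(y) k(x, y) dγ(y)` for all bounded measurable `f` and all `x`.
Continuity singles out the version whose diagonal values make sense. -/
structure IsOUKernel {n : ℕ} (t : ℝ)
    (k : EuclideanSpace ℝ (Fin n) → EuclideanSpace ℝ (Fin n) → ℝ) : Prop where
  continuous : Continuous (Function.uncurry k)
  integrable : ∀ x, Integrable (k x) (stdGaussian (EuclideanSpace ℝ (Fin n)))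
  repr : ∀ f : EuclideanSpace ℝ (Fin n) → ℝ, Measurable f → (∃ C : ℝ, ∀ x, |f x| ≤ C) →
    ∀ x, ouSemigroup t f x = ∫ y, f y * k x y ∂(stdGaussian (EuclideanSpace ℝ (Fin n)))

end

/-! The basic tool is the affine change of variables: the law of m + cZ has the explicit density
`gaussianRatio` with respect to γ. With ρ = e^{-t} it gives the Mehler kernel n_t, symmetric and
such that composing two copies of correlation ρ yields the kernel of correlation ρ²
(`mehlerKernel_mul`).

Hypercontractivity comes from a two-function inequality: if X, Y are standard Gaussians with
correlation ρ and ρ²αβ ≤ (1-α)(1-β), then E[F(X)^α G(Y)^β] ≤ (EF)^α (EG)^β. Let F and G evolve by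
the heat flow in small time steps δ. In a second-order expansion about the local means, the linear
terms average to zero, the quadratic form has non-positive mean exactly because of the condition on
ρ, and the remainder is O(δ^{3/2}) uniformly along the flow (`exists_heat_couplingProduct_le`).
About 1/δ steps cost O(√δ), which tends to zero (`integral_rpow_mul_rpow_le`). Inserting (NF)^q and
F^p with α = 1 - 1/q, β = 1/p gives Nelson's inequality for smooth positive functions; density and
Fatou's lemma give the general case (`lintegral_mehler_rpow_le`).

The dimensional bound is Nelson's inequality conjugated by Gaussian weights and dilations. Write f
as exp(l‖y‖²/2) times another function. Each Gaussian law tilted by a quadratic exponential is again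
Gaussian, up to a constant, so the weight passes through the Mehler average, and the weights left
inside the L^p and L^q integrals turn into dilations. The parameters are chosen so that these
dilations cancel and the remaining average has the extremal correlation ((p-1)/(q-1))^{1/2}; the
normalising constants multiply to M^{n/2} (`lintegral_mehler_rpow_le_nashConst`).

The L¹ to L² bound is obtained directly from the kernel and not as a limit: ‖N_t f‖₂² is at most ∬
|f(y)||f(z)| n_{2t}(y,z), and completing the square gives n_{2t}(y,z) ≤ V_t(y)V_t(z) with equality
when y = z (`mehlerKernel_sq_le`). Equality on the diagonal also yields sharpness, by testing on
indicators of small sets.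

For the trace, N_{2s} = N_s² and N_s is self-adjoint, so ⟨e_i, N_{2s} e_i⟩ = ‖N_s e_i‖². By Tonelli
and Parseval applied to n_s(x,·), the sum over i is ∫ n_{2s}(x,x) dγ(x), an explicit Gaussian
integral. -/

/-! ### Gaussian density and affine changes of variables. -/

section GaussianDensity

variable {n : ℕ}

local notation "𝔼" => EuclideanSpace ℝ (Fin n)
local notation "γ" => stdGaussian (EuclideanSpace ℝ (Fin n))

/-- The density of the standard Gaussian measure with respect to Lebesgue measure. -/
noncomputable def stdGaussianPDF (x : 𝔼) : ℝ :=
  (2 * Real.pi) ^ (-(n : ℝ) / 2) * Real.exp (-‖x‖ ^ 2 / 2)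

theorem stdGaussianPDF_pos (x : 𝔼) : 0 < stdGaussianPDF x := by
  unfold stdGaussianPDF; positivity

theorem continuous_stdGaussianPDF : Continuous (stdGaussianPDF : 𝔼 → ℝ) := by
  unfold stdGaussianPDF; fun_prop

theorem integrable_stdGaussianPDF : Integrable (stdGaussianPDF : 𝔼 → ℝ) := by
  unfold stdGaussianPDF
  apply Integrable.const_mul
  have h := (GaussianFourier.integrable_cexp_neg_mul_sq_norm_add (V := 𝔼)
    (b := 1/2) (by norm_num) 0 0).norm
  refine h.congr (ae_of_all _ fun x => ?_)
  simp only [Complex.norm_exp]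
  congr 1
  simp [← Complex.ofReal_pow]
  ring

theorem integral_stdGaussianPDF_mul_cexp (t : 𝔼) :
    ∫ x : 𝔼, (stdGaussianPDF x : ℂ) * Complex.exp (inner ℝ x t * Complex.I) =
      Complex.exp (-‖t‖ ^ 2 / 2) := by
  have h := GaussianFourier.integral_cexp_neg_mul_sq_norm_add (V := 𝔼)
    (b := 1/2) (by norm_num) Complex.I t
  have e : ∀ x : 𝔼, (stdGaussianPDF x : ℂ) * Complex.exp (inner ℝ x t * Complex.I) =
      (((2 * Real.pi) ^ (-(n : ℝ) / 2) : ℝ) : ℂ) *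
        Complex.exp (-(1/2) * ‖x‖ ^ 2 + Complex.I * inner ℝ t x) := by
    intro x
    rw [stdGaussianPDF, Complex.ofReal_mul, Complex.ofReal_exp, mul_assoc, ← Complex.exp_add,
      real_inner_comm]
    congr 2
    push_cast
    ring
  simp_rw [e]
  rw [integral_const_mul, h, ← mul_assoc]
  have : (((2 * Real.pi) ^ (-(n : ℝ) / 2) : ℝ) : ℂ) *
      (Real.pi / (1 / 2) : ℂ) ^ (Module.finrank ℝ 𝔼 / 2 : ℂ) = 1 := by
    have : (Real.pi / (1 / 2) : ℂ) ^ (Module.finrank ℝ 𝔼 / 2 : ℂ) =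
        (((2 * Real.pi) ^ ((n : ℝ) / 2) : ℝ) : ℂ) := by
      rw [Complex.ofReal_cpow (by positivity)]
      push_cast
      simp
      ring_nf
    rw [this, ← Complex.ofReal_mul, ← Real.rpow_add (by positivity)]
    simp
    ring_nf
    simp
  rw [this, one_mul]
  congr 1
  rw [Complex.I_sq]
  ring

/-- Both measures are finite with characteristic function exp(-‖t‖²/2), and this determines them. -/
theorem stdGaussian_eq_withDensity :
    γ = volume.withDensity (fun x : 𝔼 => ENNReal.ofReal (stdGaussianPDF x)) := by
  have := isFiniteMeasure_withDensity_ofReal (integrable_stdGaussianPDF (n := n)).2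
  apply Measure.ext_of_charFun
  ext t
  rw [charFun_stdGaussian, charFun_apply, integral_withDensity_eq_integral_toReal_smul₀
    (by exact continuous_stdGaussianPDF.measurable.ennreal_ofReal.aemeasurable) (by simp)]
  rw [← integral_stdGaussianPDF_mul_cexp]
  congr 1
  ext x
  rw [ENNReal.toReal_ofReal (stdGaussianPDF_pos x).le]
  rfl

theorem lintegral_volume_comp_affine (m : 𝔼) {c : ℝ} (hc : 0 < c) {H : 𝔼 → ℝ≥0∞}
    (hH : Measurable H) :
    ∫⁻ z : 𝔼, H (m + c • z) = ENNReal.ofReal (c ^ (-(n : ℝ))) * ∫⁻ y : 𝔼, H y := by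
  have h := Measure.map_addHaar_smul (volume : Measure 𝔼) hc.ne'
  have h2 : ∫⁻ z : 𝔼, H (m + c • z) = ∫⁻ y, H (m + y) ∂(volume.map (fun z : 𝔼 => c • z)) := by
    rw [lintegral_map (by fun_prop) (by fun_prop)]
  rw [h2, h, lintegral_smul_measure, lintegral_add_left_eq_self, smul_eq_mul]
  congr 2
  rw [abs_of_pos (by positivity), Real.rpow_neg hc.le, finrank_euclideanSpace, Fintype.card_fin,
    Real.rpow_natCast]

/-- The density with respect to `γ` of the Gaussian measure with mean `m` and covariance
`c ^ 2`. -/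
noncomputable def gaussianRatio (m : 𝔼) (c : ℝ) (y : 𝔼) : ℝ :=
  c ^ (-(n : ℝ)) * Real.exp (‖y‖ ^ 2 / 2 - ‖y - m‖ ^ 2 / (2 * c ^ 2))

theorem gaussianRatio_pos (m : 𝔼) {c : ℝ} (hc : 0 < c) (y : 𝔼) : 0 < gaussianRatio m c y := by
  unfold gaussianRatio; positivity

theorem continuous_gaussianRatio (m : 𝔼) (c : ℝ) : Continuous (gaussianRatio m c) := by
  unfold gaussianRatio; fun_prop

theorem lintegral_stdGaussian (H : 𝔼 → ℝ≥0∞) :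
    ∫⁻ x, H x ∂γ = ∫⁻ x : 𝔼, ENNReal.ofReal (stdGaussianPDF x) * H x := by
  rw [stdGaussian_eq_withDensity, lintegral_withDensity_eq_lintegral_mul_non_measurable _
    continuous_stdGaussianPDF.measurable.ennreal_ofReal (ae_of_all _ fun _ => by simp)]
  rfl

/-- The source of every later formula: Mehler kernel, dilations and Gaussian tilts are all special
cases. -/
theorem lintegral_comp_affine (m : 𝔼) {c : ℝ} (hc : 0 < c) {H : 𝔼 → ℝ≥0∞} (hH : Measurable H) :
    ∫⁻ z, H (m + c • z) ∂γ = ∫⁻ y, ENNReal.ofReal (gaussianRatio m c y) * H y ∂γ := by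
  rw [lintegral_stdGaussian, lintegral_stdGaussian]
  have h := lintegral_volume_comp_affine m hc
    (H := fun y => ENNReal.ofReal (stdGaussianPDF (c⁻¹ • (y - m))) * H y) (by
      have := continuous_stdGaussianPDF (n := n)
      refine Measurable.mul (Continuous.measurable ?_).ennreal_ofReal hH
      fun_prop)
  have e : ∀ z : 𝔼, c⁻¹ • (m + c • z - m) = z := fun z => by
    rw [add_sub_cancel_left, smul_smul, inv_mul_cancel₀ hc.ne', one_smul]
  simp only [e] at h
  rw [h, ← lintegral_const_mul' _ _ (by simp)]
  refine lintegral_congr fun y => ?_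
  rw [← mul_assoc, ← mul_assoc, ← ENNReal.ofReal_mul (by positivity),
    ← ENNReal.ofReal_mul (stdGaussianPDF_pos y).le]
  congr 2
  rw [stdGaussianPDF, stdGaussianPDF, gaussianRatio, norm_smul, mul_mul_mul_comm,
    ← Real.exp_add, mul_comm, mul_assoc, mul_comm (Real.exp _), ← mul_assoc]
  congr 2
  rw [norm_inv, Real.norm_of_nonneg hc.le]
  field_simp
  ring

theorem map_affine_stdGaussian (m : 𝔼) {c : ℝ} (hc : 0 < c) :
    Measure.map (fun z : 𝔼 => m + c • z) γ =
      Measure.withDensity γ (fun y => ENNReal.ofReal (gaussianRatio m c y)) := by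
  refine Measure.ext_of_lintegral _ fun H hH => ?_
  rw [lintegral_map hH (by fun_prop), lintegral_comp_affine m hc hH,
    lintegral_withDensity_eq_lintegral_mul _
      (continuous_gaussianRatio m c).measurable.ennreal_ofReal hH]
  rfl

theorem integral_comp_affine (m : 𝔼) {c : ℝ} (hc : 0 < c) {f : 𝔼 → ℝ}
    (hf : AEStronglyMeasurable f γ) :
    ∫ z, f (m + c • z) ∂γ = ∫ y, f y * gaussianRatio m c y ∂γ := by
  have hf' : AEStronglyMeasurable f (Measure.map (fun z : 𝔼 => m + c • z) γ) := by
    rw [map_affine_stdGaussian m hc]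
    exact hf.mono_ac (withDensity_absolutelyContinuous _ _)
  rw [← integral_map (φ := fun z : 𝔼 => m + c • z) (by fun_prop) hf', map_affine_stdGaussian m hc,
    integral_withDensity_eq_integral_toReal_smul
      (continuous_gaussianRatio m c).measurable.ennreal_ofReal (by simp)]
  refine integral_congr_ae (ae_of_all _ fun y => ?_)
  simp only [smul_eq_mul]
  rw [ENNReal.toReal_ofReal (gaussianRatio_pos m hc y).le, mul_comm]

theorem integrable_comp_affine (m : 𝔼) {c : ℝ} (hc : 0 < c) {f : 𝔼 → ℝ}
    (hf : AEStronglyMeasurable f γ) :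
    Integrable (fun z => f (m + c • z)) γ ↔ Integrable (fun y => f y * gaussianRatio m c y) γ := by
  have hf' : AEStronglyMeasurable f (Measure.map (fun z : 𝔼 => m + c • z) γ) := by
    rw [map_affine_stdGaussian m hc]
    exact hf.mono_ac (withDensity_absolutelyContinuous _ _)
  have := integrable_map_measure hf' (f := fun z : 𝔼 => m + c • z) (by fun_prop)
  rw [show (fun z => f (m + c • z)) = f ∘ fun z : 𝔼 => m + c • z from rfl, ← this,
    map_affine_stdGaussian m hc, integrable_withDensity_iff_integrable_smul'
      (continuous_gaussianRatio m c).measurable.ennreal_ofReal (by simp)]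
  refine integrable_congr (ae_of_all _ fun y => ?_)
  simp only [smul_eq_mul]
  rw [ENNReal.toReal_ofReal (gaussianRatio_pos m hc y).le, mul_comm]

theorem lintegral_gaussianRatio (m : 𝔼) {c : ℝ} (hc : 0 < c) :
    ∫⁻ y, ENNReal.ofReal (gaussianRatio m c y) ∂γ = 1 := by
  have := lintegral_comp_affine m hc (H := 1) measurable_one
  simpa using this.symm

theorem integrable_gaussianRatio (m : 𝔼) {c : ℝ} (hc : 0 < c) :
    Integrable (gaussianRatio m c) γ :=
  (lintegral_ofReal_ne_top_iff_integrable (continuous_gaussianRatio m c).aestronglyMeasurable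
    (ae_of_all _ fun y => (gaussianRatio_pos m hc y).le)).1 (by
      rw [lintegral_gaussianRatio m hc]; simp)

theorem quasiMeasurePreserving_affine (m : 𝔼) {c : ℝ} (hc : 0 < c) :
    Measure.QuasiMeasurePreserving (fun z : 𝔼 => m + c • z) γ γ :=
  ⟨by fun_prop, by
    rw [map_affine_stdGaussian m hc]; exact withDensity_absolutelyContinuous _ _⟩

theorem quasiMeasurePreserving_smul {c : ℝ} (hc : 0 < c) :
    Measure.QuasiMeasurePreserving (fun z : 𝔼 => c • z) γ γ := by
  simpa using quasiMeasurePreserving_affine (0 : 𝔼) hc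

/-- Absorbing a centred Gaussian weight by a dilation. -/
theorem lintegral_exp_mul {ν : ℝ} (hν : ν < 1) {H : 𝔼 → ℝ≥0∞} (hH : Measurable H) :
    ∫⁻ x, ENNReal.ofReal (Real.exp (ν * ‖x‖ ^ 2 / 2)) * H x ∂γ =
      ENNReal.ofReal ((1 - ν) ^ (-(n : ℝ) / 2)) *
        ∫⁻ x, H ((1 - ν) ^ (-(1 / 2) : ℝ) • x) ∂γ := by
  have h1 : 0 < 1 - ν := by linarith
  -- Normalising exp(ν‖x‖²/2) γ gives the centred Gaussian of variance 1/(1-ν), the law of this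
  -- multiple of Z.
  have hc : 0 < (1 - ν) ^ (-(1 / 2) : ℝ) := by positivity
  have h := lintegral_comp_affine (0 : 𝔼) hc hH
  simp only [zero_add] at h
  rw [h, ← lintegral_const_mul' _ _ (by simp)]
  refine lintegral_congr fun y => ?_
  rw [← mul_assoc, ← ENNReal.ofReal_mul (by positivity), gaussianRatio, ← mul_assoc,
    ← Real.rpow_mul h1.le, ← Real.rpow_add h1]
  have e1 : -(n : ℝ) / 2 + -(1 / 2) * -(n : ℝ) = 0 := by ring
  have e2 : ((1 - ν) ^ (-(1 / 2) : ℝ)) ^ 2 = (1 - ν)⁻¹ := by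
    rw [← Real.rpow_natCast, ← Real.rpow_mul h1.le, ← Real.rpow_neg_one]
    norm_num
  rw [e1, e2, Real.rpow_zero, one_mul, sub_zero]
  congr 3
  field_simp
  ring

/-- Full support turns a.e. equality of continuous kernels into equality everywhere. -/
instance isOpenPosMeasure_stdGaussian : Measure.IsOpenPosMeasure γ := by
  rw [stdGaussian_eq_withDensity]
  exact (withDensity_absolutelyContinuous'
    continuous_stdGaussianPDF.measurable.ennreal_ofReal.aemeasurable
    (ae_of_all _ fun x => by simpa using stdGaussianPDF_pos x)).isOpenPosMeasure

end GaussianDensity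

/-! ### Second-order expansion of powers, with cubic error. -/

section PowerExpansion

/-- Bernoulli's inequality with exponent 1-δ, divided by 1+s. With δ = 1-α it controls the
derivative of (1+s)^α. -/
theorem rpow_neg_le_of_nonneg {δ s : ℝ} (hδ0 : 0 ≤ δ) (hδ1 : δ ≤ 1) (hs : 0 ≤ s) :
    (1 + s) ^ (-δ) ≤ 1 - δ * s + s ^ 2 := by
  have h1 : 0 < 1 + s := by linarith
  have h := rpow_one_add_le_one_add_mul_self (s := s) (by linarith) (p := 1 - δ)
    (by linarith) (by linarith)
  have e : (1 + s) ^ (-δ) = (1 + s) ^ (1 - δ) / (1 + s) := by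
    rw [sub_eq_add_neg, Real.rpow_add h1, Real.rpow_one]
    field_simp
  rw [e, div_le_iff₀ h1]
  nlinarith [mul_nonneg hδ0 hs, mul_nonneg (mul_nonneg (sub_nonneg.2 hδ1) hs) hs,
    mul_nonneg (mul_nonneg hs hs) hs]

/-- Invert Bernoulli's inequality for the exponent δ and use (1-δs)(1+δs) ≤ 1. -/
theorem le_rpow_neg_of_nonpos {δ s : ℝ} (hδ0 : 0 ≤ δ) (hδ1 : δ ≤ 1) (hs : -1 < s) :
    1 - δ * s ≤ (1 + s) ^ (-δ) := by
  have h1 : 0 < 1 + s := by linarith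
  have h := rpow_one_add_le_one_add_mul_self (s := s) (by linarith) (p := δ) hδ0 hδ1
  have hp : 0 < (1 + s) ^ δ := by positivity
  rw [Real.rpow_neg h1.le]
  refine le_trans ?_ (inv_anti₀ hp h)
  rw [← one_div, le_div_iff₀ (hp.trans_le h)]
  nlinarith [sq_nonneg (δ * s)]

/-- Second order expansion of `(1 + s) ^ α`, with one-sided cubic error. -/
theorem one_add_rpow_le {α s : ℝ} (h0 : 0 ≤ α) (h1 : α ≤ 1) (hs : -1 < s) :
    (1 + s) ^ α ≤ 1 + α * s - α * (1 - α) / 2 * s ^ 2 + |s| ^ 3 := by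
  have hd : ∀ x : ℝ, -1 < x → HasDerivAt (fun s : ℝ => (1 + s) ^ α)
      (α * (1 + x) ^ (-(1 - α))) x := fun x hx => by
    have := (((hasDerivAt_id x).const_add 1).rpow_const (p := α) (Or.inl (by simp; linarith)))
    simpa [mul_comm] using this
  rcases le_total 0 s with h | h
  · rw [abs_of_nonneg h]
    -- The difference of the two sides vanishes at 0, so its monotonicity suffices.
    let f : ℝ → ℝ := fun s => 1 + α * s - α * (1 - α) / 2 * s ^ 2 + s ^ 3 - (1 + s) ^ α
    have hf : ∀ x : ℝ, -1 < x → HasDerivAt f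
        (α - α * (1 - α) * x + 3 * x ^ 2 - α * (1 + x) ^ (-(1 - α))) x := fun x hx => by
      have := (((((hasDerivAt_id x).const_mul α).const_add 1).sub
        (((hasDerivAt_pow 2 x).const_mul (α * (1 - α) / 2)))).add (hasDerivAt_pow 3 x)).sub
        (hd x hx)
      refine this.congr_deriv ?_
      push_cast
      ring
    have hm : MonotoneOn f (Ici 0) := by
      refine monotoneOn_of_deriv_nonneg (convex_Ici 0) ?_ ?_ ?_
      · exact fun x hx => (hf x (by linarith [mem_Ici.1 hx])).continuousAt.continuousWithinAt
      · intro x hx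
        rw [interior_Ici] at hx
        exact (hf x (by linarith [mem_Ioi.1 hx])).differentiableAt.differentiableWithinAt
      · intro x hx
        rw [interior_Ici] at hx
        have hx := mem_Ioi.1 hx
        rw [(hf x (by linarith)).deriv]
        have := mul_le_mul_of_nonneg_left
          (rpow_neg_le_of_nonneg (δ := 1 - α) (by linarith) (by linarith) hx.le) h0
        nlinarith [sq_nonneg x]
    have := hm (mem_Ici.2 le_rfl) (mem_Ici.2 h) h
    simp only [f] at this
    norm_num at this
    linarith
  -- On (-1, 0] the quadratic Taylor polynomial is already an upper bound, so the singularity at -1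
  -- does no harm.
  · let f : ℝ → ℝ := fun s => 1 + α * s - α * (1 - α) / 2 * s ^ 2 - (1 + s) ^ α
    have hf : ∀ x : ℝ, -1 < x → HasDerivAt f
        (α - α * (1 - α) * x - α * (1 + x) ^ (-(1 - α))) x := fun x hx => by
      have := ((((hasDerivAt_id x).const_mul α).const_add 1).sub
        (((hasDerivAt_pow 2 x).const_mul (α * (1 - α) / 2)))).sub (hd x hx)
      refine this.congr_deriv ?_
      push_cast
      ring
    have hm : AntitoneOn f (Ioc (-1) 0) := by
      refine antitoneOn_of_deriv_nonpos (convex_Ioc _ _) ?_ ?_ ?_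
      · exact fun x hx => (hf x hx.1).continuousAt.continuousWithinAt
      · intro x hx
        rw [interior_Ioc] at hx
        exact (hf x hx.1).differentiableAt.differentiableWithinAt
      · intro x hx
        rw [interior_Ioc] at hx
        rw [(hf x hx.1).deriv]
        have := mul_le_mul_of_nonneg_left
          (le_rpow_neg_of_nonpos (δ := 1 - α) (by linarith) (by linarith) hx.1) h0
        nlinarith
    have := hm (a := s) (b := 0) ⟨hs, h⟩ ⟨by norm_num, le_rfl⟩ h
    simp only [f] at this
    norm_num at this
    have h3 : 0 ≤ |s| ^ 3 := by positivity
    linarith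

/-- A and B stand for the linear parts of the increments s and r. As ε ≤ 1 ≤ X, each monomial (εX)^j
with 3 ≤ j ≤ 6 is at most ε³X⁶. There are ten such monomials, and replacing s, r by A, B in the
three quadratic terms costs two units each: sixteen in all, below the stated 20. -/
theorem expansion_mul_le {α β c d ε X s r A B : ℝ} (hα0 : 0 ≤ α) (hα1 : α ≤ 1) (hβ0 : 0 ≤ β)
    (hβ1 : β ≤ 1) (hc0 : 0 ≤ c) (hc1 : c ≤ 1) (hd0 : 0 ≤ d) (hd1 : d ≤ 1) (hε0 : 0 ≤ ε)
    (hε1 : ε ≤ 1) (hX : 1 ≤ X) (hs : |s| ≤ ε * X) (hr : |r| ≤ ε * X) (hA : |A| ≤ ε * X)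
    (hB : |B| ≤ ε * X) (hsA : |s - A| ≤ ε ^ 2 * X) (hrB : |r - B| ≤ ε ^ 2 * X) :
    (1 + α * s - c * s ^ 2 + |s| ^ 3) * (1 + β * r - d * r ^ 2 + |r| ^ 3) ≤
      1 + α * s + β * r + (α * β * (A * B) - c * A ^ 2 - d * B ^ 2) + 20 * (ε ^ 3 * X ^ 6) := by
  have hX0 : 0 ≤ X := by linarith
  have key : ∀ j : ℕ, 3 ≤ j → j ≤ 6 → ε ^ j * X ^ j ≤ ε ^ 3 * X ^ 6 := fun j h3 h6 =>
    mul_le_mul (pow_le_pow_of_le_one hε0 hε1 h3) (pow_le_pow_right₀ hX h6) (by positivity)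
      (by positivity)
  have bound : ∀ (k x y : ℝ) (i j : ℕ), |k| ≤ 1 → |x| ≤ (ε * X) ^ i → |y| ≤ (ε * X) ^ j →
      3 ≤ i + j → i + j ≤ 6 → k * (x * y) ≤ ε ^ 3 * X ^ 6 := fun k x y i j hk hx hy h3 h6 => by
    refine (le_abs_self _).trans ?_
    rw [abs_mul, abs_mul]
    calc |k| * (|x| * |y|) ≤ 1 * ((ε * X) ^ i * (ε * X) ^ j) := by gcongr
      _ = ε ^ (i + j) * X ^ (i + j) := by rw [one_mul, ← pow_add, mul_pow]
      _ ≤ _ := key _ h3 h6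
  have pw : ∀ (x : ℝ) (i : ℕ), |x| ≤ ε * X → |x ^ i| ≤ (ε * X) ^ i := fun x i hx => by
    rw [abs_pow]; gcongr
  have pw' : ∀ x : ℝ, |x| ≤ ε * X → |(|x| ^ 3)| ≤ (ε * X) ^ 3 := fun x hx => by
    rw [abs_pow, abs_abs]; gcongr
  have quad : ∀ (k x y x' y' : ℝ), |k| ≤ 1 → |x| ≤ ε * X → |y'| ≤ ε * X →
      |x - x'| ≤ ε ^ 2 * X → |y - y'| ≤ ε ^ 2 * X →
      k * (x * y) - k * (x' * y') ≤ 2 * (ε ^ 3 * X ^ 6) := fun k x y x' y' hk hx hy hxx hyy => by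
    have e : k * (x * y) - k * (x' * y') = k * (x * (y - y') + (x - x') * y') := by ring
    rw [e]
    refine (le_abs_self _).trans ?_
    rw [abs_mul]
    calc |k| * |x * (y - y') + (x - x') * y'|
        ≤ 1 * (|x| * |y - y'| + |x - x'| * |y'|) := by
          gcongr
          exact (abs_add_le _ _).trans (by rw [abs_mul, abs_mul])
      _ ≤ 1 * (ε * X * (ε ^ 2 * X) + ε ^ 2 * X * (ε * X)) := by gcongr
      _ = 2 * (ε ^ 3 * X ^ 2) := by ring
      _ ≤ 2 * (ε ^ 3 * X ^ 6) := by
          gcongr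
          norm_num
  have q1 := quad (α * β) s r A B (by rw [abs_of_nonneg (by positivity)]; nlinarith) hs hB hsA hrB
  have q2 := quad (-c) s s A A (by rw [abs_neg, abs_of_nonneg hc0]; exact hc1) hs hA hsA hsA
  have q3 := quad (-d) r r B B (by rw [abs_neg, abs_of_nonneg hd0]; exact hd1) hr hB hrB hrB
  have hcd : |c * d| ≤ 1 := by rw [abs_of_nonneg (by positivity)]; nlinarith
  have hαd : |-(α * d)| ≤ 1 := by rw [abs_neg, abs_of_nonneg (by positivity)]; nlinarith
  have hβc : |-(β * c)| ≤ 1 := by rw [abs_neg, abs_of_nonneg (by positivity)]; nlinarith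
  have hα : |α| ≤ 1 := by rwa [abs_of_nonneg hα0]
  have hβ : |β| ≤ 1 := by rwa [abs_of_nonneg hβ0]
  have hc : |-c| ≤ 1 := by rwa [abs_neg, abs_of_nonneg hc0]
  have hd : |-d| ≤ 1 := by rwa [abs_neg, abs_of_nonneg hd0]
  have one : |(1 : ℝ)| ≤ 1 := by simp
  have t1 := bound 1 (|s| ^ 3) 1 3 0 one (pw' s hs) (by simp) (by norm_num) (by norm_num)
  have t2 := bound 1 (|r| ^ 3) 1 3 0 one (pw' r hr) (by simp) (by norm_num) (by norm_num)
  have t3 := bound (-(α * d)) (s ^ 1) (r ^ 2) 1 2 hαd (pw s 1 hs) (pw r 2 hr) (by norm_num)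
    (by norm_num)
  have t4 := bound (-(β * c)) (s ^ 2) (r ^ 1) 2 1 hβc (pw s 2 hs) (pw r 1 hr) (by norm_num)
    (by norm_num)
  have t5 := bound α (s ^ 1) (|r| ^ 3) 1 3 hα (pw s 1 hs) (pw' r hr) (by norm_num) (by norm_num)
  have t6 := bound β (r ^ 1) (|s| ^ 3) 1 3 hβ (pw r 1 hr) (pw' s hs) (by norm_num) (by norm_num)
  have t7 := bound (c * d) (s ^ 2) (r ^ 2) 2 2 hcd (pw s 2 hs) (pw r 2 hr) (by norm_num)
    (by norm_num)
  have t8 := bound (-c) (s ^ 2) (|r| ^ 3) 2 3 hc (pw s 2 hs) (pw' r hr) (by norm_num)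
    (by norm_num)
  have t9 := bound (-d) (r ^ 2) (|s| ^ 3) 2 3 hd (pw r 2 hr) (pw' s hs) (by norm_num)
    (by norm_num)
  have t10 := bound 1 (|s| ^ 3) (|r| ^ 3) 3 3 one (pw' s hs) (pw' r hr) (by norm_num)
    (by norm_num)
  have hE : 0 ≤ ε ^ 3 * X ^ 6 := by positivity
  linarith

end PowerExpansion

/-! ### The heat semigroup of a Gaussian measure. -/

section Heat

theorem exists_cos_sin_eq {a b : ℝ} (hab : a ^ 2 + b ^ 2 = 1) :
    ∃ θ : ℝ, Real.cos θ = a ∧ Real.sin θ = b := by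
  have h : ‖(⟨a, b⟩ : ℂ)‖ = 1 := by
    rw [← sq_eq_sq₀ (norm_nonneg _) zero_le_one, Complex.sq_norm, Complex.normSq_mk]
    linarith
  obtain ⟨θ, hθ⟩ := (Complex.norm_eq_one_iff _).1 h
  refine ⟨θ, ?_, ?_⟩
  · simpa [Complex.exp_ofReal_mul_I_re] using congrArg Complex.re hθ
  · simpa [Complex.exp_ofReal_mul_I_im] using congrArg Complex.im hθ

theorem integrable_of_continuous_of_bound {V : Type*} [TopologicalSpace V] [MeasurableSpace V]
    [OpensMeasurableSpace V] {μ : Measure V} [IsFiniteMeasure μ] {f : V → ℝ} (hf : Continuous f)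
    {C : ℝ} (hC : ∀ x, |f x| ≤ C) : Integrable f μ :=
  Integrable.of_bound hf.measurable.aestronglyMeasurable C (ae_of_all _ hC)

variable {V : Type*} [NormedAddCommGroup V] [NormedSpace ℝ V] [MeasurableSpace V] [BorelSpace V]

/-- The heat semigroup `f ↦ E[f (x + √h Z)]` of a Gaussian measure. -/
noncomputable def heat (μ : Measure V) (h : ℝ) (f : V → ℝ) (x : V) : ℝ :=
  ∫ z, f (x + Real.sqrt h • z) ∂μ

variable {μ : Measure V}

/-- A product of two copies of a centred Gaussian measure is rotation invariant; project the rotated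
pair to its first coordinate. -/
theorem map_smul_add_smul [CompleteSpace V] [SecondCountableTopology V] [IsGaussian μ]
    (hμ : μ[id] = 0) {a b : ℝ} (hab : a ^ 2 + b ^ 2 = 1) :
    (μ.prod μ).map (fun p => a • p.1 + b • p.2) = μ := by
  obtain ⟨θ, rfl, rfl⟩ := exists_cos_sin_eq hab
  have h := congrArg (Measure.map Prod.fst) (IsGaussian.map_rotation_eq_self hμ θ)
  rw [Measure.map_map measurable_fst (by fun_prop), Measure.map_fst_prod, measure_univ,
    one_smul] at h
  exact h

theorem continuous_heat [IsFiniteMeasure μ] [SecondCountableTopology V] (h : ℝ) {f : V → ℝ}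
    (hf : Continuous f) {C : ℝ} (hC : ∀ x, |f x| ≤ C) : Continuous (heat μ h f) := by
  refine continuous_of_dominated (bound := fun _ => C) (fun x => ?_)
    (fun x => ae_of_all _ fun z => hC _) (integrable_const C) (ae_of_all _ fun z => by fun_prop)
  exact Continuous.aestronglyMeasurable (by fun_prop)

/-- For independent Z, W the vector √s Z + √h W has the law of √(s+h) Z. A general Gaussian μ is
allowed because the flow is run both for γ and for γ × γ. -/
theorem heat_heat [CompleteSpace V] [SecondCountableTopology V] [IsGaussian μ]
    (hμ : μ[id] = 0) {s h : ℝ} (hs : 0 ≤ s) (hh : 0 ≤ h) {f : V → ℝ} (hf : Continuous f) {C : ℝ}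
    (hC : ∀ x, |f x| ≤ C) (x : V) : heat μ s (heat μ h f) x = heat μ (s + h) f x := by
  rcases (add_nonneg hs hh).eq_or_lt with h0 | h0
  · obtain ⟨rfl, rfl⟩ := (add_eq_zero_iff_of_nonneg hs hh).1 h0.symm
    simp [heat]
  have hc : 0 < Real.sqrt (s + h) := Real.sqrt_pos.2 h0
  have hab : (Real.sqrt s / Real.sqrt (s + h)) ^ 2 + (Real.sqrt h / Real.sqrt (s + h)) ^ 2 = 1 := by
    rw [div_pow, div_pow, Real.sq_sqrt hs, Real.sq_sqrt hh, Real.sq_sqrt h0.le]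
    field_simp
  unfold heat
  have e := map_smul_add_smul hμ hab
  conv_rhs => rw [← e]
  rw [integral_map (by fun_prop) (Continuous.aestronglyMeasurable (by fun_prop)),
    integral_prod _ (Integrable.of_bound (Continuous.aestronglyMeasurable (by fun_prop)) C
      (ae_of_all _ fun _ => hC _))]
  refine integral_congr_ae (ae_of_all _ fun z => integral_congr_ae (ae_of_all _ fun w => ?_))
  simp only [smul_add, smul_smul, mul_div_cancel₀ _ hc.ne', add_assoc]

theorem heat_mono [IsFiniteMeasure μ] [SecondCountableTopology V] (h : ℝ) {f g : V → ℝ}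
    (hf : Continuous f) {C : ℝ} (hC : ∀ x, |f x| ≤ C) (hg : Continuous g) {C' : ℝ}
    (hC' : ∀ x, |g x| ≤ C') (hfg : ∀ x, f x ≤ g x) (x : V) : heat μ h f x ≤ heat μ h g x :=
  integral_mono (integrable_of_continuous_of_bound (by fun_prop) fun _ => hC _)
    (integrable_of_continuous_of_bound (by fun_prop) fun _ => hC' _) fun _ => hfg _

theorem heat_add_const [IsProbabilityMeasure μ] [SecondCountableTopology V] (h : ℝ) {f : V → ℝ}
    (hf : Continuous f) {C : ℝ} (hC : ∀ x, |f x| ≤ C) (c : ℝ) (x : V) :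
    heat μ h (fun y => f y + c) x = heat μ h f x + c := by
  unfold heat
  rw [integral_add (integrable_of_continuous_of_bound (by fun_prop) fun _ => hC _)
    (integrable_const c)]
  simp

end Heat

/-! ### Bounded C^{1,1} functions and their stability. -/

section SmoothBounded

variable {n : ℕ}

local notation "𝔼" => EuclideanSpace ℝ (Fin n)
local notation "γ" => stdGaussian (EuclideanSpace ℝ (Fin n))

/-- `F` takes values in `[a, b]` and is of class `C^{1,1}` with gradient `D`, with constants
bounded by `L`. -/
structure SmoothBounded (a b L : ℝ) (F : 𝔼 → ℝ) (D : 𝔼 → 𝔼) : Prop where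
  lower : ∀ x, a ≤ F x
  upper : ∀ x, F x ≤ b
  continuous : Continuous F
  continuous_grad : Continuous D
  norm_grad : ∀ x, ‖D x‖ ≤ L
  lipschitz : ∀ x z, |F (x + z) - F x| ≤ L * ‖z‖
  taylor : ∀ x z, |F (x + z) - F x - inner ℝ (D x) z| ≤ L * ‖z‖ ^ 2

namespace SmoothBounded

variable {a b L : ℝ} {F : EuclideanSpace ℝ (Fin n) → ℝ}
  {D : EuclideanSpace ℝ (Fin n) → EuclideanSpace ℝ (Fin n)}

theorem abs_le (hF : SmoothBounded a b L F D) (x : 𝔼) : |F x| ≤ max |a| |b| :=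
  abs_le_max_abs_abs (hF.lower x) (hF.upper x)

theorem integrable_comp (hF : SmoothBounded a b L F D) {V : Type*} [MeasurableSpace V]
    {μ : Measure V} [IsFiniteMeasure μ] {φ : V → 𝔼} (hφ : Measurable φ) :
    Integrable (fun v => F (φ v)) μ :=
  Integrable.of_bound (hF.continuous.measurable.comp hφ).aestronglyMeasurable _
    (ae_of_all _ fun _ => hF.abs_le _)

theorem nonneg (hF : SmoothBounded a b L F D) : 0 ≤ L := (norm_nonneg _).trans (hF.norm_grad 0)

theorem integrable_grad_comp (hF : SmoothBounded a b L F D) {V : Type*} [MeasurableSpace V]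
    {μ : Measure V} [IsFiniteMeasure μ] {φ : V → 𝔼} (hφ : Measurable φ) :
    Integrable (fun v => D (φ v)) μ :=
  Integrable.of_bound (hF.continuous_grad.measurable.comp hφ).aestronglyMeasurable L
    (ae_of_all _ fun _ => hF.norm_grad _)

/-- Averaging translates does not worsen any of the constants. This keeps the error of a time step
uniform along the whole flow. -/
theorem heatFlow (hF : SmoothBounded a b L F D) (h : ℝ) :
    SmoothBounded a b L (heat γ h F) (fun x => ∫ z, D (x + Real.sqrt h • z) ∂γ) := by
  have hi : ∀ x : 𝔼, Integrable (fun z => F (x + Real.sqrt h • z)) γ := fun x =>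
    hF.integrable_comp (φ := fun z => x + Real.sqrt h • z) (by fun_prop)
  have hD : ∀ x : 𝔼, Integrable (fun z => D (x + Real.sqrt h • z)) γ := fun x =>
    hF.integrable_grad_comp (φ := fun z => x + Real.sqrt h • z) (by fun_prop)
  have bd : ∀ {f : 𝔼 → ℝ} {c : ℝ}, (∀ z, |f z| ≤ c) → |∫ z, f z ∂γ| ≤ c := fun {f c} hc => by
    have := norm_integral_le_of_norm_le_const (μ := γ) (f := f) (C := c) (ae_of_all _ hc)
    simpa using this
  refine ⟨fun x => ?_, fun x => ?_, continuous_heat h hF.continuous hF.abs_le, ?_, fun x => ?_,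
    fun x z => ?_, fun x z => ?_⟩
  · have := integral_mono (integrable_const a) (hi x) fun z => hF.lower _
    simpa [heat] using this
  · have := integral_mono (hi x) (integrable_const b) fun z => hF.upper _
    simpa [heat] using this
  · have hc := hF.continuous_grad
    refine continuous_of_dominated (bound := fun _ => L) (fun x => ?_)
      (fun x => ae_of_all _ fun z => hF.norm_grad _) (integrable_const L)
      (ae_of_all _ fun z => by fun_prop)
    exact Continuous.aestronglyMeasurable (by fun_prop)
  · have := norm_integral_le_of_norm_le_const (μ := γ) (f := fun z => D (x + Real.sqrt h • z))
      (C := L) (ae_of_all _ fun z => hF.norm_grad _)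
    simpa using this
  · unfold heat
    rw [← integral_sub (hi _) (hi _)]
    refine bd fun w => ?_
    rw [add_right_comm]
    exact hF.lipschitz _ _
  · unfold heat
    have e : inner ℝ (∫ w, D (x + Real.sqrt h • w) ∂γ) z =
        ∫ w, inner ℝ (D (x + Real.sqrt h • w)) z ∂γ := by
      rw [real_inner_comm, ← integral_inner (hD x)]
      simp_rw [real_inner_comm]
    rw [e, ← integral_sub (hi _) (hi _), ← integral_sub (by exact (hi _).sub (hi _))
      ((hD x).inner_const z)]
    refine bd fun w => ?_
    rw [add_right_comm]
    exact hF.taylor _ _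

theorem mono {a' b' L' : ℝ} (hF : SmoothBounded a b L F D) (ha : a' ≤ a) (hb : b ≤ b')
    (hL : L ≤ L') : SmoothBounded a' b' L' F D where
  lower x := ha.trans (hF.lower x)
  upper x := (hF.upper x).trans hb
  continuous := hF.continuous
  continuous_grad := hF.continuous_grad
  norm_grad x := (hF.norm_grad x).trans hL
  lipschitz x z := (hF.lipschitz x z).trans (by gcongr)
  taylor x z := (hF.taylor x z).trans (by gcongr)

end SmoothBounded

theorem exists_quadratic_bound {φ : ℝ → ℝ} {a b : ℝ} {U : Set ℝ} (hU : IsOpen U)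
    (hab : Icc a b ⊆ U) (hφ : ContDiffOn ℝ 2 φ U) :
    ∃ K : ℝ, 0 ≤ K ∧ (∀ u ∈ Icc a b, |deriv φ u| ≤ K) ∧
      (∀ u ∈ Icc a b, ∀ v ∈ Icc a b, |φ v - φ u| ≤ K * |v - u|) ∧
      (∀ u ∈ Icc a b, ∀ v ∈ Icc a b, |φ v - φ u - deriv φ u * (v - u)| ≤ K * |v - u| ^ 2) := by
  have h1 : ContDiffOn ℝ 1 (deriv φ) U := hφ.deriv_of_isOpen hU (by norm_num)
  have h2 : ContinuousOn (deriv (deriv φ)) U := h1.continuousOn_deriv_of_isOpen hU (by norm_num)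
  obtain ⟨K1, hK1⟩ := isCompact_Icc.exists_bound_of_continuousOn (h1.continuousOn.mono hab)
  obtain ⟨K2, hK2⟩ := isCompact_Icc.exists_bound_of_continuousOn (h2.mono hab)
  have d1 : ∀ u ∈ U, HasDerivAt φ (deriv φ u) u := fun u hu =>
    ((hφ.differentiableOn (by norm_num)).differentiableAt (hU.mem_nhds hu)).hasDerivAt
  have d2 : ∀ u ∈ U, HasDerivAt (deriv φ) (deriv (deriv φ) u) u := fun u hu =>
    ((h1.differentiableOn (by norm_num)).differentiableAt (hU.mem_nhds hu)).hasDerivAt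
  refine ⟨max 0 (max K1 K2), le_max_left _ _, fun u hu => (hK1 u hu).trans (by simp),
    fun u hu v hv => ?_, fun u hu v hv => ?_⟩
  · exact (convex_Icc a b).norm_image_sub_le_of_norm_hasDerivWithin_le
      (fun x hx => (d1 x (hab hx)).hasDerivWithinAt) (fun x hx => (hK1 x hx).trans (by simp)) hu hv
  · have hsub : uIcc u v ⊆ Icc a b := (ordConnected_Icc).uIcc_subset hu hv
    have key : ∀ x ∈ uIcc u v, ‖deriv φ x - deriv φ u‖ ≤ max 0 (max K1 K2) * |v - u| :=
      fun x hx => by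
      have := (convex_Icc a b).norm_image_sub_le_of_norm_hasDerivWithin_le
        (fun x hx => (d2 x (hab hx)).hasDerivWithinAt)
        (fun x hx => (hK2 x hx).trans (show K2 ≤ max 0 (max K1 K2) by simp)) hu (hsub hx)
      refine this.trans ?_
      gcongr
      have := abs_sub_left_of_mem_uIcc hx
      simpa using this
    -- The mean value inequality for x ↦ φ(x) - φ'(u)x, whose derivative is at most a constant times
    -- |v-u| between u and v.
    have := (convex_uIcc u v).norm_image_sub_le_of_norm_hasDerivWithin_le
      (f := fun x => φ x - deriv φ u * x)
      (fun x hx => ((d1 x (hab (hsub hx))).sub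
        ((hasDerivAt_id x).const_mul (deriv φ u))).hasDerivWithinAt)
      (fun x hx => by simpa using key x hx) left_mem_uIcc right_mem_uIcc
    rw [Real.norm_eq_abs, Real.norm_eq_abs] at this
    calc _ = |φ v - deriv φ u * v - (φ u - deriv φ u * u)| := by congr 1; ring
      _ ≤ _ := this
      _ = _ := by ring

namespace SmoothBounded

variable {a b L : ℝ} {F : EuclideanSpace ℝ (Fin n) → ℝ}
  {D : EuclideanSpace ℝ (Fin n) → EuclideanSpace ℝ (Fin n)}

/-- As F stays in the compact interval [a, b], φ only has to be C² near it: this admits powers,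
which are singular at 0, when a > 0. The other use is φ(u) = √(u² + ε²). -/
theorem exists_comp (hF : SmoothBounded a b L F D) {φ : ℝ → ℝ} {U : Set ℝ} (hU : IsOpen U)
    (hab : Icc a b ⊆ U) (hφ : ContDiffOn ℝ 2 φ U) {a' b' : ℝ}
    (hφab : ∀ u ∈ Icc a b, φ u ∈ Icc a' b') :
    ∃ L', SmoothBounded a' b' L' (fun x => φ (F x)) (fun x => deriv φ (F x) • D x) := by
  obtain ⟨K, hK0, hK1, hK2, hK3⟩ := exists_quadratic_bound hU hab hφ
  have hL := hF.nonneg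
  have mem : ∀ x, F x ∈ Icc a b := fun x => ⟨hF.lower x, hF.upper x⟩
  have h1 : ContDiffOn ℝ 1 (deriv φ) U := hφ.deriv_of_isOpen hU (by norm_num)
  refine ⟨K * L + K * L ^ 2, fun x => (hφab _ (mem x)).1, fun x => (hφab _ (mem x)).2,
    hφ.continuousOn.comp_continuous hF.continuous fun x => hab (mem x),
    (h1.continuousOn.comp_continuous hF.continuous fun x => hab (mem x)).smul hF.continuous_grad,
    fun x => ?_, fun x z => ?_, fun x z => ?_⟩
  · rw [norm_smul]
    calc ‖deriv φ (F x)‖ * ‖D x‖ ≤ K * L :=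
          mul_le_mul (hK1 _ (mem x)) (hF.norm_grad x) (norm_nonneg _) hK0
      _ ≤ _ := le_add_of_nonneg_right (by positivity)
  · calc _ ≤ K * |F (x + z) - F x| := hK2 _ (mem _) _ (mem _)
      _ ≤ K * (L * ‖z‖) := by gcongr; exact hF.lipschitz x z
      _ = (K * L) * ‖z‖ := by ring
      _ ≤ _ := by gcongr; exact le_add_of_nonneg_right (by positivity)
  · have e : φ (F (x + z)) - φ (F x) - inner ℝ (deriv φ (F x) • D x) z =
        (φ (F (x + z)) - φ (F x) - deriv φ (F x) * (F (x + z) - F x)) +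
          deriv φ (F x) * (F (x + z) - F x - inner ℝ (D x) z) := by
      rw [real_inner_smul_left]; ring
    rw [e]
    refine (abs_add_le _ _).trans ?_
    rw [abs_mul]
    calc _ ≤ K * |F (x + z) - F x| ^ 2 + K * (L * ‖z‖ ^ 2) := by
          gcongr
          exacts [hK3 _ (mem _) _ (mem _), hK1 _ (mem x), hF.taylor x z]
      _ ≤ K * (L * ‖z‖) ^ 2 + K * (L * ‖z‖ ^ 2) := by gcongr; exact hF.lipschitz x z
      _ = _ := by ring

theorem exists_of_hasCompactSupport {g : 𝔼 → ℝ} (hg : ContDiff ℝ 2 g) (hs : HasCompactSupport g) :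
    ∃ B L D, SmoothBounded (-B) B L g D := by
  obtain ⟨B, hB⟩ := hs.exists_bound_of_continuous hg.continuous
  have hd : ContDiff ℝ 1 (fderiv ℝ g) := hg.fderiv_right (by norm_num)
  have hds : HasCompactSupport (fderiv ℝ g) := hs.fderiv ℝ
  obtain ⟨L1, hL1⟩ := hds.exists_bound_of_continuous hd.continuous
  obtain ⟨L2, hL2⟩ := hd.lipschitzWith_of_hasCompactSupport hds (by norm_num)
  have hdiff : ∀ x, HasFDerivAt g (fderiv ℝ g x) x := fun x =>
    (hg.differentiable (by norm_num) x).hasFDerivAt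
  refine ⟨B, max L1 L2, fun x => (InnerProductSpace.toDual ℝ 𝔼).symm (fderiv ℝ g x),
    fun x => (_root_.abs_le.1 (hB x)).1, fun x => (_root_.abs_le.1 (hB x)).2,
    hg.continuous, ?_, fun x => ?_,
    fun x z => ?_, fun x z => ?_⟩
  · exact (LinearIsometryEquiv.continuous _).comp hd.continuous
  · rw [LinearIsometryEquiv.norm_map]
    exact (hL1 x).trans (le_max_left _ _)
  · have := convex_univ.norm_image_sub_le_of_norm_hasFDerivWithin_le
      (fun x _ => (hdiff x).hasFDerivWithinAt) (fun x _ => (hL1 x).trans (le_max_left L1 L2))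
      (mem_univ x) (mem_univ (x + z))
    simpa using this
  · have key : ∀ y ∈ segment ℝ x (x + z), ‖fderiv ℝ g y - fderiv ℝ g x‖ ≤ max L1 L2 * ‖z‖ :=
      fun y hy => by
      have h1 := hL2.dist_le_mul y x
      rw [dist_eq_norm, dist_eq_norm] at h1
      refine h1.trans ?_
      gcongr
      · exact le_max_right _ _
      · have := norm_sub_le_of_mem_segment hy
        simpa using this
    have := (convex_segment x (x + z)).norm_image_sub_le_of_norm_hasFDerivWithin_le'
      (fun x _ => (hdiff x).hasFDerivWithinAt) key (left_mem_segment _ _ _)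
      (right_mem_segment _ _ _)
    simp only [add_sub_cancel_left] at this
    rw [InnerProductSpace.toDual_symm_apply, pow_two, ← mul_assoc]
    exact this

end SmoothBounded

end SmoothBounded

/-! ### Correlated Gaussian pairs: moments and increments. -/

section GaussianCoupling

variable {n : ℕ}

local notation "𝔼" => EuclideanSpace ℝ (Fin n)
local notation "γ" => stdGaussian (EuclideanSpace ℝ (Fin n))

theorem integral_inner_stdGaussian (d : 𝔼) : ∫ z, inner ℝ d z ∂γ = 0 := by
  simpa using integral_strongDual_stdGaussian (innerSL ℝ d)

theorem integrable_norm_pow_of_isGaussian {V : Type*} [NormedAddCommGroup V] [NormedSpace ℝ V]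
    [MeasurableSpace V] [BorelSpace V] [CompleteSpace V] [SecondCountableTopology V]
    (μ : Measure V) [IsGaussian μ] (k : ℕ) : Integrable (fun v => ‖v‖ ^ k) μ := by
  rcases eq_or_ne k 0 with rfl | hk
  · simp
  · exact (IsGaussian.memLp_id μ k (by simp)).integrable_norm_pow hk

theorem integral_id_stdGaussian_prod : (Measure.prod γ γ)[id] = 0 := by
  have hi : Integrable id (Measure.prod γ γ) := IsGaussian.integrable_id
  refine Prod.ext ?_ ?_
  · have := (ContinuousLinearMap.fst ℝ 𝔼 𝔼).integral_comp_comm hi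
    simp only [ContinuousLinearMap.coe_fst', id] at this
    rw [show (∫ x, id x ∂Measure.prod γ γ).1 = _ from this.symm, integral_fun_fst (fun x : 𝔼 => x)]
    simp
  · have := (ContinuousLinearMap.snd ℝ 𝔼 𝔼).integral_comp_comm hi
    simp only [ContinuousLinearMap.coe_snd', id] at this
    rw [show (∫ x, id x ∂Measure.prod γ γ).2 = _ from this.symm, integral_fun_snd (fun x : 𝔼 => x)]
    simp

theorem integral_prod_comp_rotation {ρ σ : ℝ} (h : ρ ^ 2 + σ ^ 2 = 1) {f : 𝔼 → ℝ}
    (hf : Continuous f) :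
    ∫ u, f (ρ • u.1 + σ • u.2) ∂(Measure.prod γ γ) = ∫ z, f z ∂γ := by
  conv_rhs => rw [← map_smul_add_smul (μ := γ) (by simp) h]
  rw [integral_map (by fun_prop) hf.aestronglyMeasurable]

/-- The discriminant condition, after multiplication by 4c and completion of the square. -/
theorem quadratic_nonpos {k c d x y : ℝ} (hc : 0 < c) (h : k ^ 2 ≤ 4 * c * d) :
    k * (x * y) - c * x ^ 2 - d * y ^ 2 ≤ 0 := by
  have : 0 ≤ 4 * c * (c * x ^ 2 - k * (x * y) + d * y ^ 2) := by
    nlinarith [sq_nonneg (2 * c * x - k * y), mul_nonneg (sub_nonneg.2 h) (sq_nonneg y)]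
  have := nonneg_of_mul_nonneg_right this (by positivity)
  linarith

/-- The quadratic part of the expansion has non-positive mean under the coupling. -/
theorem integral_quadratic_nonpos {ρ σ k c d : ℝ} (h : ρ ^ 2 + σ ^ 2 = 1) (hc : 0 < c)
    (hk : (k * ρ) ^ 2 ≤ 4 * c * d) (v w : 𝔼) :
    ∫ u, (k * (inner ℝ v u.1 * inner ℝ w (ρ • u.1 + σ • u.2)) - c * inner ℝ v u.1 ^ 2 -
      d * inner ℝ w (ρ • u.1 + σ • u.2) ^ 2) ∂(Measure.prod γ γ) ≤ 0 := by
  have hinner : ∀ v : 𝔼, MemLp (fun z => inner ℝ v z) 2 γ := fun v =>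
    (innerSL ℝ v).comp_memLp' IsGaussian.memLp_two_id
  have hsq : ∀ v w : 𝔼, Integrable (fun z => inner ℝ v z * inner ℝ w z) γ := fun v w =>
    (hinner v).integrable_mul (hinner w)
  have i1 : Integrable (fun u : 𝔼 × 𝔼 => inner ℝ v u.1 * inner ℝ w u.1) (Measure.prod γ γ) :=
    (hsq v w).comp_fst _
  have i2 : Integrable (fun u : 𝔼 × 𝔼 => inner ℝ v u.1 * inner ℝ w u.2) (Measure.prod γ γ) :=
    ((hinner v).integrable (by norm_num)).mul_prod ((hinner w).integrable (by norm_num))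
  have i3 : Integrable (fun u : 𝔼 × 𝔼 => inner ℝ v u.1 ^ 2) (Measure.prod γ γ) := by
    simp_rw [pow_two]; exact (hsq v v).comp_fst _
  have i4'' : ∀ v : 𝔼, Integrable (fun z : 𝔼 => inner ℝ v z ^ 2) γ := fun v => by
    simp_rw [pow_two]; exact hsq v v
  have i4 : Integrable (fun u : 𝔼 × 𝔼 => inner ℝ w (ρ • u.1 + σ • u.2) ^ 2)
      (Measure.prod γ γ) := by
    have := i4'' w
    rw [← map_smul_add_smul (μ := γ) (by simp) h] at this
    exact this.comp_measurable (by fun_prop)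
  -- The σ-part of the mixed term integrates to zero by independence and centring, which leaves the
  -- coefficient kρ.
  have e : ∀ u : 𝔼 × 𝔼, k * (inner ℝ v u.1 * inner ℝ w (ρ • u.1 + σ • u.2)) -
      c * inner ℝ v u.1 ^ 2 - d * inner ℝ w (ρ • u.1 + σ • u.2) ^ 2 =
      k * ρ * (inner ℝ v u.1 * inner ℝ w u.1) + k * σ * (inner ℝ v u.1 * inner ℝ w u.2) -
      c * inner ℝ v u.1 ^ 2 - d * inner ℝ w (ρ • u.1 + σ • u.2) ^ 2 := fun u => by
    rw [inner_add_right, real_inner_smul_right, real_inner_smul_right]; ring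
  simp_rw [e]
  rw [integral_sub (by exact ((i1.const_mul _).add (i2.const_mul _)).sub (i3.const_mul _))
      (i4.const_mul _),
    integral_sub (by exact (i1.const_mul _).add (i2.const_mul _)) (i3.const_mul _),
    integral_add (i1.const_mul _) (i2.const_mul _), integral_const_mul, integral_const_mul,
    integral_const_mul, integral_const_mul,
    integral_prod_comp_rotation h (f := fun z => inner ℝ w z ^ 2) (by fun_prop),
    integral_prod_mul (fun z => inner ℝ v z) (fun z => inner ℝ w z), integral_inner_stdGaussian,
    zero_mul, mul_zero, add_zero, integral_fun_fst (fun z : 𝔼 => inner ℝ v z * inner ℝ w z),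
    integral_fun_fst (fun z : 𝔼 => inner ℝ v z ^ 2)]
  simp only [probReal_univ, one_smul]
  -- All three terms are now integrals over one copy of γ, and the combined integrand is
  -- non-positive pointwise.
  rw [← integral_const_mul, ← integral_const_mul, ← integral_const_mul,
    ← integral_sub ((hsq v w).const_mul _) ((i4'' v).const_mul _),
    ← integral_sub (by exact ((hsq v w).const_mul _).sub ((i4'' v).const_mul _))
      ((i4'' w).const_mul _)]
  exact integral_nonpos fun z => quadratic_nonpos hc hk

/-- The relative increment of `F` and its linear part. -/
theorem SmoothBounded.increment_bounds {a b L : ℝ} (ha : 0 < a) {F : 𝔼 → ℝ} {D : 𝔼 → 𝔼}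
    (hF : SmoothBounded a b L F D) {h : ℝ} (h1 : h ≤ 1) (x z : 𝔼) {W : ℝ}
    (hW : 1 + ∫ y, ‖y‖ ^ 2 ∂γ + ‖z‖ ^ 2 ≤ W) :
    |F (x + Real.sqrt h • z) / heat γ h F x - 1| ≤ Real.sqrt h * ((1 + 2 * (L / a)) * W) ∧
    |Real.sqrt h * inner ℝ (D x) z / heat γ h F x| ≤ Real.sqrt h * ((1 + 2 * (L / a)) * W) ∧
    |F (x + Real.sqrt h • z) / heat γ h F x - 1 - Real.sqrt h * inner ℝ (D x) z / heat γ h F x| ≤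
      Real.sqrt h ^ 2 * ((1 + 2 * (L / a)) * W) := by
  have hL := hF.nonneg
  set m2 := ∫ y, ‖y‖ ^ 2 ∂γ with hm2
  set ε := Real.sqrt h with hε
  have hε0 : 0 ≤ ε := Real.sqrt_nonneg h
  have hε1 : ε ≤ 1 := by rw [hε]; exact Real.sqrt_le_one.2 h1
  have hm0 : 0 ≤ m2 := integral_nonneg fun _ => by positivity
  have hu : a ≤ heat γ h F x := (hF.heatFlow h).lower x
  set u0 := heat γ h F x with hu0
  have hu0p : 0 < u0 := ha.trans_le hu
  have tay : ∀ z, |F (x + ε • z) - F x - ε * inner ℝ (D x) z| ≤ L * ε ^ 2 * ‖z‖ ^ 2 := fun z => by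
    have := hF.taylor x (ε • z)
    rw [real_inner_smul_right, norm_smul, Real.norm_of_nonneg hε0] at this
    calc _ ≤ _ := this
      _ = _ := by ring
  have iF : Integrable (fun z => F (x + ε • z)) γ :=
    hF.integrable_comp (φ := fun z => x + ε • z) (by fun_prop)
  have iD : Integrable (fun z : 𝔼 => inner ℝ (D x) z) γ :=
    (innerSL ℝ (D x)).integrable_comp IsGaussian.integrable_id
  -- The linear Taylor term has mean zero, so the local mean differs from F(x) only at second order
  -- in ε.
  have mean : |u0 - F x| ≤ L * ε ^ 2 * m2 := by
    have e : u0 - F x = ∫ z, (F (x + ε • z) - F x - ε * inner ℝ (D x) z) ∂γ := by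
      rw [integral_sub (by exact iF.sub (integrable_const _)) (iD.const_mul _),
        integral_sub iF (integrable_const _), integral_const_mul, integral_inner_stdGaussian]
      simp [hu0, heat, hε]
    rw [e, hm2, ← integral_const_mul]
    exact norm_integral_le_of_norm_le ((integrable_norm_pow_of_isGaussian γ 2).const_mul _)
      (ae_of_all _ fun z => by rw [Real.norm_eq_abs]; exact tay z)
  have key : |F (x + ε • z) - u0 - ε * inner ℝ (D x) z| ≤ L * ε ^ 2 * (‖z‖ ^ 2 + m2) := by
    have e : F (x + ε • z) - u0 - ε * inner ℝ (D x) z =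
      (F (x + ε • z) - F x - ε * inner ℝ (D x) z) - (u0 - F x) := by ring
    rw [e]
    refine (abs_sub _ _).trans ?_
    linarith [tay z, mean]
  have lin : |ε * inner ℝ (D x) z| ≤ ε * (L * ‖z‖) := by
    rw [abs_mul, abs_of_nonneg hε0]
    gcongr
    exact (abs_real_inner_le_norm _ _).trans (by gcongr; exact hF.norm_grad x)
  have hz : ‖z‖ ≤ W := by nlinarith [sq_nonneg (‖z‖ - 1)]
  have hW0 : 0 ≤ W := (norm_nonneg z).trans hz
  have hzW : ‖z‖ ^ 2 + m2 ≤ W := by linarith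
  have scale : ∀ y C : ℝ, 0 ≤ C → |y| ≤ L * C → |y / u0| ≤ (L / a) * C := fun y C hC hy => by
    rw [abs_div, abs_of_pos hu0p, div_le_iff₀ hu0p]
    calc |y| ≤ L * C := hy
      _ = (L / a) * C * a := by field_simp
      _ ≤ (L / a) * C * u0 := by gcongr
  have hκ : 0 ≤ L / a := by positivity
  have b3 : |F (x + ε • z) / u0 - 1 - ε * inner ℝ (D x) z / u0| ≤ L / a * (ε ^ 2 * W) := by
    have e : F (x + ε • z) / u0 - 1 - ε * inner ℝ (D x) z / u0 =
      (F (x + ε • z) - u0 - ε * inner ℝ (D x) z) / u0 := by field_simp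
    rw [e]
    refine scale _ _ (by positivity) (key.trans ?_)
    rw [mul_assoc]
    gcongr
  have b2 : |ε * inner ℝ (D x) z / u0| ≤ L / a * (ε * W) := by
    refine scale _ _ (by positivity) (lin.trans ?_)
    calc ε * (L * ‖z‖) = L * (ε * ‖z‖) := by ring
      _ ≤ _ := by gcongr
  have p1 : 0 ≤ ε * W := by positivity
  have p2 : 0 ≤ L / a * (ε * W) := by positivity
  have p3 : 0 ≤ ε ^ 2 * W := by positivity
  have p4 : 0 ≤ L / a * (ε ^ 2 * W) := by positivity
  refine ⟨?_, by nlinarith, by nlinarith⟩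
  have e : F (x + ε • z) / u0 - 1 = (F (x + ε • z) / u0 - 1 - ε * inner ℝ (D x) z / u0) +
    ε * inner ℝ (D x) z / u0 := by ring
  rw [e]
  refine (abs_add_le _ _).trans ?_
  have : L / a * (ε ^ 2 * W) ≤ L / a * (ε * W) := by
    gcongr
    nlinarith
  nlinarith

end GaussianCoupling

/-! ### One time step of the bilinear inequality. -/

section BilinearInequality

variable {n : ℕ}

local notation "𝔼" => EuclideanSpace ℝ (Fin n)
local notation "γ" => stdGaussian (EuclideanSpace ℝ (Fin n))

/-- The function `(x, w) ↦ F(x)^α G(ρ x + σ w)^β` on the space of two independent variables. -/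
noncomputable def couplingProduct (ρ σ α β : ℝ) (F G : 𝔼 → ℝ) (v : 𝔼 × 𝔼) : ℝ :=
  F v.1 ^ α * G (ρ • v.1 + σ • v.2) ^ β

theorem SmoothBounded.continuous_couplingProduct {a b L ρ σ α β : ℝ} (ha : 0 < a) {F G : 𝔼 → ℝ}
    {D D' : 𝔼 → 𝔼} (hF : SmoothBounded a b L F D) (hG : SmoothBounded a b L G D') :
    Continuous (couplingProduct ρ σ α β F G) := by
  have h1 := hF.continuous
  have h2 := hG.continuous
  unfold couplingProduct
  refine Continuous.mul (Continuous.rpow_const (by fun_prop) fun v => Or.inl ?_)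
    (Continuous.rpow_const (by fun_prop) fun v => Or.inl ?_)
  · exact (ha.trans_le (hF.lower _)).ne'
  · exact (ha.trans_le (hG.lower _)).ne'

theorem SmoothBounded.abs_couplingProduct_le {a b L ρ σ α β : ℝ} (ha : 0 < a) (hα : 0 ≤ α)
    (hβ : 0 ≤ β) {F G : 𝔼 → ℝ} {D D' : 𝔼 → 𝔼} (hF : SmoothBounded a b L F D)
    (hG : SmoothBounded a b L G D') (v : 𝔼 × 𝔼) :
    |couplingProduct ρ σ α β F G v| ≤ b ^ α * b ^ β := by
  have h1 : ∀ x, 0 ≤ F x := fun x => ha.le.trans (hF.lower x)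
  have h2 : ∀ x, 0 ≤ G x := fun x => ha.le.trans (hG.lower x)
  have hb : 0 ≤ b := (h1 0).trans (hF.upper 0)
  unfold couplingProduct
  rw [abs_of_nonneg (mul_nonneg (Real.rpow_nonneg (h1 _) _) (Real.rpow_nonneg (h2 _) _))]
  exact mul_le_mul (Real.rpow_le_rpow (h1 _) (hF.upper _) hα)
    (Real.rpow_le_rpow (h2 _) (hG.upper _) hβ) (Real.rpow_nonneg (h2 _) _)
    (Real.rpow_nonneg hb _)

/-- A weight dominating the increments along the coupling. -/
noncomputable def couplingWeight (ρ σ : ℝ) (u : 𝔼 × 𝔼) : ℝ :=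
  1 + ∫ y, ‖y‖ ^ 2 ∂γ + (‖u.1‖ ^ 2 + ‖ρ • u.1 + σ • u.2‖ ^ 2)

theorem one_le_couplingWeight (ρ σ : ℝ) (u : 𝔼 × 𝔼) : 1 ≤ couplingWeight ρ σ u := by
  have hm : 0 ≤ ∫ y, ‖y‖ ^ 2 ∂γ := integral_nonneg fun _ => by positivity
  have : 0 ≤ ‖u.1‖ ^ 2 + ‖ρ • u.1 + σ • u.2‖ ^ 2 := by positivity
  simp only [couplingWeight]; linarith

theorem continuous_couplingWeight (ρ σ : ℝ) :
    Continuous (couplingWeight ρ σ : 𝔼 × 𝔼 → ℝ) := by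
  unfold couplingWeight; fun_prop

theorem couplingWeight_le (ρ σ : ℝ) (u : 𝔼 × 𝔼) : couplingWeight ρ σ u ≤
    (1 + ∫ y, ‖y‖ ^ 2 ∂γ + (1 + (|ρ| + |σ|) ^ 2)) * (1 + ‖u‖ ^ 2) := by
  have hm : 0 ≤ ∫ y, ‖y‖ ^ 2 ∂γ := integral_nonneg fun _ => by positivity
  have h1 : ‖u.1‖ ≤ ‖u‖ := norm_fst_le u
  have h2 : ‖ρ • u.1 + σ • u.2‖ ≤ (|ρ| + |σ|) * ‖u‖ := by
    refine (norm_add_le _ _).trans ?_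
    rw [norm_smul, norm_smul, add_mul, Real.norm_eq_abs, Real.norm_eq_abs]
    exact add_le_add (mul_le_mul_of_nonneg_left h1 (abs_nonneg _))
      (mul_le_mul_of_nonneg_left (norm_snd_le u) (abs_nonneg _))
  have h3 := pow_le_pow_left₀ (norm_nonneg _) h1 2
  have h4 := pow_le_pow_left₀ (norm_nonneg _) h2 2
  rw [mul_pow] at h4
  unfold couplingWeight
  nlinarith [sq_nonneg ‖u‖, mul_nonneg hm (sq_nonneg ‖u‖), sq_nonneg (|ρ| + |σ|)]

theorem integrable_couplingWeight_pow (ρ σ : ℝ) (k : ℕ) :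
    Integrable (fun u => couplingWeight ρ σ u ^ k) (Measure.prod γ γ) := by
  have h0 : ∀ u : 𝔼 × 𝔼, 0 ≤ couplingWeight ρ σ u := fun u =>
    zero_le_one.trans (one_le_couplingWeight ρ σ u)
  set C := 1 + ∫ y, ‖y‖ ^ 2 ∂γ + (1 + (|ρ| + |σ|) ^ 2)
  refine ((((integrable_const (1 : ℝ)).add (integrable_norm_pow_of_isGaussian
    (Measure.prod γ γ) (2 * k))).const_mul (2 ^ (k - 1))).const_mul (C ^ k)).mono'
    ((continuous_couplingWeight ρ σ).pow k).aestronglyMeasurable (ae_of_all _ fun u => ?_)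
  rw [Real.norm_of_nonneg (pow_nonneg (h0 u) k)]
  refine (pow_le_pow_left₀ (h0 u) (couplingWeight_le ρ σ u) k).trans ?_
  rw [mul_pow]
  gcongr
  refine (add_pow_le zero_le_one (by positivity) k).trans ?_
  simp [pow_mul]

theorem abs_quadratic_le {k c d A B X : ℝ} (hk : |k| ≤ 1) (hc : |c| ≤ 1) (hd : |d| ≤ 1)
    (hX : 1 ≤ X) (hA : |A| ≤ X) (hB : |B| ≤ X) :
    |k * (A * B) - c * A ^ 2 - d * B ^ 2| ≤ 3 * X ^ 6 := by
  have hX0 : 0 ≤ X := by linarith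
  have key : ∀ k x y : ℝ, |k| ≤ 1 → |x| ≤ X → |y| ≤ X → |k * (x * y)| ≤ X ^ 6 :=
    fun k x y hk hx hy => by
    rw [abs_mul, abs_mul]
    calc |k| * (|x| * |y|) ≤ 1 * (X * X) := by gcongr
      _ = X ^ 2 := by ring
      _ ≤ X ^ 6 := pow_le_pow_right₀ hX (by norm_num)
  have h1 := key k A B hk hA hB
  have h2 := key c A A hc hA hA
  have h3 := key d B B hd hB hB
  rw [← pow_two] at h2 h3
  refine (abs_sub _ _).trans ?_
  have := abs_sub (k * (A * B)) (c * A ^ 2)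
  linarith

-- Dividing by the local means u0, v0 makes both relative increments mean-zero under the coupling.
-- The quadratic part has non-positive mean: the discriminant condition for the coefficients αβ,
-- α(1-α)/2, β(1-β)/2 is `hρ` multiplied by αβ. What remains is of order δ^{3/2}. The constant is
-- chosen before F and G, so the step can be iterated.
set_option maxHeartbeats 1000000 in
theorem exists_heat_couplingProduct_le {a b L ρ σ α β : ℝ} (ha : 0 < a) (hL : 0 ≤ L)
    (h : ρ ^ 2 + σ ^ 2 = 1)
    (hα0 : 0 < α) (hα1 : α < 1) (hβ0 : 0 < β) (hβ1 : β < 1)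
    (hρ : ρ ^ 2 * (α * β) ≤ (1 - α) * (1 - β)) :
    ∃ C : ℝ, ∀ (F G : 𝔼 → ℝ) (D D' : 𝔼 → 𝔼), SmoothBounded a b L F D → SmoothBounded a b L G D' →
      ∀ δ : ℝ, 0 ≤ δ → δ ≤ 1 → ∀ v : 𝔼 × 𝔼,
        heat (Measure.prod γ γ) δ (couplingProduct ρ σ α β F G) v ≤
          couplingProduct ρ σ α β (heat γ δ F) (heat γ δ G) v + C * Real.sqrt δ ^ 3 := by
  let W : 𝔼 × 𝔼 → ℝ := couplingWeight ρ σ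
  let X : 𝔼 × 𝔼 → ℝ := fun u => (1 + 2 * (L / a)) * W u
  have hX1 : ∀ u, 1 ≤ X u := fun u => by
    have : 0 ≤ L / a := by positivity
    simp only [X, W]
    nlinarith [one_le_couplingWeight ρ σ u]
  have hXi : Integrable (fun u => X u ^ 6) (Measure.prod γ γ) := by
    simp only [X, W, mul_pow]
    exact (integrable_couplingWeight_pow ρ σ 6).const_mul _
  -- The prefactor bounds u0^α v0^β; the integral is the mean of the remainder in
  -- `expansion_mul_le`.
  refine ⟨b ^ α * b ^ β * (20 * ∫ u, X u ^ 6 ∂(Measure.prod γ γ)),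
    fun F G D D' hF hG δ hδ0 hδ1 v => ?_⟩
  obtain ⟨ε, hε⟩ : ∃ ε, ε = Real.sqrt δ := ⟨_, rfl⟩
  have hε0 : 0 ≤ ε := hε ▸ Real.sqrt_nonneg δ
  have hε1 : ε ≤ 1 := hε ▸ Real.sqrt_le_one.2 hδ1
  obtain ⟨x, hx⟩ : ∃ x, x = v.1 := ⟨_, rfl⟩
  obtain ⟨y, hy⟩ : ∃ y, y = ρ • v.1 + σ • v.2 := ⟨_, rfl⟩
  obtain ⟨u0, hu0⟩ : ∃ u0, u0 = heat γ δ F x := ⟨_, rfl⟩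
  obtain ⟨v0, hv0⟩ : ∃ v0, v0 = heat γ δ G y := ⟨_, rfl⟩
  have hu0b : u0 ≤ b := hu0 ▸ (hF.heatFlow δ).upper x
  have hv0b : v0 ≤ b := hv0 ▸ (hG.heatFlow δ).upper y
  have hu0p : 0 < u0 := ha.trans_le (hu0 ▸ (hF.heatFlow δ).lower x)
  have hv0p : 0 < v0 := ha.trans_le (hv0 ▸ (hG.heatFlow δ).lower y)
  have hb : 0 ≤ b := hu0p.le.trans hu0b
  -- Increments are taken about the means and not about F(x), G(y), so that the first-order terms
  -- vanish exactly.
  let s : 𝔼 × 𝔼 → ℝ := fun u => F (x + ε • u.1) / u0 - 1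
  let r : 𝔼 × 𝔼 → ℝ := fun u => G (y + ε • (ρ • u.1 + σ • u.2)) / v0 - 1
  let A : 𝔼 × 𝔼 → ℝ := fun u => ε * inner ℝ (D x) u.1 / u0
  let B : 𝔼 × 𝔼 → ℝ := fun u => ε * inner ℝ (D' y) (ρ • u.1 + σ • u.2) / v0
  have hcF := hF.continuous
  have hcG := hG.continuous
  have bF : ∀ u, |s u| ≤ ε * X u ∧ |A u| ≤ ε * X u ∧ |s u - A u| ≤ ε ^ 2 * X u := fun u => by
    have := hF.increment_bounds ha hδ1 x u.1 (W := W u) (by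
      simp only [W, couplingWeight]; nlinarith [sq_nonneg ‖ρ • u.1 + σ • u.2‖])
    rwa [← hε, ← hu0] at this
  have bG : ∀ u, |r u| ≤ ε * X u ∧ |B u| ≤ ε * X u ∧ |r u - B u| ≤ ε ^ 2 * X u := fun u => by
    have := hG.increment_bounds ha hδ1 y (ρ • u.1 + σ • u.2) (W := W u) (by
      simp only [W, couplingWeight]; nlinarith [sq_nonneg ‖u.1‖])
    rwa [← hε, ← hv0] at this
  have hs1 : ∀ u, -1 < s u := fun u => by
    have : 0 < F (x + ε • u.1) / u0 := div_pos (ha.trans_le (hF.lower _)) hu0p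
    simp only [s]; linarith
  have hr1 : ∀ u, -1 < r u := fun u => by
    have : 0 < G (y + ε • (ρ • u.1 + σ • u.2)) / v0 := div_pos (ha.trans_le (hG.lower _)) hv0p
    simp only [r]; linarith
  let Q : 𝔼 × 𝔼 → ℝ := fun u => α * β * (A u * B u) - α * (1 - α) / 2 * A u ^ 2 -
    β * (1 - β) / 2 * B u ^ 2
  have pointwise : ∀ u, couplingProduct ρ σ α β F G (v + ε • u) ≤ u0 ^ α * v0 ^ β *
      (1 + α * s u + β * r u + Q u + 20 * (ε ^ 3 * X u ^ 6)) := fun u => by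
    have e1 : F (x + ε • u.1) = u0 * (1 + s u) := by simp only [s]; field_simp; ring
    have e2 : G (y + ε • (ρ • u.1 + σ • u.2)) = v0 * (1 + r u) := by
      simp only [r]; field_simp; ring
    have e3 : couplingProduct ρ σ α β F G (v + ε • u) =
        u0 ^ α * v0 ^ β * ((1 + s u) ^ α * (1 + r u) ^ β) := by
      have e4 : ρ • (v + ε • u).1 + σ • (v + ε • u).2 = y + ε • (ρ • u.1 + σ • u.2) := by
        simp only [hy, Prod.fst_add, Prod.snd_add, Prod.smul_fst, Prod.smul_snd, smul_add,
          smul_comm ε]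
        abel
      rw [couplingProduct, e4, e2, show (v + ε • u).1 = x + ε • u.1 by rw [hx]; rfl, e1,
        Real.mul_rpow hu0p.le (by linarith [hs1 u]), Real.mul_rpow hv0p.le (by linarith [hr1 u])]
      ring
    rw [e3]
    refine mul_le_mul_of_nonneg_left ?_ (by positivity)
    have t1 := one_add_rpow_le hα0.le hα1.le (hs1 u)
    have t2 := one_add_rpow_le hβ0.le hβ1.le (hr1 u)
    have n1 : 0 ≤ (1 + s u) ^ α := Real.rpow_nonneg (by linarith [hs1 u]) _
    have n2 : 0 ≤ (1 + r u) ^ β := Real.rpow_nonneg (by linarith [hr1 u]) _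
    exact (mul_le_mul t1 t2 n2 (n1.trans t1)).trans
      (expansion_mul_le hα0.le hα1.le hβ0.le hβ1.le (by nlinarith) (by nlinarith) (by nlinarith)
        (by nlinarith) hε0 hε1 (hX1 u) (bF u).1 (bG u).1 (bF u).2.1 (bG u).2.1 (bF u).2.2
        (bG u).2.2)
  have iF : Integrable (fun u : 𝔼 × 𝔼 => F (x + ε • u.1)) (Measure.prod γ γ) :=
    hF.integrable_comp (φ := fun u : 𝔼 × 𝔼 => x + ε • u.1) (by fun_prop)
  have iG : Integrable (fun u : 𝔼 × 𝔼 => G (y + ε • (ρ • u.1 + σ • u.2))) (Measure.prod γ γ) :=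
    hG.integrable_comp (φ := fun u : 𝔼 × 𝔼 => y + ε • (ρ • u.1 + σ • u.2)) (by fun_prop)
  have is : Integrable s (Measure.prod γ γ) := (iF.div_const _).sub (integrable_const _)
  have ir : Integrable r (Measure.prod γ γ) := (iG.div_const _).sub (integrable_const _)
  have ms : ∫ u, s u ∂(Measure.prod γ γ) = 0 := by
    simp only [s]
    rw [integral_sub (iF.div_const _) (integrable_const _), integral_div,
      integral_fun_fst (fun z => F (x + ε • z))]
    simp only [probReal_univ, integral_const, smul_eq_mul, mul_one, one_mul]
    rw [show ∫ z, F (x + ε • z) ∂γ = u0 by rw [hu0, hε]; rfl, div_self hu0p.ne', sub_self]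
  -- The second marginal ρu₁ + σu₂ of the coupling again has law γ.
  have mr : ∫ u, r u ∂(Measure.prod γ γ) = 0 := by
    simp only [r]
    rw [integral_sub (iG.div_const _) (integrable_const _), integral_div,
      integral_prod_comp_rotation h (f := fun z => G (y + ε • z)) (by fun_prop)]
    simp only [probReal_univ, integral_const, smul_eq_mul, mul_one]
    rw [show ∫ z, G (y + ε • z) ∂γ = v0 by rw [hv0, hε]; rfl, div_self hv0p.ne', sub_self]
  have iQ : Integrable Q (Measure.prod γ γ) := by
    refine (hXi.const_mul 3).mono' (Continuous.aestronglyMeasurable ?_) (ae_of_all _ fun u => ?_)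
    · simp only [Q, A, B]; fun_prop
    · have hεX : ε * X u ≤ X u := mul_le_of_le_one_left (zero_le_one.trans (hX1 u)) hε1
      exact abs_quadratic_le (abs_le.2 ⟨by nlinarith, by nlinarith⟩)
        (abs_le.2 ⟨by nlinarith, by nlinarith⟩) (abs_le.2 ⟨by nlinarith, by nlinarith⟩) (hX1 u)
        ((bF u).2.1.trans hεX) ((bG u).2.1.trans hεX)
  have mQ : ∫ u, Q u ∂(Measure.prod γ γ) ≤ 0 := by
    have := integral_quadratic_nonpos h (k := α * β) (c := α * (1 - α) / 2) (d := β * (1 - β) / 2)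
      (by nlinarith) (by
        have : 0 ≤ α * β := by positivity
        nlinarith [mul_le_mul_of_nonneg_left hρ this]) ((ε / u0) • D x) ((ε / v0) • D' y)
    simp only [real_inner_smul_left] at this
    have eA : ∀ u, A u = ε / u0 * inner ℝ (D x) u.1 := fun u => mul_div_right_comm _ _ _
    have eB : ∀ u, B u = ε / v0 * inner ℝ (D' y) (ρ • u.1 + σ • u.2) := fun u =>
      mul_div_right_comm _ _ _
    simp only [Q, eA, eB]
    exact this
  have iR : Integrable (fun u => 1 + α * s u + β * r u + Q u + 20 * (ε ^ 3 * X u ^ 6))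
      (Measure.prod γ γ) :=
    ((((integrable_const _).add (is.const_mul _)).add (ir.const_mul _)).add iQ).add
      ((hXi.const_mul _).const_mul _)
  have step : heat (Measure.prod γ γ) δ (couplingProduct ρ σ α β F G) v ≤
      u0 ^ α * v0 ^ β * ∫ u, (1 + α * s u + β * r u + Q u + 20 * (ε ^ 3 * X u ^ 6))
        ∂(Measure.prod γ γ) := by
    rw [← integral_const_mul, heat, ← hε]
    refine integral_mono (integrable_of_continuous_of_bound ?_
      fun _ => hF.abs_couplingProduct_le ha hα0.le hβ0.le hG _) (iR.const_mul _) pointwise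
    have := hF.continuous_couplingProduct (ρ := ρ) (σ := σ) (α := α) (β := β) ha hG
    fun_prop
  rw [integral_add (by exact (((integrable_const _).add (is.const_mul _)).add
      (ir.const_mul _)).add iQ) ((hXi.const_mul _).const_mul _),
    integral_add (by exact ((integrable_const _).add (is.const_mul _)).add (ir.const_mul _)) iQ,
    integral_add (by exact (integrable_const _).add (is.const_mul _)) (ir.const_mul _),
    integral_add (integrable_const _) (is.const_mul _), integral_const_mul, integral_const_mul,
    integral_const_mul, integral_const_mul, ms, mr] at step
  have hE : 0 ≤ 20 * (ε ^ 3 * ∫ u, X u ^ 6 ∂(Measure.prod γ γ)) := by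
    have : 0 ≤ ∫ u, X u ^ 6 ∂(Measure.prod γ γ) := integral_nonneg fun u => by
      have := hX1 u
      positivity
    positivity
  have hK : u0 ^ α * v0 ^ β ≤ b ^ α * b ^ β :=
    mul_le_mul (Real.rpow_le_rpow hu0p.le hu0b hα0.le)
      (Real.rpow_le_rpow hv0p.le hv0b hβ0.le) (by positivity) (by positivity)
  refine step.trans ?_
  have e : couplingProduct ρ σ α β (heat γ δ F) (heat γ δ G) v = u0 ^ α * v0 ^ β := by
    rw [hu0, hv0, hx, hy]; rfl
  rw [e]
  have hp : 0 ≤ u0 ^ α * v0 ^ β := by positivity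
  simp only [integral_const, probReal_univ, smul_eq_mul, mul_one, mul_zero, add_zero]
  calc _ = u0 ^ α * v0 ^ β + u0 ^ α * v0 ^ β * (∫ u, Q u ∂(Measure.prod γ γ)) +
        u0 ^ α * v0 ^ β * (20 * (ε ^ 3 * ∫ u, X u ^ 6 ∂(Measure.prod γ γ))) := by ring
    _ ≤ u0 ^ α * v0 ^ β + 0 +
        b ^ α * b ^ β * (20 * (ε ^ 3 * ∫ u, X u ^ 6 ∂(Measure.prod γ γ))) := by
      gcongr
      exact mul_nonpos_of_nonneg_of_nonpos hp mQ
    _ = _ := by rw [← hε]; ring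

end BilinearInequality

/-! ### Iteration to time one and the two-function inequality. -/

section Telescoping

variable {n : ℕ}

local notation "𝔼" => EuclideanSpace ℝ (Fin n)
local notation "γ" => stdGaussian (EuclideanSpace ℝ (Fin n))

theorem heat_zero {V : Type*} [NormedAddCommGroup V] [NormedSpace ℝ V] [MeasurableSpace V]
    (μ : Measure V) [IsProbabilityMeasure μ] (f : V → ℝ) : heat μ 0 f = f := by
  ext x
  simp [heat]

/-- The heat flow is monotone, commutes with adding constants and preserves the function class, so
the errors of the single steps add up. -/
theorem heat_iterate_couplingProduct_le {a b L ρ σ α β C δ : ℝ} (ha : 0 < a) (hα : 0 ≤ α)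
    (hβ : 0 ≤ β) (hδ : 0 ≤ δ)
    (hC : ∀ (F G : 𝔼 → ℝ) (D D' : 𝔼 → 𝔼), SmoothBounded a b L F D → SmoothBounded a b L G D' →
      ∀ v : 𝔼 × 𝔼, heat (Measure.prod γ γ) δ (couplingProduct ρ σ α β F G) v ≤
          couplingProduct ρ σ α β (heat γ δ F) (heat γ δ G) v + C) (k : ℕ) :
    ∀ (F G : 𝔼 → ℝ) (D D' : 𝔼 → 𝔼), SmoothBounded a b L F D → SmoothBounded a b L G D' →
      ∀ v : 𝔼 × 𝔼, heat (Measure.prod γ γ) (k * δ) (couplingProduct ρ σ α β F G) v ≤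
          couplingProduct ρ σ α β (heat γ (k * δ) F) (heat γ (k * δ) G) v + k * C := by
  induction k with
  | zero =>
    intro F G D D' hF hG v
    simp [heat_zero]
  | succ k ih =>
    intro F G D D' hF hG v
    have hk : 0 ≤ k * δ := by positivity
    have e : ((k + 1 : ℕ) : ℝ) * δ = k * δ + δ := by push_cast; ring
    have eF : heat γ (k * δ) (heat γ δ F) = heat γ (k * δ + δ) F :=
      funext fun x => heat_heat (by simp) hk hδ hF.continuous hF.abs_le x
    have eG : heat γ (k * δ) (heat γ δ G) = heat γ (k * δ + δ) G :=
      funext fun x => heat_heat (by simp) hk hδ hG.continuous hG.abs_le x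
    have c0 := hF.continuous_couplingProduct (ρ := ρ) (σ := σ) (α := α) (β := β) ha hG
    have c1 := (hF.heatFlow δ).continuous_couplingProduct (ρ := ρ) (σ := σ) (α := α) (β := β) ha
      (hG.heatFlow δ)
    have b0 := hF.abs_couplingProduct_le (ρ := ρ) (σ := σ) ha hα hβ hG
    have b1 := (hF.heatFlow δ).abs_couplingProduct_le (ρ := ρ) (σ := σ) ha hα hβ (hG.heatFlow δ)
    rw [e, ← heat_heat integral_id_stdGaussian_prod hk hδ c0 b0]
    have hb : ∀ v, |heat (Measure.prod γ γ) δ (couplingProduct ρ σ α β F G) v| ≤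
        b ^ α * b ^ β := fun v => by
      have := norm_integral_le_of_norm_le_const (μ := Measure.prod γ γ)
        (f := fun z => couplingProduct ρ σ α β F G (v + Real.sqrt δ • z)) (C := b ^ α * b ^ β)
        (ae_of_all _ fun z => b0 _)
      simpa [heat] using this
    refine (heat_mono _ (continuous_heat δ c0 b0) hb (c1.add continuous_const)
      (C' := b ^ α * b ^ β + |C|) (fun v => (abs_add_le _ _).trans (by gcongr; exact b1 v))
      (fun v => hC F G D D' hF hG v) v).trans ((heat_add_const _ c1 b1 C v).le.trans ?_)
    have := ih _ _ _ _ (hF.heatFlow δ) (hG.heatFlow δ) v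
    rw [eF, eG] at this
    push_cast
    linarith

/-- **Two-function hypercontractivity**: the Gaussian Hölder inequality for correlated variables,
for smooth functions bounded away from zero. -/
theorem integral_rpow_mul_rpow_le {a b L ρ σ α β : ℝ} (ha : 0 < a) (h : ρ ^ 2 + σ ^ 2 = 1)
    (hα0 : 0 < α) (hα1 : α < 1) (hβ0 : 0 < β) (hβ1 : β < 1)
    (hρ : ρ ^ 2 * (α * β) ≤ (1 - α) * (1 - β)) {F G : 𝔼 → ℝ} {D D' : 𝔼 → 𝔼}
    (hF : SmoothBounded a b L F D) (hG : SmoothBounded a b L G D') :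
    ∫ u, F u.1 ^ α * G (ρ • u.1 + σ • u.2) ^ β ∂(Measure.prod γ γ) ≤
      (∫ z, F z ∂γ) ^ α * (∫ z, G z ∂γ) ^ β := by
  obtain ⟨C, hC⟩ := exists_heat_couplingProduct_le (n := n) (b := b) ha hF.nonneg h hα0 hα1 hβ0
    hβ1 hρ
  have key : ∀ m : ℕ, ∫ u, F u.1 ^ α * G (ρ • u.1 + σ • u.2) ^ β ∂(Measure.prod γ γ) ≤
      (∫ z, F z ∂γ) ^ α * (∫ z, G z ∂γ) ^ β + C * Real.sqrt (1 / ((m : ℝ) + 1)) := fun m => by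
    -- Then m+1 steps reach time one, with total error (m+1)Cδ^{3/2} = C√δ.
    set δ : ℝ := 1 / ((m : ℝ) + 1) with hδ
    have hδ0 : 0 ≤ δ := by positivity
    have hδ1 : δ ≤ 1 := by
      rw [hδ, div_le_one (by positivity)]
      linarith [(Nat.cast_nonneg m : (0 : ℝ) ≤ m)]
    have hm : ((m + 1 : ℕ) : ℝ) * δ = 1 := by
      rw [hδ]; push_cast; field_simp
    -- At base point 0 the flow at time one is the plain Gaussian expectation.
    have := heat_iterate_couplingProduct_le ha hα0.le hβ0.le hδ0
      (fun F G D D' hF hG v => hC F G D D' hF hG δ hδ0 hδ1 v) (m + 1) F G D D' hF hG 0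
    rw [hm] at this
    have e : ((m + 1 : ℕ) : ℝ) * (C * Real.sqrt δ ^ 3) = C * Real.sqrt δ := by
      calc _ = C * Real.sqrt δ * (((m + 1 : ℕ) : ℝ) * Real.sqrt δ ^ 2) := by ring
        _ = _ := by rw [Real.sq_sqrt hδ0, hm, mul_one]
    rw [e] at this
    simpa [heat, couplingProduct] using this
  have lim : Tendsto (fun m : ℕ => (∫ z, F z ∂γ) ^ α * (∫ z, G z ∂γ) ^ β +
      C * Real.sqrt (1 / ((m : ℝ) + 1))) atTop
      (𝓝 ((∫ z, F z ∂γ) ^ α * (∫ z, G z ∂γ) ^ β + C * Real.sqrt 0)) :=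
    (((Real.continuous_sqrt.tendsto 0).comp tendsto_one_div_add_atTop_nhds_zero_nat).const_mul
      C).const_add _
  rw [Real.sqrt_zero, mul_zero, add_zero] at lim
  exact ge_of_tendsto' lim key

end Telescoping

/-! ### Nelson's hypercontractivity theorem. -/

section Hypercontractivity

variable {n : ℕ}

local notation "𝔼" => EuclideanSpace ℝ (Fin n)
local notation "γ" => stdGaussian (EuclideanSpace ℝ (Fin n))

theorem SmoothBounded.comp_smul {a b L ρ : ℝ} {F : 𝔼 → ℝ} {D : 𝔼 → 𝔼}
    (hF : SmoothBounded a b L F D) (hρ : |ρ| ≤ 1) :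
    SmoothBounded a b L (fun x => F (ρ • x)) (fun x => ρ • D (ρ • x)) := by
  have hL := hF.nonneg
  have hc := hF.continuous
  have hD := hF.continuous_grad
  have hn : ∀ z : 𝔼, ‖ρ • z‖ ≤ ‖z‖ := fun z => by
    rw [norm_smul]
    exact mul_le_of_le_one_left (norm_nonneg z) hρ
  refine ⟨fun x => hF.lower _, fun x => hF.upper _, by fun_prop, by fun_prop,
    fun x => (hn _).trans (hF.norm_grad _), fun x z => ?_, fun x z => ?_⟩
  · rw [smul_add]
    exact (hF.lipschitz _ _).trans (by gcongr; exact hn z)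
  · rw [smul_add, real_inner_smul_left, ← real_inner_smul_right]
    exact (hF.taylor _ _).trans (by gcongr; exact hn z)

/-- The Mehler average is the heat flow at time σ² evaluated at ρx, and |ρ| ≤ 1. -/
theorem SmoothBounded.exists_mehler {a b L ρ σ : ℝ} {F : 𝔼 → ℝ} {D : 𝔼 → 𝔼}
    (hF : SmoothBounded a b L F D) (h : ρ ^ 2 + σ ^ 2 = 1) (hσ : 0 ≤ σ) :
    ∃ D', SmoothBounded a b L (fun x => ∫ z, F (ρ • x + σ • z) ∂γ) D' := by
  have h1 := (hF.heatFlow (σ ^ 2)).comp_smul (ρ := ρ)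
    ((sq_le_one_iff_abs_le_one ρ).1 (by nlinarith [sq_nonneg σ]))
  simp only [heat, Real.sqrt_sq hσ] at h1
  exact ⟨_, h1⟩

/-- Duality with the optimal test function: the two-function inequality for (NF)^q and F^p with α =
1 - 1/q, β = 1/p has left side ∫ (NF)^{q-1} NF = ∫ (NF)^q. Dividing by (∫ (NF)^q)^{1-1/q} gives the
claim. -/
theorem SmoothBounded.integral_mehler_rpow_le {a b L p q ρ σ : ℝ} (ha : 0 < a) (hp : 1 < p)
    (hq : 1 < q) (h : ρ ^ 2 + σ ^ 2 = 1) (hσ : 0 ≤ σ) (hρ : ρ ^ 2 * (q - 1) ≤ p - 1)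
    {F : 𝔼 → ℝ} {D : 𝔼 → 𝔼} (hF : SmoothBounded a b L F D) :
    (∫ x, (∫ z, F (ρ • x + σ • z) ∂γ) ^ q ∂γ) ^ (1 / q) ≤ (∫ x, F x ^ p ∂γ) ^ (1 / p) := by
  obtain ⟨D', hN⟩ := hF.exists_mehler h hσ
  obtain ⟨N, hNdef⟩ : ∃ N : 𝔼 → ℝ, N = fun x => ∫ z, F (ρ • x + σ • z) ∂γ := ⟨_, rfl⟩
  rw [← hNdef] at hN
  have hb : a ≤ b := (hF.lower 0).trans (hF.upper 0)
  have hpow : ∀ {r : ℝ} {H : 𝔼 → ℝ} {D : 𝔼 → 𝔼}, 0 < r → SmoothBounded a b L H D →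
      ∃ L' D', SmoothBounded (a ^ r) (b ^ r) L' (fun x => H x ^ r) D' := fun {r H D} hr hH => by
    obtain ⟨L', hL'⟩ := hH.exists_comp (φ := fun u => u ^ r) (U := Ioi 0) isOpen_Ioi
      (fun u hu => ha.trans_le hu.1)
      (fun u hu => (Real.contDiffAt_rpow_const_of_ne (mem_Ioi.1 hu).ne').contDiffWithinAt)
      (a' := a ^ r) (b' := b ^ r)
      (fun u hu => ⟨Real.rpow_le_rpow ha.le hu.1 hr.le,
        Real.rpow_le_rpow (ha.le.trans hu.1) hu.2 hr.le⟩)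
    exact ⟨L', _, hL'⟩
  obtain ⟨L1, D1, h1⟩ := hpow (r := q) (by linarith) hN
  obtain ⟨L2, D2, h2⟩ := hpow (r := p) (by linarith) hF
  -- The two-function inequality asks for the same constants for both functions.
  have h1' := h1.mono (a' := min (a ^ q) (a ^ p)) (b' := max (b ^ q) (b ^ p)) (L' := max L1 L2)
    (min_le_left _ _) (le_max_left _ _) (le_max_left _ _)
  have h2' := h2.mono (a' := min (a ^ q) (a ^ p)) (b' := max (b ^ q) (b ^ p)) (L' := max L1 L2)
    (min_le_right _ _) (le_max_right _ _) (le_max_right _ _)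
  have hp0 : 0 < p := by linarith
  have hq0 : 0 < q := by linarith
  have main := integral_rpow_mul_rpow_le (lt_min (by positivity) (by positivity)) h
    (α := 1 - 1 / q) (β := 1 / p) (by rw [sub_pos, div_lt_one hq0]; exact hq)
    (by simp [hq0]) (by positivity) (by rw [div_lt_one hp0]; exact hp)
    (by
      have e1 : ρ ^ 2 * ((1 - 1 / q) * (1 / p)) = ρ ^ 2 * (q - 1) / (q * p) := by field_simp
      have e2 : (1 - (1 - 1 / q)) * (1 - 1 / p) = (p - 1) / (q * p) := by field_simp; ring
      rw [e1, e2]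
      gcongr) h1' h2'
  have hNpos : ∀ x, 0 < N x := fun x => ha.trans_le (hN.lower x)
  have hFpos : ∀ x, 0 < F x := fun x => ha.trans_le (hF.lower x)
  have e : ∫ u : 𝔼 × 𝔼, (N u.1 ^ q) ^ (1 - 1 / q) * (F (ρ • u.1 + σ • u.2) ^ p) ^ (1 / p)
      ∂(Measure.prod γ γ) = ∫ x, N x ^ q ∂γ := by
    have e1 : ∀ u : 𝔼 × 𝔼, (N u.1 ^ q) ^ (1 - 1 / q) * (F (ρ • u.1 + σ • u.2) ^ p) ^ (1 / p) =
        N u.1 ^ (q - 1) * F (ρ • u.1 + σ • u.2) := fun u => by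
      rw [← Real.rpow_mul (hNpos _).le, ← Real.rpow_mul (hFpos _).le, mul_one_div_cancel hp0.ne',
        Real.rpow_one, mul_sub, mul_one_div_cancel hq0.ne', mul_one]
    simp_rw [e1]
    have hcN := hN.continuous
    have hcF := hF.continuous
    have hcr : Continuous fun x => N x ^ (q - 1) :=
      hcN.rpow_const fun x => Or.inl (hNpos x).ne'
    rw [integral_prod]
    · refine integral_congr_ae (ae_of_all _ fun x => ?_)
      simp only
      rw [integral_const_mul]
      have : ∫ z, F (ρ • x + σ • z) ∂γ = N x := by rw [hNdef]
      rw [this, Real.rpow_sub_one (hNpos x).ne', div_mul_cancel₀ _ (hNpos x).ne']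
    · refine Integrable.of_bound (Continuous.aestronglyMeasurable
        ((hcr.comp continuous_fst).mul (by fun_prop))) (b ^ (q - 1) * b)
        (ae_of_all _ fun u => ?_)
      rw [Real.norm_of_nonneg (mul_nonneg (Real.rpow_nonneg (hNpos _).le _) (hFpos _).le)]
      exact mul_le_mul (Real.rpow_le_rpow (hNpos _).le (hN.upper _) (by linarith)) (hF.upper _)
        (hFpos _).le (Real.rpow_nonneg (ha.le.trans hb) _)
  rw [e] at main
  have hI : 0 < ∫ x, N x ^ q ∂γ := by
    have := integral_mono (μ := γ) (integrable_const (a ^ q)) (h1.integrable_comp measurable_id)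
      (fun x => h1.lower x)
    refine lt_of_lt_of_le (by positivity : 0 < a ^ q) ?_
    simpa using this
  have : (∫ x, N x ^ q ∂γ) ^ (1 / q) ≤ (∫ x, F x ^ p ∂γ) ^ (1 / p) := by
    have hI' : 0 < (∫ x, N x ^ q ∂γ) ^ (1 - 1 / q) := by positivity
    refine le_of_mul_le_mul_left ?_ hI'
    rw [← Real.rpow_add hI, sub_add_cancel, Real.rpow_one]
    exact main
  rwa [hNdef] at this

theorem eLpNorm_eq_ofReal_integral_rpow {F : 𝔼 → ℝ} {p : ℝ} (hp : 0 < p) (hF : ∀ x, 0 ≤ F x)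
    (hi : Integrable (fun x => F x ^ p) γ) :
    eLpNorm F (ENNReal.ofReal p) γ = ENNReal.ofReal ((∫ x, F x ^ p ∂γ) ^ (1 / p)) := by
  rw [eLpNorm_eq_lintegral_rpow_enorm_toReal (by simpa using hp) (by simp),
    ENNReal.toReal_ofReal hp.le, ← ENNReal.ofReal_rpow_of_nonneg
      (integral_nonneg fun x => Real.rpow_nonneg (hF x) p) (by positivity),
    ofReal_integral_eq_lintegral_ofReal hi (ae_of_all _ fun x => Real.rpow_nonneg (hF x) p)]
  congr 1
  refine lintegral_congr fun x => ?_
  rw [Real.enorm_of_nonneg (hF x), ENNReal.ofReal_rpow_of_nonneg (hF x) hp.le]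

/-- The function √(g² + ε²) is smooth, bounded below by ε, and lies between |g| and |g| + ε; the
positive case applies to it. -/
theorem lintegral_mehler_le_of_smooth {p q ρ σ ε : ℝ} (hp : 1 < p) (hq : 1 < q)
    (h : ρ ^ 2 + σ ^ 2 = 1) (hσ : 0 ≤ σ) (hρ : ρ ^ 2 * (q - 1) ≤ p - 1) (hε : 0 < ε) {g : 𝔼 → ℝ}
    (hg : ContDiff ℝ 2 g) (hs : HasCompactSupport g) :
    ∫⁻ x, (∫⁻ z, ‖g (ρ • x + σ • z)‖ₑ ∂γ) ^ q ∂γ ≤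
      (eLpNorm g (ENNReal.ofReal p) γ + ENNReal.ofReal ε) ^ q := by
  have hp0 : 0 < p := by linarith
  have hq0 : 0 < q := by linarith
  obtain ⟨B, L, D, hG⟩ := SmoothBounded.exists_of_hasCompactSupport hg hs
  obtain ⟨L', hF⟩ := hG.exists_comp (φ := fun u => Real.sqrt (u ^ 2 + ε ^ 2)) isOpen_univ
    (subset_univ _) (ContDiff.contDiffOn (ContDiff.sqrt (by fun_prop) fun u => by positivity))
    (a' := ε) (b' := Real.sqrt (B ^ 2 + ε ^ 2)) (fun u hu =>
      ⟨Real.le_sqrt_of_sq_le (by nlinarith [sq_nonneg u]), Real.sqrt_le_sqrt (by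
        nlinarith [hu.1, hu.2])⟩)
  obtain ⟨F, hFdef⟩ : ∃ F : 𝔼 → ℝ, F = fun x => Real.sqrt (g x ^ 2 + ε ^ 2) := ⟨_, rfl⟩
  rw [← hFdef] at hF
  have hFpos : ∀ x, 0 < F x := fun x => hε.trans_le (hF.lower x)
  have hgF : ∀ x, |g x| ≤ F x := fun x => by
    rw [hFdef, ← Real.sqrt_sq_eq_abs]
    exact Real.sqrt_le_sqrt (by nlinarith)
  have hFg : ∀ x, F x ≤ |g x| + ε := fun x => by
    rw [hFdef]
    refine Real.sqrt_le_iff.2 ⟨by positivity, ?_⟩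
    nlinarith [sq_abs (g x), mul_nonneg (abs_nonneg (g x)) hε.le]
  obtain ⟨D', hN⟩ := hF.exists_mehler h hσ
  have hcF := hF.continuous
  have hcN := hN.continuous
  have hNpos : ∀ x, 0 < ∫ z, F (ρ • x + σ • z) ∂γ := fun x => hε.trans_le (hN.lower x)
  have step1 : ∀ x, ∫⁻ z, ‖g (ρ • x + σ • z)‖ₑ ∂γ ≤
      ENNReal.ofReal (∫ z, F (ρ • x + σ • z) ∂γ) := fun x => by
    rw [ofReal_integral_eq_lintegral_ofReal
      (hF.integrable_comp (φ := fun z => ρ • x + σ • z) (by fun_prop))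
      (ae_of_all _ fun z => (hFpos _).le)]
    refine lintegral_mono fun z => ?_
    rw [Real.enorm_eq_ofReal_abs]
    exact ENNReal.ofReal_le_ofReal (hgF _)
  have hb : 0 ≤ Real.sqrt (B ^ 2 + ε ^ 2) := Real.sqrt_nonneg _
  have intpow : ∀ {r : ℝ} {H : 𝔼 → ℝ}, 0 < r → Continuous H → (∀ x, 0 < H x) →
      (∀ x, H x ≤ Real.sqrt (B ^ 2 + ε ^ 2)) → Integrable (fun x => H x ^ r) γ :=
    fun {r H} hr hc h0 h1 => integrable_of_continuous_of_bound
      (hc.rpow_const fun x => Or.inl (h0 x).ne') (C := Real.sqrt (B ^ 2 + ε ^ 2) ^ r) fun x => by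
        rw [abs_of_nonneg (Real.rpow_nonneg (h0 x).le r)]
        exact Real.rpow_le_rpow (h0 x).le (h1 x) hr.le
  have iN := intpow hq0 hcN hNpos hN.upper
  have iF := intpow hp0 hcF hFpos hF.upper
  have hyp := hF.integral_mehler_rpow_le hε hp hq h hσ hρ
  calc ∫⁻ x, (∫⁻ z, ‖g (ρ • x + σ • z)‖ₑ ∂γ) ^ q ∂γ
      ≤ ∫⁻ x, ENNReal.ofReal ((∫ z, F (ρ • x + σ • z) ∂γ) ^ q) ∂γ := lintegral_mono fun x => by
        rw [← ENNReal.ofReal_rpow_of_nonneg (hNpos x).le hq0.le]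
        exact ENNReal.rpow_le_rpow (step1 x) hq0.le
    _ = ENNReal.ofReal (∫ x, (∫ z, F (ρ • x + σ • z) ∂γ) ^ q ∂γ) :=
        (ofReal_integral_eq_lintegral_ofReal iN
          (ae_of_all _ fun x => Real.rpow_nonneg (hNpos x).le q)).symm
    _ = ENNReal.ofReal (((∫ x, (∫ z, F (ρ • x + σ • z) ∂γ) ^ q ∂γ) ^ (1 / q)) ^ q) := by
        rw [← Real.rpow_mul (integral_nonneg fun x => Real.rpow_nonneg (hNpos x).le q),
          one_div_mul_cancel hq0.ne', Real.rpow_one]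
    _ ≤ ENNReal.ofReal (((∫ x, F x ^ p ∂γ) ^ (1 / p)) ^ q) :=
        ENNReal.ofReal_le_ofReal (Real.rpow_le_rpow (Real.rpow_nonneg
          (integral_nonneg fun x => Real.rpow_nonneg (hNpos x).le q) _) hyp hq0.le)
    _ = eLpNorm F (ENNReal.ofReal p) γ ^ q := by
        rw [eLpNorm_eq_ofReal_integral_rpow hp0 (fun x => (hFpos x).le) iF,
          ENNReal.ofReal_rpow_of_nonneg (Real.rpow_nonneg (integral_nonneg fun x =>
            Real.rpow_nonneg (hFpos x).le p) _) hq0.le]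
    _ ≤ _ := by
        refine ENNReal.rpow_le_rpow ?_ hq0.le
        have hc := hg.continuous
        calc eLpNorm F (ENNReal.ofReal p) γ
            ≤ eLpNorm ((fun x => |g x|) + fun _ => ε) (ENNReal.ofReal p) γ :=
              eLpNorm_mono_real fun x => by
                rw [Real.norm_of_nonneg (hFpos x).le]
                exact hFg x
          _ ≤ eLpNorm (fun x => |g x|) (ENNReal.ofReal p) γ +
                eLpNorm (fun _ => ε) (ENNReal.ofReal p) γ :=
              eLpNorm_add_le (Continuous.aestronglyMeasurable (by fun_prop))
                aestronglyMeasurable_const (by simpa using hp.le)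
          _ = _ := by
              rw [eLpNorm_const _ (by simpa using hp0) (NeZero.ne _)]
              congr 1
              · exact eLpNorm_norm g
              · simp [Real.enorm_of_nonneg hε.le]

theorem lintegral_lintegral_mehler {ρ σ : ℝ} (h : ρ ^ 2 + σ ^ 2 = 1) {f : 𝔼 → ℝ≥0∞}
    (hf : Measurable f) : ∫⁻ x, ∫⁻ z, f (ρ • x + σ • z) ∂γ ∂γ = ∫⁻ x, f x ∂γ := by
  conv_rhs => rw [← map_smul_add_smul (μ := γ) (by simp) h]
  rw [lintegral_map hf (by fun_prop), lintegral_prod _ (by fun_prop)]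

theorem measurable_lintegral_mehler (ρ σ : ℝ) {f : 𝔼 → ℝ≥0∞} (hf : Measurable f) :
    Measurable fun x => ∫⁻ z, f (ρ • x + σ • z) ∂γ :=
  Measurable.lintegral_prod_right' (f := fun u : 𝔼 × 𝔼 => f (ρ • u.1 + σ • u.2)) (by fun_prop)

/-- **Nelson's hypercontractivity theorem**. -/
theorem lintegral_mehler_rpow_le {p q ρ σ : ℝ} (hp : 1 < p) (hq : 1 < q)
    (h : ρ ^ 2 + σ ^ 2 = 1) (hσ : 0 ≤ σ) (hρ : ρ ^ 2 * (q - 1) ≤ p - 1) {f : 𝔼 → ℝ}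
    (hf : Measurable f) :
    ∫⁻ x, (∫⁻ z, ‖f (ρ • x + σ • z)‖ₑ ∂γ) ^ q ∂γ ≤ eLpNorm f (ENNReal.ofReal p) γ ^ q := by
  have hq0 : 0 < q := by linarith
  by_cases htop : eLpNorm f (ENNReal.ofReal p) γ = ∞
  · rw [htop, ENNReal.top_rpow_of_pos hq0]
    exact le_top
  have hmem : MemLp f (ENNReal.ofReal p) γ := ⟨hf.aestronglyMeasurable, lt_top_iff_ne_top.2 htop⟩
  have hp1 : 1 ≤ ENNReal.ofReal p := by simpa using hp.le
  have hεpos : ∀ k : ℕ, (0 : ℝ) < (1 / 2) ^ k := fun k => by positivity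
  -- A summable rate, so that the averages of |f - g k| tend to zero almost everywhere without
  -- passing to a subsequence.
  choose g hgs hgd hgf using fun k : ℕ => hmem.exist_eLpNorm_sub_le (by simp) hp1 (hεpos k)
  have hgm : ∀ k, Measurable (g k) := fun k => (hgd k).continuous.measurable
  let N : (𝔼 → ℝ) → 𝔼 → ℝ≥0∞ := fun f x => ∫⁻ z, ‖f (ρ • x + σ • z)‖ₑ ∂γ
  have hNm : ∀ {f : 𝔼 → ℝ}, Measurable f → Measurable (N f) := fun hf =>
    measurable_lintegral_mehler ρ σ hf.enorm
  have hdiff : ∀ᵐ x ∂γ, Tendsto (fun k => N (f - g k) x) atTop (𝓝 0) := by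
    have hsum : ∫⁻ x, ∑' k, N (f - g k) x ∂γ ≠ ∞ := by
      rw [lintegral_tsum fun k => (hNm (hf.sub (hgm k))).aemeasurable]
      refine ne_top_of_le_ne_top (b := ∑' k : ℕ, ENNReal.ofReal ((1 / 2) ^ k)) ?_
        (ENNReal.tsum_le_tsum fun k => ?_)
      · exact (summable_geometric_two).tsum_ofReal_ne_top
      · calc ∫⁻ x, N (f - g k) x ∂γ = eLpNorm (f - g k) 1 γ := by
              rw [eLpNorm_one_eq_lintegral_enorm]
              exact lintegral_lintegral_mehler h (hf.sub (hgm k)).enorm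
          _ ≤ eLpNorm (f - g k) (ENNReal.ofReal p) γ :=
              eLpNorm_le_eLpNorm_of_exponent_le hp1 (hf.sub (hgm k)).aestronglyMeasurable
          _ ≤ _ := hgf k
    filter_upwards [ae_lt_top (Measurable.tsum fun k => hNm (hf.sub (hgm k))) hsum] with x hx
    exact ENNReal.tendsto_atTop_zero_of_tsum_ne_top hx.ne
  have hle : ∀ k x, N f x - N (f - g k) x ≤ N (g k) x := fun k x => by
    rw [tsub_le_iff_right]
    simp only [N]
    rw [← lintegral_add_left (by have := (hgm k).enorm; fun_prop)]
    refine lintegral_mono fun z => ?_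
    have := enorm_add_le (g k (ρ • x + σ • z)) ((f - g k) (ρ • x + σ • z))
    simpa using this
  have hbound : ∀ k, ∫⁻ x, (N f x - N (f - g k) x) ^ q ∂γ ≤
      (eLpNorm f (ENNReal.ofReal p) γ + 2 * ENNReal.ofReal ((1 / 2) ^ k)) ^ q := fun k => by
    refine (lintegral_mono fun x => ENNReal.rpow_le_rpow (hle k x) hq0.le).trans
      ((lintegral_mehler_le_of_smooth hp hq h hσ hρ (hεpos k) (mod_cast contDiff_infty.1 (hgd k) 2)
        (hgs k)).trans (ENNReal.rpow_le_rpow ?_ hq0.le))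
    rw [two_mul, ← add_assoc]
    gcongr
    have e : g k = f - (f - g k) := (sub_sub_cancel f (g k)).symm
    calc eLpNorm (g k) (ENNReal.ofReal p) γ
        = eLpNorm (f - (f - g k)) (ENNReal.ofReal p) γ := by rw [← e]
      _ ≤ eLpNorm f (ENNReal.ofReal p) γ + eLpNorm (f - g k) (ENNReal.ofReal p) γ :=
          eLpNorm_sub_le hf.aestronglyMeasurable (hf.sub (hgm k)).aestronglyMeasurable hp1
      _ ≤ _ := by gcongr; exact hgf k
  have hlim : Tendsto (fun k : ℕ => (eLpNorm f (ENNReal.ofReal p) γ +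
      2 * ENNReal.ofReal ((1 / 2) ^ k)) ^ q) atTop (𝓝 (eLpNorm f (ENNReal.ofReal p) γ ^ q)) := by
    have h1 : Tendsto (fun k : ℕ => ENNReal.ofReal ((1 / 2) ^ k)) atTop (𝓝 0) := by
      have := ENNReal.tendsto_ofReal (tendsto_pow_atTop_nhds_zero_of_lt_one
        (r := (1 / 2 : ℝ)) (by norm_num) (by norm_num))
      simpa using this
    have h2 : Tendsto (fun k : ℕ => eLpNorm f (ENNReal.ofReal p) γ +
        2 * ENNReal.ofReal ((1 / 2) ^ k)) atTop (𝓝 (eLpNorm f (ENNReal.ofReal p) γ + 2 * 0)) :=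
      tendsto_const_nhds.add (ENNReal.Tendsto.const_mul h1 (Or.inr (by simp)))
    rw [mul_zero, add_zero] at h2
    exact (ENNReal.continuous_rpow_const.tendsto _).comp h2
  -- Fatou's lemma for the truncated differences N f - N(f - g k), which are at most N(g k) and
  -- converge a.e. to N f.
  calc ∫⁻ x, N f x ^ q ∂γ
      = ∫⁻ x, liminf (fun k => (N f x - N (f - g k) x) ^ q) atTop ∂γ := by
        refine lintegral_congr_ae ?_
        filter_upwards [hdiff] with x hx
        have h1 : Tendsto (fun k => N f x - N (f - g k) x) atTop (𝓝 (N f x - 0)) :=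
          ENNReal.Tendsto.sub tendsto_const_nhds hx (Or.inr (by simp))
        rw [tsub_zero] at h1
        exact (((ENNReal.continuous_rpow_const.tendsto _).comp h1).liminf_eq).symm
    _ ≤ liminf (fun k => ∫⁻ x, (N f x - N (f - g k) x) ^ q ∂γ) atTop :=
        lintegral_liminf_le fun k => ((hNm hf).sub (hNm (hf.sub (hgm k)))).pow_const q
    _ ≤ liminf (fun k : ℕ => (eLpNorm f (ENNReal.ofReal p) γ +
          2 * ENNReal.ofReal ((1 / 2) ^ k)) ^ q) atTop :=
        liminf_le_liminf (Eventually.of_forall hbound)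
    _ = _ := hlim.liminf_eq

end Hypercontractivity

/-! ### The Mehler kernel and its bounds. -/

section MehlerKernel

variable {n : ℕ}

local notation "𝔼" => EuclideanSpace ℝ (Fin n)
local notation "γ" => stdGaussian (EuclideanSpace ℝ (Fin n))

/-- The Mehler kernel with correlation `ρ`. -/
noncomputable def mehlerKernel (ρ : ℝ) (x y : 𝔼) : ℝ :=
  (1 - ρ ^ 2) ^ (-(n : ℝ) / 2) *
    Real.exp (-(ρ ^ 2 * ‖x‖ ^ 2 + ρ ^ 2 * ‖y‖ ^ 2 - 2 * ρ * inner ℝ x y) / (2 * (1 - ρ ^ 2)))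

theorem mehlerKernel_comm (ρ : ℝ) (x y : 𝔼) : mehlerKernel ρ x y = mehlerKernel ρ y x := by
  unfold mehlerKernel
  rw [real_inner_comm, add_comm (ρ ^ 2 * ‖x‖ ^ 2)]

theorem exp_neg_lt_one {t : ℝ} (ht : 0 < t) : Real.exp (-t) < 1 := by
  rw [← Real.exp_zero]
  exact Real.exp_lt_exp.2 (by linarith)

theorem one_sub_sq_pos {ρ : ℝ} (h0 : 0 < ρ) (h1 : ρ < 1) : 0 < 1 - ρ ^ 2 := by nlinarith

theorem mehlerKernel_pos {ρ : ℝ} (h0 : 0 < ρ) (h1 : ρ < 1) (x y : 𝔼) :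
    0 < mehlerKernel ρ x y := by
  have := one_sub_sq_pos h0 h1
  unfold mehlerKernel; positivity

theorem continuous_mehlerKernel (ρ : ℝ) :
    Continuous fun u : 𝔼 × 𝔼 => mehlerKernel ρ u.1 u.2 := by
  unfold mehlerKernel; fun_prop

theorem sqrt_rpow_neg {c : ℝ} (hc : 0 ≤ c) (d : ℝ) : Real.sqrt c ^ (-d) = c ^ (-d / 2) := by
  rw [Real.sqrt_eq_rpow, ← Real.rpow_mul hc]
  ring_nf

theorem gaussianRatio_eq_mehlerKernel {ρ : ℝ} (h0 : 0 < ρ) (h1 : ρ < 1) (x y : 𝔼) :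
    gaussianRatio (ρ • x) (Real.sqrt (1 - ρ ^ 2)) y = mehlerKernel ρ x y := by
  have h := one_sub_sq_pos h0 h1
  rw [gaussianRatio, mehlerKernel, Real.sq_sqrt h.le, sqrt_rpow_neg h.le, norm_sub_sq_real,
    real_inner_smul_right, norm_smul, Real.norm_of_nonneg h0.le, real_inner_comm]
  congr 2
  field_simp
  ring

/-- Completing the square in x leaves a probability density in x times a factor independent of x.
Integration in x then gives the Chapman–Kolmogorov identity. -/
theorem mehlerKernel_mul {ρ : ℝ} (h0 : 0 < ρ) (h1 : ρ < 1) (x y z : 𝔼) :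
    mehlerKernel ρ x y * mehlerKernel ρ x z = mehlerKernel (ρ ^ 2) y z *
      gaussianRatio ((ρ / (1 + ρ ^ 2)) • (y + z)) (Real.sqrt ((1 - ρ ^ 2) / (1 + ρ ^ 2))) x := by
  have h := one_sub_sq_pos h0 h1
  have h' : 0 < 1 + ρ ^ 2 := by positivity
  have h4 : 1 - (ρ ^ 2) ^ 2 = (1 - ρ ^ 2) * (1 + ρ ^ 2) := by ring
  rw [gaussianRatio, mehlerKernel, mehlerKernel, mehlerKernel, Real.sq_sqrt (by positivity),
    sqrt_rpow_neg (by positivity), h4, mul_mul_mul_comm ((1 - ρ ^ 2) ^ (-(n : ℝ) / 2)),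
    mul_mul_mul_comm (((1 - ρ ^ 2) * (1 + ρ ^ 2)) ^ (-(n : ℝ) / 2)), ← Real.exp_add,
    ← Real.exp_add]
  congr 1
  · rw [Real.mul_rpow h.le h'.le, Real.div_rpow h.le h'.le]
    have : (1 + ρ ^ 2) ^ (-(n : ℝ) / 2) ≠ 0 := by positivity
    field_simp
  · congr 1
    rw [norm_sub_sq_real, real_inner_smul_right, norm_smul, mul_pow, Real.norm_of_nonneg
      (by positivity), norm_add_sq_real, inner_add_right]
    field_simp
    ring

theorem lintegral_mehlerKernel_mul {ρ : ℝ} (h0 : 0 < ρ) (h1 : ρ < 1) (y z : 𝔼) :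
    ∫⁻ x, ENNReal.ofReal (mehlerKernel ρ x y) * ENNReal.ofReal (mehlerKernel ρ x z) ∂γ =
      ENNReal.ofReal (mehlerKernel (ρ ^ 2) y z) := by
  have h := one_sub_sq_pos h0 h1
  have h2 : 0 < ρ ^ 2 := by positivity
  have h3 : ρ ^ 2 < 1 := by linarith
  have hp : ∀ x, 0 < mehlerKernel ρ x y := fun x => mehlerKernel_pos h0 h1 x y
  simp_rw [← fun x => ENNReal.ofReal_mul (q := mehlerKernel ρ x z) (hp x).le,
    mehlerKernel_mul h0 h1, ENNReal.ofReal_mul (mehlerKernel_pos h2 h3 y z).le]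
  rw [lintegral_const_mul' _ _ (by simp), lintegral_gaussianRatio _ (by positivity), mul_one]

theorem lintegral_comp_mehler {ρ : ℝ} (h0 : 0 < ρ) (h1 : ρ < 1) (x : 𝔼) {f : 𝔼 → ℝ≥0∞}
    (hf : Measurable f) :
    ∫⁻ z, f (ρ • x + Real.sqrt (1 - ρ ^ 2) • z) ∂γ =
      ∫⁻ y, ENNReal.ofReal (mehlerKernel ρ x y) * f y ∂γ := by
  rw [lintegral_comp_affine _ (Real.sqrt_pos.2 (one_sub_sq_pos h0 h1)) hf]
  simp_rw [gaussianRatio_eq_mehlerKernel h0 h1]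

theorem integrable_mehlerKernel {ρ : ℝ} (h0 : 0 < ρ) (h1 : ρ < 1) (x : 𝔼) :
    Integrable (mehlerKernel ρ x) γ := by
  have := integrable_gaussianRatio (ρ • x) (Real.sqrt_pos.2 (one_sub_sq_pos h0 h1))
  exact this.congr (ae_of_all _ fun y => gaussianRatio_eq_mehlerKernel h0 h1 x y)

/-- The exponent equals ‖x‖²/2 - ‖ρy - x‖²/(2(1-ρ²)). Uniformity in y makes the Mehler integral
converge for every f in L¹(γ) and every x. -/
theorem mehlerKernel_le {ρ : ℝ} (h0 : 0 < ρ) (h1 : ρ < 1) (x y : 𝔼) :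
    mehlerKernel ρ x y ≤
      (1 - ρ ^ 2) ^ (-(n : ℝ) / 2) * Real.exp (‖x‖ ^ 2 / 2) := by
  have h := one_sub_sq_pos h0 h1
  unfold mehlerKernel
  refine mul_le_mul_of_nonneg_left (Real.exp_le_exp.2 ?_) (by positivity)
  rw [div_le_div_iff₀ (by positivity) (by positivity)]
  have h3 : 0 ≤ ‖ρ • y - x‖ ^ 2 := by positivity
  rw [norm_sub_sq_real, real_inner_smul_left, norm_smul, mul_pow, Real.norm_of_nonneg h0.le,
    real_inner_comm] at h3
  nlinarith

theorem measurable_ofReal_mehlerKernel (ρ : ℝ) :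
    Measurable fun u : 𝔼 × 𝔼 => ENNReal.ofReal (mehlerKernel ρ u.1 u.2) :=
  (continuous_mehlerKernel ρ).measurable.ennreal_ofReal

theorem lintegral_sq_kernel {α β : Type*} [MeasurableSpace α] [MeasurableSpace β] {μ : Measure α}
    {ν : Measure β} [SFinite μ] [SFinite ν] {K : α → β → ℝ≥0∞}
    (hK : Measurable (Function.uncurry K)) {f : β → ℝ≥0∞} (hf : Measurable f) :
    ∫⁻ x, (∫⁻ y, K x y * f y ∂ν) ^ 2 ∂μ =
      ∫⁻ y, ∫⁻ z, f y * f z * ∫⁻ x, K x y * K x z ∂μ ∂ν ∂ν := by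
  have hK1 : ∀ x, Measurable (K x) := fun x => hK.comp measurable_prodMk_left
  have hK2 : ∀ y, Measurable fun x => K x y := fun y => hK.comp measurable_prodMk_right
  have e1 : ∀ x, (∫⁻ y, K x y * f y ∂ν) ^ 2 =
      ∫⁻ y, ∫⁻ z, f y * f z * (K x y * K x z) ∂ν ∂ν := fun x => by
    rw [pow_two, ← lintegral_mul_const _ (by exact (hK1 x).mul hf)]
    refine lintegral_congr fun y => ?_
    rw [← lintegral_const_mul _ (by exact (hK1 x).mul hf)]
    refine lintegral_congr fun z => ?_
    ring
  simp_rw [e1]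
  have m2 : Measurable fun u : (α × β) × β => K u.1.1 u.1.2 :=
    hK.comp measurable_fst
  have m3 : Measurable fun u : (α × β) × β => K u.1.1 u.2 :=
    hK.comp ((measurable_fst.comp measurable_fst).prodMk measurable_snd)
  rw [lintegral_lintegral_swap]
  · refine lintegral_congr fun y => ?_
    rw [lintegral_lintegral_swap]
    · refine lintegral_congr fun z => ?_
      rw [lintegral_const_mul _ (by exact (hK2 y).mul (hK2 z))]
    · refine Measurable.aemeasurable ?_
      exact (measurable_const.mul (hf.comp measurable_snd)).mul
        (((hK2 y).comp measurable_fst).mul hK)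
  · refine Measurable.aemeasurable (Measurable.lintegral_prod_right'
      (f := fun u : (α × β) × β => f u.1.2 * f u.2 * (K u.1.1 u.1.2 * K u.1.1 u.2)) ?_)
    exact ((hf.comp (measurable_snd.comp measurable_fst)).mul (hf.comp measurable_snd)).mul
      (m2.mul m3)

theorem lintegral_sq_mehlerKernel {ρ : ℝ} (h0 : 0 < ρ) (h1 : ρ < 1) {f : 𝔼 → ℝ≥0∞}
    (hf : Measurable f) :
    ∫⁻ x, (∫⁻ y, ENNReal.ofReal (mehlerKernel ρ x y) * f y ∂γ) ^ 2 ∂γ =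
      ∫⁻ y, ∫⁻ z, f y * f z * ENNReal.ofReal (mehlerKernel (ρ ^ 2) y z) ∂γ ∂γ := by
  rw [lintegral_sq_kernel (K := fun x y => ENNReal.ofReal (mehlerKernel ρ x y))
    (measurable_ofReal_mehlerKernel ρ) hf]
  simp_rw [lintegral_mehlerKernel_mul h0 h1]

theorem ouWeight_pos {t : ℝ} (ht : 0 < t) (y : 𝔼) : 0 < ouWeight t y := by
  have : Real.exp (-(4 * t)) < 1 := exp_neg_lt_one (by linarith)
  rw [← neg_mul] at this
  have : 0 < 1 - Real.exp (-4 * t) := by linarith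
  unfold ouWeight; positivity

theorem continuous_ouWeight (t : ℝ) : Continuous (ouWeight t : 𝔼 → ℝ) := by
  unfold ouWeight; fun_prop

theorem ouWeight_eq (t : ℝ) (y : 𝔼) : ouWeight t y =
    (1 - (Real.exp (-t) ^ 2) ^ 2) ^ (-(n : ℝ) / 4) *
      Real.exp (‖y‖ ^ 2 / 2 * (Real.exp (-t) ^ 2 / (1 + Real.exp (-t) ^ 2))) := by
  have e1 : Real.exp (-4 * t) = (Real.exp (-t) ^ 2) ^ 2 := by
    rw [← pow_mul, ← Real.exp_nat_mul]
    push_cast; ring_nf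
  have e2 : Real.exp (2 * t) = (Real.exp (-t) ^ 2)⁻¹ := by
    rw [← Real.exp_nat_mul, ← Real.exp_neg]
    push_cast; ring_nf
  rw [ouWeight, e1, e2]
  congr 3
  have := Real.exp_pos (-t)
  field_simp
  ring

theorem mehlerKernel_sq_self {t : ℝ} (ht : 0 < t) (x : 𝔼) :
    mehlerKernel (Real.exp (-t) ^ 2) x x = ouWeight t x ^ 2 := by
  have h0 := Real.exp_pos (-t)
  have h1 : Real.exp (-t) < 1 := exp_neg_lt_one ht
  have h := one_sub_sq_pos h0 h1
  rw [ouWeight_eq, mehlerKernel]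
  set ρ := Real.exp (-t)
  have h4 : 0 < 1 - (ρ ^ 2) ^ 2 := by nlinarith
  rw [mul_pow, ← Real.exp_nat_mul (‖x‖ ^ 2 / 2 * _), ← Real.rpow_natCast (_ ^ (-(n : ℝ) / 4)),
    ← Real.rpow_mul h4.le, real_inner_self_eq_norm_sq]
  congr 2
  · push_cast; ring
  · have h4' : 1 - (ρ ^ 2) ^ 2 = (1 - ρ ^ 2) * (1 + ρ ^ 2) := by ring
    rw [h4']
    have : 0 < 1 + ρ ^ 2 := by positivity
    push_cast
    field_simp
    ring

/-- With ρ = e^{-t}, the quotient of the two sides is exp(-ρ²‖x-y‖²/(2(1-ρ⁴))), which is 1 precisely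
on the diagonal. -/
theorem mehlerKernel_sq_le {t : ℝ} (ht : 0 < t) (x y : 𝔼) :
    mehlerKernel (Real.exp (-t) ^ 2) x y ≤ ouWeight t x * ouWeight t y := by
  have h0 := Real.exp_pos (-t)
  have h1 : Real.exp (-t) < 1 := exp_neg_lt_one ht
  have h := one_sub_sq_pos h0 h1
  rw [ouWeight_eq, ouWeight_eq, mehlerKernel]
  set ρ := Real.exp (-t)
  have h4 : 0 < 1 - (ρ ^ 2) ^ 2 := by nlinarith
  rw [mul_mul_mul_comm, ← Real.exp_add, ← Real.rpow_add h4]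
  have e : -(n : ℝ) / 4 + -(n : ℝ) / 4 = -(n : ℝ) / 2 := by ring
  rw [e]
  gcongr
  have h4' : 1 - (ρ ^ 2) ^ 2 = (1 - ρ ^ 2) * (1 + ρ ^ 2) := by ring
  have h5 : 0 < 1 + ρ ^ 2 := by positivity
  have h6 : ‖x‖ ^ 2 / 2 * (ρ ^ 2 / (1 + ρ ^ 2)) + ‖y‖ ^ 2 / 2 * (ρ ^ 2 / (1 + ρ ^ 2)) -
      -((ρ ^ 2) ^ 2 * ‖x‖ ^ 2 + (ρ ^ 2) ^ 2 * ‖y‖ ^ 2 - 2 * ρ ^ 2 * inner ℝ x y) /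
        (2 * (1 - (ρ ^ 2) ^ 2)) = ρ ^ 2 * ‖x - y‖ ^ 2 / (2 * (1 - ρ ^ 2) * (1 + ρ ^ 2)) := by
    rw [norm_sub_sq_real, h4']
    field_simp
    ring
  have h7 : 0 ≤ ρ ^ 2 * ‖x - y‖ ^ 2 / (2 * (1 - ρ ^ 2) * (1 + ρ ^ 2)) := by positivity
  linarith

theorem lintegral_sq_mehlerKernel_le {t : ℝ} (ht : 0 < t) {f : 𝔼 → ℝ≥0∞} (hf : Measurable f) :
    ∫⁻ x, (∫⁻ y, ENNReal.ofReal (mehlerKernel (Real.exp (-t)) x y) * f y ∂γ) ^ 2 ∂γ ≤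
      (∫⁻ y, f y * ENNReal.ofReal (ouWeight t y) ∂γ) ^ 2 := by
  have hm : Measurable fun y : 𝔼 => f y * ENNReal.ofReal (ouWeight t y) :=
    hf.mul (continuous_ouWeight t).measurable.ennreal_ofReal
  rw [lintegral_sq_mehlerKernel (Real.exp_pos _) (exp_neg_lt_one ht) hf,
    pow_two (∫⁻ y, f y * _ ∂γ), ← lintegral_mul_const _ hm]
  refine lintegral_mono fun y => ?_
  rw [← lintegral_const_mul _ hm]
  refine lintegral_mono fun z => ?_
  calc f y * f z * ENNReal.ofReal (mehlerKernel (Real.exp (-t) ^ 2) y z)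
      ≤ f y * f z * ENNReal.ofReal (ouWeight t y * ouWeight t z) := by
        gcongr; exact mehlerKernel_sq_le ht y z
    _ = _ := by rw [ENNReal.ofReal_mul (ouWeight_pos ht y).le]; ring

end MehlerKernel

/-! ### The semigroup as an integral operator. -/

section Semigroup

variable {n : ℕ}

local notation "𝔼" => EuclideanSpace ℝ (Fin n)
local notation "γ" => stdGaussian (EuclideanSpace ℝ (Fin n))

theorem mehlerPoint_eq (t : ℝ) (x y : 𝔼) : mehlerPoint t x y =
    Real.exp (-t) • x + Real.sqrt (1 - Real.exp (-t) ^ 2) • y := by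
  rw [mehlerPoint, ← Real.exp_nat_mul]
  push_cast
  ring_nf

theorem quasiMeasurePreserving_mehlerPoint {t : ℝ} (ht : 0 < t) (x : 𝔼) :
    Measure.QuasiMeasurePreserving (mehlerPoint t x) γ γ := by
  have := quasiMeasurePreserving_affine (Real.exp (-t) • x)
    (Real.sqrt_pos.2 (one_sub_sq_pos (Real.exp_pos (-t)) (exp_neg_lt_one ht)))
  exact (funext (mehlerPoint_eq t x) : mehlerPoint t x = _) ▸ this

/-- For t > 0 the law of the Mehler point is absolutely continuous with respect to γ for every x, so
equality holds everywhere and N_t acts on classes. -/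
theorem ouSemigroup_congr_ae {t : ℝ} (ht : 0 < t) {f g : 𝔼 → ℝ} (hfg : f =ᵐ[γ] g) :
    ouSemigroup t f = ouSemigroup t g :=
  funext fun x => integral_congr_ae ((quasiMeasurePreserving_mehlerPoint ht x).ae_eq hfg)

theorem measurable_ouSemigroup (t : ℝ) {f : 𝔼 → ℝ} (hf : Measurable f) :
    Measurable (ouSemigroup t f) := by
  refine (StronglyMeasurable.integral_prod_right'
    (f := fun u : 𝔼 × 𝔼 => f (mehlerPoint t u.1 u.2)) ?_).measurable
  unfold mehlerPoint
  exact Measurable.stronglyMeasurable (by fun_prop)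

theorem aestronglyMeasurable_ouSemigroup {t : ℝ} (ht : 0 < t) {f : 𝔼 → ℝ}
    (hf : AEStronglyMeasurable f γ) : AEStronglyMeasurable (ouSemigroup t f) γ := by
  rw [ouSemigroup_congr_ae ht hf.ae_eq_mk]
  exact (measurable_ouSemigroup t hf.stronglyMeasurable_mk.measurable).aestronglyMeasurable

theorem ouSemigroup_eq_integral {t : ℝ} (ht : 0 < t) {f : 𝔼 → ℝ} (hf : AEStronglyMeasurable f γ)
    (x : 𝔼) : ouSemigroup t f x = ∫ y, f y * mehlerKernel (Real.exp (-t)) x y ∂γ := by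
  have h1 := exp_neg_lt_one ht
  simp_rw [ouSemigroup, mehlerPoint_eq,
    ← gaussianRatio_eq_mehlerKernel (Real.exp_pos (-t)) h1]
  exact integral_comp_affine _ (Real.sqrt_pos.2 (one_sub_sq_pos (Real.exp_pos (-t)) h1)) hf

theorem integrable_comp_mehlerPoint_iff {t : ℝ} (ht : 0 < t) {f : 𝔼 → ℝ}
    (hf : AEStronglyMeasurable f γ) (x : 𝔼) : Integrable (fun y => f (mehlerPoint t x y)) γ ↔
      Integrable (fun y => f y * mehlerKernel (Real.exp (-t)) x y) γ := by
  have h1 := exp_neg_lt_one ht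
  simp_rw [mehlerPoint_eq, ← gaussianRatio_eq_mehlerKernel (Real.exp_pos (-t)) h1]
  exact integrable_comp_affine _ (Real.sqrt_pos.2 (one_sub_sq_pos (Real.exp_pos (-t)) h1)) hf

/-- The Mehler kernel is bounded in each variable, so `N_t` is defined on `L¹(γ)`. -/
theorem integrable_comp_mehlerPoint {t : ℝ} (ht : 0 < t) {f : 𝔼 → ℝ} (hf : Integrable f γ)
    (x : 𝔼) : Integrable (fun y => f (mehlerPoint t x y)) γ := by
  rw [integrable_comp_mehlerPoint_iff ht hf.aestronglyMeasurable]
  refine hf.mul_bdd (c := (1 - Real.exp (-t) ^ 2) ^ (-(n : ℝ) / 2) * Real.exp (‖x‖ ^ 2 / 2))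
    (integrable_mehlerKernel (Real.exp_pos _) (exp_neg_lt_one ht) x).aestronglyMeasurable
    (ae_of_all _ fun y => ?_)
  rw [Real.norm_of_nonneg (mehlerKernel_pos (Real.exp_pos _) (exp_neg_lt_one ht) x y).le]
  exact mehlerKernel_le (Real.exp_pos _) (exp_neg_lt_one ht) x y

theorem enorm_ouSemigroup_le {t : ℝ} (ht : 0 < t) {f : 𝔼 → ℝ} (hf : Measurable f) (x : 𝔼) :
    ‖ouSemigroup t f x‖ₑ ≤
      ∫⁻ y, ENNReal.ofReal (mehlerKernel (Real.exp (-t)) x y) * ‖f y‖ₑ ∂γ := by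
  rw [← lintegral_comp_mehler (Real.exp_pos _) (exp_neg_lt_one ht) x hf.enorm]
  simp_rw [← mehlerPoint_eq]
  exact enorm_integral_le_lintegral_enorm _

theorem eLpNorm_two_sq (f : 𝔼 → ℝ) : eLpNorm f 2 γ ^ 2 = ∫⁻ x, ‖f x‖ₑ ^ 2 ∂γ := by
  have := eLpNorm_nnreal_pow_eq_lintegral (f := f) (p := 2) (μ := γ) two_ne_zero
  simpa using this

theorem eLpNorm_two_ouSemigroup_le {t : ℝ} (ht : 0 < t) {f : 𝔼 → ℝ}
    (hf : AEStronglyMeasurable f γ) :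
    eLpNorm (ouSemigroup t f) 2 γ ≤ ∫⁻ y, ‖f y‖ₑ * ENNReal.ofReal (ouWeight t y) ∂γ := by
  wlog hm : Measurable f generalizing f
  · have := this hf.stronglyMeasurable_mk.aestronglyMeasurable hf.stronglyMeasurable_mk.measurable
    rw [ouSemigroup_congr_ae ht hf.ae_eq_mk]
    refine this.trans_eq (lintegral_congr_ae ?_)
    filter_upwards [hf.ae_eq_mk] with x hx
    rw [hx]
  refine (ENNReal.pow_le_pow_left_iff two_ne_zero).1 ?_
  rw [eLpNorm_two_sq]
  exact (lintegral_mono fun x => pow_le_pow_left' (enorm_ouSemigroup_le ht hm x) 2).trans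
    (lintegral_sq_mehlerKernel_le ht hm.enorm)

end Semigroup

/-! ### The weight V_t: dilation form, sharpness, kernel uniqueness, diagonal integral. -/

section WeightedBound

variable {n : ℕ}

local notation "𝔼" => EuclideanSpace ℝ (Fin n)
local notation "γ" => stdGaussian (EuclideanSpace ℝ (Fin n))

theorem dilation_congr_ae (a : ℝ) {f g : 𝔼 → ℝ} (hfg : f =ᵐ[γ] g) :
    dilation a f =ᵐ[γ] dilation a g :=
  (quasiMeasurePreserving_smul (Real.exp_pos (a / 2))).ae_eq hfg

theorem exp_neg_two_mul_eq (t : ℝ) : Real.exp (-2 * t) = Real.exp (-t) ^ 2 := by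
  rw [← Real.exp_nat_mul]; push_cast; ring_nf

/-- With r = e^{-2t}, the exponential in V_t is a tilt with ν = r/(1+r). The dilation absorbing it
has factor (1-ν)^{-1/2} = √(1+r), that is, exp(ln(1+r)/2). -/
theorem eLpNorm_dilation_eq_lintegral_ouWeight {t : ℝ} (ht : 0 < t) {f : 𝔼 → ℝ}
    (hf : AEStronglyMeasurable f γ) :
    ENNReal.ofReal (((Real.exp (-2 * t) + 1) / (1 - Real.exp (-2 * t))) ^ ((n : ℝ) / 4)) *
        eLpNorm (dilation (Real.log (Real.exp (-2 * t) + 1)) f) 1 γ =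
      ∫⁻ y, ‖f y‖ₑ * ENNReal.ofReal (ouWeight t y) ∂γ := by
  wlog hm : Measurable f generalizing f
  · have := this hf.stronglyMeasurable_mk.aestronglyMeasurable hf.stronglyMeasurable_mk.measurable
    rw [eLpNorm_congr_ae (dilation_congr_ae _ hf.ae_eq_mk), this]
    refine lintegral_congr_ae ?_
    filter_upwards [hf.ae_eq_mk] with y hy
    rw [← hy]
  have h := one_sub_sq_pos (Real.exp_pos (-t)) (exp_neg_lt_one ht)
  rw [exp_neg_two_mul_eq, eLpNorm_one_eq_lintegral_enorm]
  simp_rw [dilation, ouWeight_eq]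
  set r := Real.exp (-t) ^ 2 with hr
  have h0 : 0 < r := by positivity
  have h1 : 0 < 1 + r := by positivity
  have hν : r / (1 + r) < 1 := by rw [div_lt_one h1]; linarith
  have e1 : 1 - r / (1 + r) = (1 + r)⁻¹ := by field_simp; ring
  have e2 : (1 - r / (1 + r)) ^ (-(1 / 2) : ℝ) = Real.exp (Real.log (r + 1) / 2) := by
    rw [e1, Real.inv_rpow h1.le, Real.rpow_neg h1.le, inv_inv, Real.rpow_def_of_pos h1]
    ring_nf
  have key := lintegral_exp_mul (n := n) hν hm.enorm
  rw [e2] at key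
  have e3 : ∀ y : 𝔼, ‖f y‖ₑ * ENNReal.ofReal ((1 - r ^ 2) ^ (-(n : ℝ) / 4) *
      Real.exp (‖y‖ ^ 2 / 2 * (r / (1 + r)))) = ENNReal.ofReal ((1 - r ^ 2) ^ (-(n : ℝ) / 4)) *
      (ENNReal.ofReal (Real.exp (r / (1 + r) * ‖y‖ ^ 2 / 2)) * ‖f y‖ₑ) := fun y => by
    have : 0 ≤ 1 - r ^ 2 := by nlinarith
    rw [ENNReal.ofReal_mul (by positivity)]
    ring_nf
  have hd : 0 < 1 - r ^ 2 := by nlinarith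
  simp_rw [e3]
  rw [lintegral_const_mul _ (by fun_prop), key, ← mul_assoc, ← ENNReal.ofReal_mul (by positivity)]
  congr 2
  rw [e1, Real.inv_rpow h1.le, ← Real.rpow_neg h1.le,
    show 1 - r ^ 2 = (1 - r) * (1 + r) by ring, Real.mul_rpow h.le h1.le, mul_assoc,
    ← Real.rpow_add h1, add_comm r 1, Real.div_rpow h1.le h.le, neg_div, Real.rpow_neg h.le,
    div_eq_inv_mul]
  ring_nf

/-- V_t is bounded below by its positive value at the origin. -/
theorem integrable_of_integrable_mul_ouWeight {t : ℝ} (ht : 0 < t) {f : 𝔼 → ℝ}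
    (hf : AEStronglyMeasurable f γ) (h : Integrable (fun y => f y * ouWeight t y) γ) :
    Integrable f γ := by
  have h4 : 0 < 1 - Real.exp (-4 * t) := by
    have : Real.exp (-(4 * t)) < 1 := exp_neg_lt_one (by linarith)
    rw [← neg_mul] at this; linarith
  refine (h.mul_const ((1 - Real.exp (-4 * t)) ^ ((n : ℝ) / 4))).mono hf (ae_of_all _ fun y => ?_)
  have : (1 : ℝ) ≤ ouWeight t y * (1 - Real.exp (-4 * t)) ^ ((n : ℝ) / 4) := by
    rw [ouWeight, mul_right_comm, ← Real.rpow_add h4, neg_div, neg_add_cancel, Real.rpow_zero,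
      one_mul]
    exact Real.one_le_exp (by positivity)
  rw [mul_assoc, norm_mul]
  exact le_mul_of_one_le_right (norm_nonneg _) (this.trans (le_abs_self _))

theorem enorm_ouSemigroup_eq {t : ℝ} (ht : 0 < t) {f : 𝔼 → ℝ} (hf : Measurable f)
    (hi : Integrable f γ) (h0 : ∀ x, 0 ≤ f x) (x : 𝔼) : ‖ouSemigroup t f x‖ₑ =
      ∫⁻ y, ENNReal.ofReal (mehlerKernel (Real.exp (-t)) x y) * ‖f y‖ₑ ∂γ := by
  rw [← lintegral_comp_mehler (Real.exp_pos _) (exp_neg_lt_one ht) x hf.enorm]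
  simp_rw [← mehlerPoint_eq]
  rw [ouSemigroup, Real.enorm_of_nonneg (integral_nonneg fun y => h0 _),
    ofReal_integral_eq_lintegral_ofReal (integrable_comp_mehlerPoint ht hi x)
      (ae_of_all _ fun y => h0 _)]
  simp_rw [Real.enorm_of_nonneg (h0 _)]

theorem eLpNorm_two_ouSemigroup_indicator_sq {t : ℝ} (ht : 0 < t) {B : Set 𝔼}
    (hB : MeasurableSet B) : eLpNorm (ouSemigroup t (B.indicator fun _ => 1)) 2 γ ^ 2 =
      ∫⁻ y in B, ∫⁻ z in B, ENNReal.ofReal (mehlerKernel (Real.exp (-t) ^ 2) y z) ∂γ ∂γ := by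
  have hm : Measurable (B.indicator fun _ => (1 : ℝ)) := measurable_const.indicator hB
  have hi : Integrable (B.indicator fun _ => (1 : ℝ)) γ := (integrable_const 1).indicator hB
  have h0 : ∀ x, 0 ≤ B.indicator (fun _ => (1 : ℝ)) x := fun x => by
    by_cases hx : x ∈ B <;> simp [hx]
  rw [eLpNorm_two_sq]
  simp_rw [enorm_ouSemigroup_eq ht hm hi h0]
  rw [lintegral_sq_mehlerKernel (Real.exp_pos _) (exp_neg_lt_one ht) hm.enorm,
    ← lintegral_indicator hB]
  refine lintegral_congr fun y => ?_
  by_cases hy : y ∈ B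
  · rw [indicator_of_mem hy, indicator_of_mem hy, ← lintegral_indicator hB]
    refine lintegral_congr fun z => ?_
    by_cases hz : z ∈ B <;> simp [hz]
  · simp [hy]

/-- If V < q < V_t on a set of positive measure, then near some point of that set n_{2t} > q² in
both variables, since n_{2t} = V_t² on the diagonal. For a small piece B of the set this gives ‖N_t
1_B‖₂ ≥ qγ(B) > ∫_B V, a contradiction. -/
theorem ouWeight_le_of_eLpNorm_two_le {t : ℝ} (ht : 0 < t) {V : 𝔼 → ℝ≥0∞} (hV : Measurable V)
    (h : ∀ f : 𝔼 → ℝ, Measurable f → (∃ C : ℝ, ∀ x, |f x| ≤ C) →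
      eLpNorm (ouSemigroup t f) 2 γ ≤ ∫⁻ y, ‖f y‖ₑ * V y ∂γ) :
    ∀ᵐ y ∂γ, ENNReal.ofReal (ouWeight t y) ≤ V y := by
  by_contra hcon
  have hpos : γ {y | V y < ENNReal.ofReal (ouWeight t y)} ≠ 0 := by
    simpa [ae_iff] using hcon
  have hsub : {y : 𝔼 | V y < ENNReal.ofReal (ouWeight t y)} ⊆
      ⋃ q : ℚ, {y | V y < ENNReal.ofReal q ∧ ENNReal.ofReal q < ENNReal.ofReal (ouWeight t y)} := by
    intro y hy
    obtain ⟨q, -, h1, h2⟩ := ENNReal.lt_iff_exists_rat_btwn.1 hy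
    exact mem_iUnion.2 ⟨q, h1, h2⟩
  obtain ⟨q, hq⟩ : ∃ q : ℚ, γ {y : 𝔼 | V y < ENNReal.ofReal q ∧
      ENNReal.ofReal q < ENNReal.ofReal (ouWeight t y)} ≠ 0 := by
    by_contra! hall
    exact hpos (measure_mono_null hsub (measure_iUnion_null hall))
  set S : Set 𝔼 := {y | V y < ENNReal.ofReal q ∧
    ENNReal.ofReal q < ENNReal.ofReal (ouWeight t y)} with hS
  have hSm : MeasurableSet S :=
    (measurableSet_lt hV measurable_const).inter
      (measurableSet_lt measurable_const (continuous_ouWeight t).measurable.ennreal_ofReal)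
  -- A point all of whose neighbourhoods meet S in positive measure, so that localising does not
  -- lose the mass.
  obtain ⟨y₀, hy₀, hnhds⟩ := exists_mem_forall_mem_nhdsWithin_pos_measure hq
  set K : 𝔼 × 𝔼 → ℝ≥0∞ := fun u =>
    ENNReal.ofReal (mehlerKernel (Real.exp (-t) ^ 2) u.1 u.2) with hK
  have hKc : Continuous K := ENNReal.continuous_ofReal.comp (continuous_mehlerKernel _)
  have hK0 : ENNReal.ofReal q ^ 2 < K (y₀, y₀) := by
    simp only [hK, mehlerKernel_sq_self ht]
    rw [ENNReal.ofReal_pow (ouWeight_pos ht y₀).le]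
    exact ENNReal.pow_lt_pow_left two_ne_zero hy₀.2
  have hev : ∀ᶠ u in 𝓝 y₀ ×ˢ 𝓝 y₀, ENNReal.ofReal q ^ 2 < K u := by
    rw [← nhds_prod_eq]
    exact hKc.continuousAt.eventually (lt_mem_nhds hK0)
  obtain ⟨W, hW, hWK⟩ := eventually_prod_self_iff'.1 hev
  obtain ⟨U, hUW, hUo, hyU⟩ := mem_nhds_iff.1 hW
  set B := U ∩ S with hB
  have hBm : MeasurableSet B := hUo.measurableSet.inter hSm
  have hBpos : γ B ≠ 0 :=
    (hnhds B (inter_mem (mem_nhdsWithin_of_mem_nhds (hUo.mem_nhds hyU)) self_mem_nhdsWithin)).ne'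
  have hlow : (ENNReal.ofReal q * γ B) ^ 2 ≤
      eLpNorm (ouSemigroup t (B.indicator fun _ => 1)) 2 γ ^ 2 := by
    rw [eLpNorm_two_ouSemigroup_indicator_sq ht hBm]
    calc (ENNReal.ofReal q * γ B) ^ 2
        = ∫⁻ y in B, ∫⁻ z in B, ENNReal.ofReal q ^ 2 ∂γ ∂γ := by simp; ring
      _ ≤ _ := setLIntegral_mono' hBm fun y hy => setLIntegral_mono' hBm fun z hz =>
          (hWK y (hUW hy.1) z (hUW hz.1)).le
  have hup : ∫⁻ y, ‖B.indicator (fun _ => (1 : ℝ)) y‖ₑ * V y ∂γ < ENNReal.ofReal q * γ B := by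
    calc ∫⁻ y, ‖B.indicator (fun _ => (1 : ℝ)) y‖ₑ * V y ∂γ = ∫⁻ y in B, V y ∂γ := by
          rw [← lintegral_indicator hBm]
          refine lintegral_congr fun y => ?_
          by_cases hy : y ∈ B <;> simp [hy]
      _ < ∫⁻ y in B, ENNReal.ofReal q ∂γ := by
          refine setLIntegral_strict_mono hBm hBpos measurable_const ?_
            (ae_of_all _ fun y hy => hy.2.1)
          refine ((setLIntegral_mono' hBm fun y hy => hy.2.1.le).trans_lt ?_).ne
          rw [setLIntegral_const]
          exact ENNReal.mul_lt_top ENNReal.ofReal_lt_top (measure_lt_top _ _)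
      _ = _ := by simp
  have hle := h (B.indicator fun _ => 1) (measurable_const.indicator hBm)
    ⟨1, fun x => by by_cases hx : x ∈ B <;> simp [hx]⟩
  exact absurd ((hle.trans_lt hup)) (not_lt.2 ((ENNReal.pow_le_pow_left_iff two_ne_zero).1 hlow))

theorem isOUKernel_mehlerKernel {t : ℝ} (ht : 0 < t) :
    IsOUKernel (n := n) t (mehlerKernel (Real.exp (-t))) where
  continuous := continuous_mehlerKernel _
  integrable := integrable_mehlerKernel (Real.exp_pos _) (exp_neg_lt_one ht)
  repr _ hf _ x := ouSemigroup_eq_integral ht hf.aestronglyMeasurable x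

/-- For fixed x, testing on indicators gives equality a.e. in y; continuity and full support of γ
upgrade it to all y. -/
theorem IsOUKernel.eq {t : ℝ} {k l : 𝔼 → 𝔼 → ℝ} (hk : IsOUKernel t k) (hl : IsOUKernel t l) :
    k = l := by
  funext x
  have hc : ∀ {j : 𝔼 → 𝔼 → ℝ}, IsOUKernel t j → Continuous (j x) := fun hj =>
    hj.continuous.comp (Continuous.prodMk_right x)
  refine ((hc hk).ae_eq_iff_eq γ (hc hl)).1 ?_
  refine (hk.integrable x).ae_eq_of_forall_setIntegral_eq _ _ (hl.integrable x) fun s hs _ => ?_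
  have hb : ∃ C : ℝ, ∀ x : 𝔼, |s.indicator (fun _ => (1 : ℝ)) x| ≤ C :=
    ⟨1, fun x => by by_cases hx : x ∈ s <;> simp [hx]⟩
  have hm : Measurable (s.indicator fun _ => (1 : ℝ)) := measurable_const.indicator hs
  have := (hk.repr _ hm hb x).symm.trans (hl.repr _ hm hb x)
  have e : ∀ j : 𝔼 → ℝ, (fun y => s.indicator (fun _ => (1 : ℝ)) y * j y) = s.indicator j :=
    fun j => by ext y; by_cases hy : y ∈ s <;> simp [hy]
  rwa [e, e, integral_indicator hs, integral_indicator hs] at this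

theorem lintegral_mehlerKernel_self {t : ℝ} (ht : 0 < t) :
    ∫⁻ x : 𝔼, ENNReal.ofReal (mehlerKernel (Real.exp (-t)) x x) ∂γ =
      ENNReal.ofReal ((1 - Real.exp (-t)) ^ n)⁻¹ := by
  have h0 := Real.exp_pos (-t)
  have h1 := exp_neg_lt_one ht
  have h2 := one_sub_sq_pos h0 h1
  set r := Real.exp (-t)
  have h3 : 0 < 1 - r := by linarith
  -- On the diagonal the kernel is a centred tilt with ν = 2r/(1+r), and (1-r²)(1-ν) = (1-r)².
  have hν : 2 * r / (1 + r) < 1 := by rw [div_lt_one (by positivity)]; linarith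
  have key := lintegral_exp_mul (n := n) hν (H := fun _ => 1) measurable_const
  have e : ∀ x : 𝔼, mehlerKernel r x x =
      (1 - r ^ 2) ^ (-(n : ℝ) / 2) * Real.exp (2 * r / (1 + r) * ‖x‖ ^ 2 / 2) := fun x => by
    rw [mehlerKernel, real_inner_self_eq_norm_sq]
    congr 2
    field_simp
    rw [show 1 - r ^ 2 = (1 - r) * (1 + r) by ring]
    field_simp
    ring
  simp only [mul_one, lintegral_one, measure_univ] at key
  simp_rw [e, ENNReal.ofReal_mul (show 0 ≤ (1 - r ^ 2) ^ (-(n : ℝ) / 2) by positivity)]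
  rw [lintegral_const_mul _ (by fun_prop), key, ← ENNReal.ofReal_mul (by positivity),
    ← Real.mul_rpow h2.le (by linarith),
    show (1 - r ^ 2) * (1 - 2 * r / (1 + r)) = (1 - r) ^ (2 : ℝ) by
      rw [Real.rpow_two]; field_simp; ring,
    ← Real.rpow_mul h3.le, show (2 : ℝ) * (-n / 2) = -n by ring, Real.rpow_neg h3.le,
    Real.rpow_natCast]

theorem integrable_mehlerKernel_self {t : ℝ} (ht : 0 < t) :
    Integrable (fun x : 𝔼 => mehlerKernel (Real.exp (-t)) x x) γ := by
  refine ⟨((continuous_mehlerKernel _).comp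
    (continuous_id.prodMk continuous_id)).aestronglyMeasurable, ?_⟩
  rw [hasFiniteIntegral_iff_ofReal (ae_of_all _ fun x =>
    (mehlerKernel_pos (Real.exp_pos _) (exp_neg_lt_one ht) x x).le),
    lintegral_mehlerKernel_self ht]
  exact ENNReal.ofReal_lt_top

theorem integral_mehlerKernel_self {t : ℝ} (ht : 0 < t) :
    ∫ x : 𝔼, mehlerKernel (Real.exp (-t)) x x ∂γ = ((1 - Real.exp (-t)) ^ n)⁻¹ := by
  have : 0 < 1 - Real.exp (-t) := sub_pos.2 (exp_neg_lt_one ht)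
  rw [integral_eq_lintegral_of_nonneg_ae (ae_of_all _ fun x =>
    (mehlerKernel_pos (Real.exp_pos _) (exp_neg_lt_one ht) x x).le)
    (integrable_mehlerKernel_self ht).aestronglyMeasurable,
    lintegral_mehlerKernel_self ht, ENNReal.toReal_ofReal (by positivity)]

end WeightedBound

/-! ### The operator on L²(γ) and its trace. -/

section TraceClass

/-- Orthonormal vectors are √2 apart, so the balls of radius 1/2 around them are disjoint.
Countability is what permits exchanging the sum over a basis with the integral. -/
theorem Orthonormal.countable_of_separableSpace {E ι : Type*} [NormedAddCommGroup E]
    [InnerProductSpace ℝ E] [TopologicalSpace.SeparableSpace E] {v : ι → E}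
    (hv : Orthonormal ℝ v) : Countable ι := by
  have hd : (univ : Set ι).PairwiseDisjoint fun i => Metric.ball (v i) (1 / 2) := by
    intro i _ j _ hij
    refine Metric.ball_disjoint_ball ?_
    have h2 : ‖v i - v j‖ ^ 2 = 2 := by
      rw [norm_sub_sq_real, hv.1 i, hv.1 j, hv.2 hij]; norm_num
    rw [dist_eq_norm]
    nlinarith [norm_nonneg (v i - v j)]
  exact countable_univ_iff.1 (hd.countable_of_isOpen (fun _ _ => Metric.isOpen_ball)
    fun i _ => ⟨v i, Metric.mem_ball_self (by norm_num)⟩)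

theorem ENNReal.mul_le_sq_add_sq (a b : ℝ≥0∞) : a * b ≤ a ^ 2 + b ^ 2 := by
  rcases le_total a b with h | h
  · calc a * b ≤ b * b := by gcongr
      _ ≤ _ := by rw [pow_two b]; exact le_add_self
  · calc a * b ≤ a * a := by gcongr
      _ ≤ _ := by rw [pow_two a]; exact le_self_add

variable {n : ℕ}

local notation "𝔼" => EuclideanSpace ℝ (Fin n)
local notation "γ" => stdGaussian (EuclideanSpace ℝ (Fin n))

theorem integral_mehlerKernel_mul {ρ : ℝ} (h0 : 0 < ρ) (h1 : ρ < 1) (y z : 𝔼) :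
    ∫ x, mehlerKernel ρ x y * mehlerKernel ρ x z ∂γ = mehlerKernel (ρ ^ 2) y z := by
  have hp := mehlerKernel_pos (n := n) h0 h1
  have hc : ∀ y : 𝔼, Continuous fun x => mehlerKernel ρ x y := fun y => by
    have := (continuous_mehlerKernel ρ).comp (Continuous.prodMk_left y)
    exact this
  have hm : AEStronglyMeasurable (fun x => mehlerKernel ρ x y * mehlerKernel ρ x z) γ :=
    Continuous.aestronglyMeasurable (Continuous.mul (hc y) (hc z))
  have hmul : ∀ x, ENNReal.ofReal (mehlerKernel ρ x y * mehlerKernel ρ x z) =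
      ENNReal.ofReal (mehlerKernel ρ x y) * ENNReal.ofReal (mehlerKernel ρ x z) := fun x =>
    ENNReal.ofReal_mul (hp x y).le
  have hpos : 0 < mehlerKernel (ρ ^ 2) y z :=
    mehlerKernel_pos (by positivity) (pow_lt_one₀ h0.le h1 two_ne_zero) y z
  rw [integral_eq_lintegral_of_nonneg_ae
    (ae_of_all _ fun x => (mul_pos (hp x y) (hp x z)).le) hm, lintegral_congr hmul,
    lintegral_mehlerKernel_mul h0 h1, ENNReal.toReal_ofReal hpos.le]

theorem lintegral_sq_mehlerKernel_le_eLpNorm {t : ℝ} (ht : 0 < t) {f : 𝔼 → ℝ}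
    (hf : Measurable f) :
    ∫⁻ x, (∫⁻ y, ENNReal.ofReal (mehlerKernel (Real.exp (-t)) x y) * ‖f y‖ₑ ∂γ) ^ 2 ∂γ ≤
      eLpNorm f 2 γ ^ 2 := by
  have h1 := exp_neg_lt_one ht
  have h2 := one_sub_sq_pos (Real.exp_pos (-t)) h1
  have := lintegral_mehler_rpow_le (n := n) (p := 2) (q := 2) one_lt_two one_lt_two
    (ρ := Real.exp (-t)) (σ := Real.sqrt (1 - Real.exp (-t) ^ 2))
    (by rw [Real.sq_sqrt h2.le]; ring) (Real.sqrt_nonneg _) (by linarith) hf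
  simp_rw [ENNReal.rpow_two, ENNReal.ofReal_ofNat] at this
  simp_rw [← lintegral_comp_mehler (Real.exp_pos _) h1 _ hf.enorm]
  exact this

theorem eLpNorm_two_ouSemigroup_le_eLpNorm {t : ℝ} (ht : 0 < t) {f : 𝔼 → ℝ}
    (hf : Measurable f) : eLpNorm (ouSemigroup t f) 2 γ ≤ eLpNorm f 2 γ := by
  rw [← ENNReal.pow_le_pow_left_iff two_ne_zero, eLpNorm_two_sq (ouSemigroup t f)]
  refine le_trans (lintegral_mono fun x => ?_) (lintegral_sq_mehlerKernel_le_eLpNorm ht hf)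
  gcongr
  exact enorm_ouSemigroup_le ht hf x

theorem integral_ouSemigroup_mul_comm {t : ℝ} (ht : 0 < t) {f g : 𝔼 → ℝ} (hf : Measurable f)
    (hg : Measurable g) (hf2 : MemLp f 2 γ) (hg2 : MemLp g 2 γ) :
    ∫ x, ouSemigroup t f x * g x ∂γ = ∫ x, f x * ouSemigroup t g x ∂γ := by
  have hk := continuous_mehlerKernel (n := n) (Real.exp (-t))
  have hp := mehlerKernel_pos (n := n) (Real.exp_pos (-t)) (exp_neg_lt_one ht)
  have hm : Measurable (Function.uncurry fun x y : 𝔼 =>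
      f y * mehlerKernel (Real.exp (-t)) x y * g x) :=
    ((hf.comp measurable_snd).mul hk.measurable).mul (hg.comp measurable_fst)
  have hint : Integrable (Function.uncurry fun x y =>
      f y * mehlerKernel (Real.exp (-t)) x y * g x) ((γ).prod γ) := by
    refine ⟨hm.aestronglyMeasurable, ?_⟩
    rw [hasFiniteIntegral_iff_enorm, lintegral_prod _ hm.enorm.aemeasurable]
    -- Joint integrability, needed for Fubini: ab ≤ a² + b² and the L² contraction for absolute
    -- values.
    exact calc
      ∫⁻ x, ∫⁻ y, ‖f y * mehlerKernel (Real.exp (-t)) x y * g x‖ₑ ∂γ ∂γ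
        = ∫⁻ x, (∫⁻ y, ENNReal.ofReal (mehlerKernel (Real.exp (-t)) x y) * ‖f y‖ₑ ∂γ) *
            ‖g x‖ₑ ∂γ := lintegral_congr fun x => by
          rw [← lintegral_mul_const'  _ _ enorm_ne_top]
          refine lintegral_congr fun y => ?_
          rw [enorm_mul, enorm_mul, Real.enorm_of_nonneg (hp x y).le, mul_comm ‖f y‖ₑ]
      _ ≤ ∫⁻ x, ((∫⁻ y, ENNReal.ofReal (mehlerKernel (Real.exp (-t)) x y) * ‖f y‖ₑ ∂γ) ^ 2 +
            ‖g x‖ₑ ^ 2) ∂γ := lintegral_mono fun x => ENNReal.mul_le_sq_add_sq _ _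
      _ ≤ eLpNorm f 2 γ ^ 2 + eLpNorm g 2 γ ^ 2 := by
          rw [lintegral_add_right _ (hg.enorm.pow_const 2), eLpNorm_two_sq g]
          gcongr
          exact lintegral_sq_mehlerKernel_le_eLpNorm ht hf
      _ < ⊤ := ENNReal.add_lt_top.2 ⟨ENNReal.pow_lt_top hf2.2, ENNReal.pow_lt_top hg2.2⟩
  simp_rw [ouSemigroup_eq_integral ht hf.aestronglyMeasurable,
    ouSemigroup_eq_integral ht hg.aestronglyMeasurable, ← integral_mul_const,
    ← integral_const_mul]
  rw [integral_integral_swap hint]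
  refine integral_congr_ae (ae_of_all _ fun x => integral_congr_ae (ae_of_all _ fun y => ?_))
  simp only []
  rw [mehlerKernel_comm]
  ring

/-- Fubini and Chapman–Kolmogorov. Equal times suffice, as the purpose is to exhibit a square root
of N_{2t}. -/
theorem ouSemigroup_ouSemigroup {t : ℝ} (ht : 0 < t) {f : 𝔼 → ℝ} (hf : Measurable f)
    (hi : Integrable f γ) (x : 𝔼) :
    ouSemigroup t (ouSemigroup t f) x = ouSemigroup (2 * t) f x := by
  have hk := continuous_mehlerKernel (n := n) (Real.exp (-t))
  have h0 := Real.exp_pos (-t)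
  have h1 := exp_neg_lt_one ht
  have hp := mehlerKernel_pos (n := n) h0 h1
  have ht2 : 0 < 2 * t := by linarith
  have e : Real.exp (-(2 * t)) = Real.exp (-t) ^ 2 := by
    rw [← exp_neg_two_mul_eq, neg_mul]
  have hm : Measurable (Function.uncurry fun y z : 𝔼 =>
      f z * mehlerKernel (Real.exp (-t)) y z * mehlerKernel (Real.exp (-t)) x y) :=
    ((hf.comp measurable_snd).mul hk.measurable).mul
      (hk.comp (continuous_const.prodMk continuous_fst)).measurable
  have hint : Integrable (Function.uncurry fun y z =>
      f z * mehlerKernel (Real.exp (-t)) y z * mehlerKernel (Real.exp (-t)) x y)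
      ((γ).prod γ) := by
    refine ⟨hm.aestronglyMeasurable, ?_⟩
    rw [hasFiniteIntegral_iff_enorm, lintegral_prod_symm _ hm.enorm.aemeasurable]
    exact calc
      ∫⁻ z, ∫⁻ y, ‖f z * mehlerKernel (Real.exp (-t)) y z *
            mehlerKernel (Real.exp (-t)) x y‖ₑ ∂γ ∂γ
        = ∫⁻ z, ‖f z * mehlerKernel (Real.exp (-(2 * t))) x z‖ₑ ∂γ :=
          lintegral_congr fun z => by
          rw [enorm_mul, Real.enorm_of_nonneg (mehlerKernel_pos (Real.exp_pos _)
            (exp_neg_lt_one ht2) x z).le, e, ← lintegral_mehlerKernel_mul h0 h1,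
            ← lintegral_const_mul' _ _ enorm_ne_top]
          refine lintegral_congr fun y => ?_
          rw [enorm_mul, enorm_mul, Real.enorm_of_nonneg (hp _ _).le,
            Real.enorm_of_nonneg (hp _ _).le, mehlerKernel_comm _ x y]
          ring
      _ < ⊤ := ((integrable_comp_mehlerPoint_iff ht2 hf.aestronglyMeasurable x).1
          (integrable_comp_mehlerPoint ht2 hi x)).2
  rw [ouSemigroup_eq_integral ht (measurable_ouSemigroup t hf).aestronglyMeasurable,
    ouSemigroup_eq_integral ht2 hf.aestronglyMeasurable]
  simp_rw [ouSemigroup_eq_integral ht hf.aestronglyMeasurable, ← integral_mul_const]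
  rw [integral_integral_swap hint]
  refine integral_congr_ae (ae_of_all _ fun z => ?_)
  simp only []
  rw [e, ← integral_mehlerKernel_mul h0 h1, ← integral_const_mul]
  refine integral_congr_ae (ae_of_all _ fun y => ?_)
  simp only []
  rw [mehlerKernel_comm _ x y]
  ring

theorem memLp_two_ouSemigroup {t : ℝ} (ht : 0 < t) (f : Lp ℝ 2 γ) :
    MemLp (ouSemigroup t f) 2 γ :=
  ⟨aestronglyMeasurable_ouSemigroup ht (Lp.aestronglyMeasurable f),
    (eLpNorm_two_ouSemigroup_le_eLpNorm ht (Lp.stronglyMeasurable f).measurable).trans_lt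
      (Lp.memLp f).2⟩

theorem integrable_coeFn_Lp_two (f : Lp ℝ 2 γ) : Integrable f γ :=
  (Lp.memLp f).integrable one_le_two

/-- The Ornstein-Uhlenbeck semigroup as a bounded operator on `L²(γ)`. -/
noncomputable def ouOperator {t : ℝ} (ht : 0 < t) : Lp ℝ 2 γ →L[ℝ] Lp ℝ 2 γ :=
  LinearMap.mkContinuous
    { toFun := fun f => (memLp_two_ouSemigroup ht f).toLp _
      map_add' := fun f g => by
        rw [← MemLp.toLp_add]
        refine MemLp.toLp_congr _ _ (ae_of_all _ fun x => ?_)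
        rw [ouSemigroup_congr_ae ht (Lp.coeFn_add f g)]
        exact integral_add (integrable_comp_mehlerPoint ht (integrable_coeFn_Lp_two f) x)
          (integrable_comp_mehlerPoint ht (integrable_coeFn_Lp_two g) x)
      map_smul' := fun c f => by
        rw [RingHom.id_apply, ← MemLp.toLp_const_smul]
        refine MemLp.toLp_congr _ _ (ae_of_all _ fun x => ?_)
        rw [ouSemigroup_congr_ae ht (Lp.coeFn_smul c f)]
        exact integral_const_mul c _ }
    1 fun f => by
      rw [one_mul]
      change ‖(memLp_two_ouSemigroup ht f).toLp _‖ ≤ ‖f‖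
      rw [Lp.norm_toLp, Lp.norm_def]
      exact ENNReal.toReal_mono (Lp.eLpNorm_ne_top f)
        (eLpNorm_two_ouSemigroup_le_eLpNorm ht (Lp.stronglyMeasurable f).measurable)

theorem coeFn_ouOperator {t : ℝ} (ht : 0 < t) (f : Lp ℝ 2 γ) :
    ouOperator ht f =ᵐ[γ] ouSemigroup t f :=
  MemLp.coeFn_toLp (memLp_two_ouSemigroup ht f)

theorem inner_ouOperator_comm {t : ℝ} (ht : 0 < t) (f g : Lp ℝ 2 γ) :
    inner ℝ (ouOperator ht f) g = inner ℝ f (ouOperator ht g) := by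
  rw [L2.inner_def, L2.inner_def]
  have hl : ∫ x, inner ℝ (ouOperator ht f x) (g x) ∂γ = ∫ x, ouSemigroup t f x * g x ∂γ := by
    refine integral_congr_ae ?_
    filter_upwards [coeFn_ouOperator ht f] with x hx
    rw [hx, Real.inner_apply]
  have hr : ∫ x, inner ℝ (f x) (ouOperator ht g x) ∂γ = ∫ x, f x * ouSemigroup t g x ∂γ := by
    refine integral_congr_ae ?_
    filter_upwards [coeFn_ouOperator ht g] with x hx
    rw [hx, Real.inner_apply]
  rw [hl, hr]
  exact integral_ouSemigroup_mul_comm ht (Lp.stronglyMeasurable f).measurable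
    (Lp.stronglyMeasurable g).measurable (Lp.memLp f) (Lp.memLp g)

theorem ouOperator_two_mul {t : ℝ} (ht : 0 < t) (ht2 : 0 < 2 * t) (f : Lp ℝ 2 γ) :
    ouOperator ht2 f = ouOperator ht (ouOperator ht f) := by
  refine Lp.ext ((coeFn_ouOperator ht2 f).trans ?_)
  refine EventuallyEq.trans (ae_of_all _ fun x => ?_) (coeFn_ouOperator ht _).symm
  rw [ouSemigroup_congr_ae ht (coeFn_ouOperator ht f), ouSemigroup_ouSemigroup ht
    (Lp.stronglyMeasurable f).measurable (integrable_coeFn_Lp_two f)]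

/-- ⟨N_{2t} f, f⟩ = ‖N_t f‖² by self-adjointness. -/
theorem isPositive_ouOperator_two_mul {t : ℝ} (ht : 0 < t) (ht2 : 0 < 2 * t) :
    (ouOperator (n := n) ht2).IsPositive := by
  refine ⟨inner_ouOperator_comm ht2, fun f => ?_⟩
  rw [ContinuousLinearMap.reApplyInnerSelf_apply, ouOperator_two_mul ht, inner_ouOperator_comm ht]
  exact inner_self_nonneg

/-- Parseval for the vector n_t(x,·) of L²(γ), whose coefficients are the values N_t b_i(x) and
whose squared norm is n_{2t}(x,x). -/
theorem tsum_enorm_ouSemigroup_sq {ι : Type*} (b : HilbertBasis ι ℝ (Lp ℝ 2 γ)) {t : ℝ}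
    (ht : 0 < t) (x : 𝔼) : ∑' i, ‖ouSemigroup t (b i) x‖ₑ ^ 2 =
      ENNReal.ofReal (mehlerKernel (Real.exp (-t) ^ 2) x x) := by
  have h0 := Real.exp_pos (-t)
  have h1 := exp_neg_lt_one ht
  have hmem : MemLp (mehlerKernel (Real.exp (-t)) x) 2 γ :=
    MemLp.of_bound (integrable_mehlerKernel h0 h1 x).aestronglyMeasurable _ (ae_of_all _ fun y => by
      rw [Real.norm_of_nonneg (mehlerKernel_pos h0 h1 x y).le]
      exact mehlerKernel_le h0 h1 x y)
  set v := hmem.toLp _ with hv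
  have hin : ∀ i, ouSemigroup t (b i) x = inner ℝ v (b i) := fun i => by
    rw [ouSemigroup_eq_integral ht (Lp.aestronglyMeasurable _), L2.inner_def]
    refine integral_congr_ae ?_
    filter_upwards [hmem.coeFn_toLp] with y hy
    rw [hv, hy, real_inner_comm, Real.inner_apply, mul_comm]
  have hvv : inner ℝ v v = mehlerKernel (Real.exp (-t) ^ 2) x x := by
    rw [← integral_mehlerKernel_mul h0 h1, L2.inner_def]
    refine integral_congr_ae ?_
    filter_upwards [hmem.coeFn_toLp] with y hy
    rw [hv, hy, Real.inner_apply, mehlerKernel_comm]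
  have hs := b.hasSum_inner_mul_inner v v
  have hsq : ∀ i, inner ℝ v (b i) * inner ℝ (b i) v = inner ℝ v (b i) ^ 2 := fun i => by
    rw [real_inner_comm, pow_two]
  simp_rw [hsq, hvv] at hs
  rw [← hs.tsum_eq, ENNReal.ofReal_tsum_of_nonneg (fun i => sq_nonneg _) hs.summable]
  refine tsum_congr fun i => ?_
  rw [hin, ← ofReal_norm, ← ENNReal.ofReal_pow (norm_nonneg _), Real.norm_eq_abs, sq_abs]

/-- Each term is ‖N_t b_i‖² ≥ 0, so Tonelli applies and the sum is the integral of n_{2t} over the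
diagonal. -/
theorem hasSum_inner_ouOperator {ι : Type*} (b : HilbertBasis ι ℝ (Lp ℝ 2 γ)) {t : ℝ}
    (ht : 0 < t) (ht2 : 0 < 2 * t) :
    HasSum (fun i => inner ℝ (b i) (ouOperator ht2 (b i)))
      ((1 - Real.exp (-(2 * t))) ^ n)⁻¹ := by
  have : Fact ((2 : ℝ≥0∞) ≠ ⊤) := ⟨ENNReal.ofNat_ne_top⟩
  have : Countable ι := b.orthonormal.countable_of_separableSpace
  have hpos : 0 < 1 - Real.exp (-(2 * t)) := sub_pos.2 (exp_neg_lt_one ht2)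
  have hsum : ∑' i, ‖ouOperator ht (b i)‖ₑ ^ 2 =
      ENNReal.ofReal ((1 - Real.exp (-(2 * t))) ^ n)⁻¹ := by
    simp_rw [Lp.enorm_def, fun i => eLpNorm_congr_ae (p := 2) (coeFn_ouOperator ht (b i)),
      eLpNorm_two_sq]
    rw [← lintegral_tsum fun i => ((memLp_two_ouSemigroup ht (b i)).1.enorm.pow_const 2),
      ← lintegral_mehlerKernel_self ht2]
    refine lintegral_congr fun x => ?_
    rw [tsum_enorm_ouSemigroup_sq b ht, ← exp_neg_two_mul_eq, neg_mul]
  have hterm : ∀ i, inner ℝ (b i) (ouOperator ht2 (b i)) =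
      (‖ouOperator ht (b i)‖ₑ ^ 2).toReal := fun i => by
    rw [ouOperator_two_mul ht, ← inner_ouOperator_comm, real_inner_self_eq_norm_sq,
      ENNReal.toReal_pow, toReal_enorm]
  simp_rw [hterm]
  have := ENNReal.hasSum_toReal (hsum ▸ ENNReal.ofReal_ne_top)
  rwa [← ENNReal.tsum_toReal_eq (fun i => ENNReal.pow_ne_top enorm_ne_top), hsum,
    ENNReal.toReal_ofReal (by positivity)] at this

end TraceClass

/-! ### Conjugating the Mehler average by Gaussian weights. -/

section NashBound

variable {n : ℕ}

local notation "𝔼" => EuclideanSpace ℝ (Fin n)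
local notation "γ" => stdGaussian (EuclideanSpace ℝ (Fin n))

/-- Tilting the Gaussian of mean m and variance s by exp(l‖y‖²/2) lowers the inverse variance by l,
to 1/v, and moves the mean to (v/s)m. -/
theorem exp_mul_gaussianRatio_sqrt {s v l : ℝ} (hs : 0 < s) (hv : 0 < v) (h : l = 1 / s - 1 / v)
    (m y : 𝔼) : Real.exp (l * ‖y‖ ^ 2 / 2) * gaussianRatio m (Real.sqrt s) y =
      (v / s) ^ ((n : ℝ) / 2) * Real.exp (l * (v / s) * ‖m‖ ^ 2 / 2) *
        gaussianRatio ((v / s) • m) (Real.sqrt v) y := by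
  rw [gaussianRatio, gaussianRatio, Real.sq_sqrt hs.le, Real.sq_sqrt hv.le, sqrt_rpow_neg hs.le,
    sqrt_rpow_neg hv.le, norm_sub_sq_real, norm_sub_sq_real, real_inner_smul_right, norm_smul,
    Real.norm_of_nonneg (div_pos hv hs).le, mul_left_comm, ← Real.exp_add, mul_mul_mul_comm,
    ← Real.exp_add]
  congr 1
  · rw [Real.div_rpow hv.le hs.le, neg_div, Real.rpow_neg hs.le, Real.rpow_neg hv.le]
    field_simp
  · congr 1
    rw [h]
    field_simp
    ring

theorem lintegral_exp_mul_comp_affine {s v l : ℝ} (hs : 0 < s) (hv : 0 < v)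
    (h : l = 1 / s - 1 / v) (m : 𝔼) {H : 𝔼 → ℝ≥0∞} (hH : Measurable H) :
    ∫⁻ z, ENNReal.ofReal (Real.exp (l * ‖m + Real.sqrt s • z‖ ^ 2 / 2)) *
        H (m + Real.sqrt s • z) ∂γ =
      ENNReal.ofReal ((v / s) ^ ((n : ℝ) / 2) * Real.exp (l * (v / s) * ‖m‖ ^ 2 / 2)) *
        ∫⁻ z, H ((v / s) • m + Real.sqrt v • z) ∂γ := by
  rw [lintegral_comp_affine m (Real.sqrt_pos.2 hs)
      (H := fun y => ENNReal.ofReal (Real.exp (l * ‖y‖ ^ 2 / 2)) * H y) (by fun_prop),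
    lintegral_comp_affine _ (Real.sqrt_pos.2 hv) hH,
    ← lintegral_const_mul' _ _ ENNReal.ofReal_ne_top]
  refine lintegral_congr fun y => ?_
  rw [← mul_assoc, ← mul_assoc,
    ← ENNReal.ofReal_mul (gaussianRatio_pos _ (Real.sqrt_pos.2 hs) _).le,
    ← ENNReal.ofReal_mul (by positivity), mul_comm (gaussianRatio m _ y),
    exp_mul_gaussianRatio_sqrt hs hv h]

theorem enorm_eq_exp_mul_enorm (l : ℝ) {k : ℝ} (hk : 0 < k) (f : 𝔼 → ℝ) (y : 𝔼) :
    ‖f y‖ₑ = ENNReal.ofReal (Real.exp (l * ‖y‖ ^ 2 / 2)) *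
      ‖f (k⁻¹ • k • y) * Real.exp (-(l * ‖k⁻¹ • k • y‖ ^ 2 / 2))‖ₑ := by
  rw [inv_smul_smul₀ hk.ne', enorm_mul, Real.enorm_of_nonneg (Real.exp_pos _).le, mul_left_comm,
    ← ENNReal.ofReal_mul (Real.exp_pos _).le, ← Real.exp_add, add_neg_cancel, Real.exp_zero,
    ENNReal.ofReal_one, mul_one]

/-- Absorbing the p-th power of the weight costs a dilation by w^{-1/2}; k is tuned so that it
cancels against k e^{a/2} = w^{1/2}. -/
theorem lintegral_comp_dilation_rpow {a l k p : ℝ} (hk : 0 < k) (hp : 0 < p) {w : ℝ} (hw : 0 < w)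
    (h : 1 - p * l * Real.exp a = w) (hkw : k ^ 2 * Real.exp a = w) {f : 𝔼 → ℝ}
    (hf : Measurable f) :
    ∫⁻ x, ‖dilation a f x‖ₑ ^ p ∂γ = ENNReal.ofReal (w ^ (-(n : ℝ) / 2)) *
      ∫⁻ x, ‖f (k⁻¹ • x) * Real.exp (-(l * ‖k⁻¹ • x‖ ^ 2 / 2))‖ₑ ^ p ∂γ := by
  set G : 𝔼 → ℝ≥0∞ := fun x => ‖f (k⁻¹ • x) * Real.exp (-(l * ‖k⁻¹ • x‖ ^ 2 / 2))‖ₑ ^ p with hG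
  have hGm : Measurable G := by fun_prop
  have e : ∀ x, ‖dilation a f x‖ₑ ^ p = ENNReal.ofReal (Real.exp (p * l * Real.exp a *
      ‖x‖ ^ 2 / 2)) * G ((k * Real.exp (a / 2)) • x) := fun x => by
    rw [dilation, enorm_eq_exp_mul_enorm l hk, ENNReal.mul_rpow_of_nonneg _ _ hp.le,
      ENNReal.ofReal_rpow_of_pos (Real.exp_pos _), ← Real.exp_mul, hG, mul_smul, norm_smul,
      Real.norm_of_nonneg (Real.exp_pos _).le, mul_pow, ← Real.exp_nat_mul]
    congr 3
    push_cast
    rw [mul_div_cancel₀ _ (two_ne_zero' ℝ)]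
    ring
  have hroot : k * Real.exp (a / 2) = w ^ (1 / 2 : ℝ) := by
    rw [← hkw, ← Real.sqrt_eq_rpow, Real.sqrt_mul (sq_nonneg k), Real.sqrt_sq hk.le,
      Real.exp_half]
  simp_rw [e]
  rw [lintegral_exp_mul (by linarith) (H := fun x => G ((k * Real.exp (a / 2)) • x))
    (by fun_prop), h]
  congr 1
  refine lintegral_congr fun x => ?_
  rw [smul_smul, hroot, ← Real.rpow_add hw]
  norm_num [hG]

/-- After the tilt, scaling by k turns the Gaussian argument into a Mehler point of correlation ρ
over τx. -/
theorem lintegral_comp_mehler_eq {r s v l k ρ σ τ : ℝ} (hs : 0 < s) (hv : 0 < v)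
    (h : l = 1 / s - 1 / v) (hk : 0 < k) (hσ : k * Real.sqrt v = σ)
    (hρ : k * (v / s) * r = ρ * τ) {f : 𝔼 → ℝ} (hf : Measurable f) (x : 𝔼) :
    ∫⁻ z, ‖f (r • x + Real.sqrt s • z)‖ₑ ∂γ =
      ENNReal.ofReal ((v / s) ^ ((n : ℝ) / 2) * Real.exp (l * (v / s) * ‖r • x‖ ^ 2 / 2)) *
        ∫⁻ z, ‖f (k⁻¹ • (ρ • τ • x + σ • z)) *
          Real.exp (-(l * ‖k⁻¹ • (ρ • τ • x + σ • z)‖ ^ 2 / 2))‖ₑ ∂γ := by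
  simp_rw [fun z : 𝔼 => enorm_eq_exp_mul_enorm l hk f (r • x + Real.sqrt s • z)]
  rw [lintegral_exp_mul_comp_affine hs hv h (r • x) (H := fun y =>
    ‖f (k⁻¹ • k • y) * Real.exp (-(l * ‖k⁻¹ • k • y‖ ^ 2 / 2))‖ₑ) (by fun_prop)]
  have e : ∀ z : 𝔼, k • ((v / s) • r • x + Real.sqrt v • z) = ρ • τ • x + σ • z := fun z => by
    rw [smul_add, smul_smul, smul_smul, smul_smul, smul_smul, hσ, ← hρ, mul_assoc]
  simp_rw [e]

/-- The exponential in x left by the tilt, raised to the power q, is absorbed by a dilation τ^{-1/2}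
cancelling √τ; Nelson's inequality bounds what remains. -/
theorem lintegral_lintegral_comp_mehler_rpow_le {r s v l k ρ σ τ p q : ℝ} (hs : 0 < s)
    (hv : 0 < v) (h : l = 1 / s - 1 / v) (hk : 0 < k) (hσ : k * Real.sqrt v = σ) (hτ0 : 0 < τ)
    (hρ : k * (v / s) * r = ρ * Real.sqrt τ) (hτ : 1 - q * (l * (v / s) * r ^ 2) = τ)
    (hp : 1 < p) (hq : 1 < q) (hρσ : ρ ^ 2 + σ ^ 2 = 1) (hpq : ρ ^ 2 * (q - 1) ≤ p - 1)
    {f : 𝔼 → ℝ} (hf : Measurable f) :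
    ∫⁻ x, (∫⁻ z, ‖f (r • x + Real.sqrt s • z)‖ₑ ∂γ) ^ q ∂γ ≤
      ENNReal.ofReal ((v / s) ^ ((n : ℝ) / 2)) ^ q * ENNReal.ofReal (τ ^ (-(n : ℝ) / 2)) *
        eLpNorm (fun x => f (k⁻¹ • x) * Real.exp (-(l * ‖k⁻¹ • x‖ ^ 2 / 2)))
          (ENNReal.ofReal p) γ ^ q := by
  have hσ0 : 0 ≤ σ := by rw [← hσ]; positivity
  set G : 𝔼 → ℝ := fun x => f (k⁻¹ • x) * Real.exp (-(l * ‖k⁻¹ • x‖ ^ 2 / 2)) with hG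
  have hGm : Measurable G := by fun_prop
  set J : 𝔼 → ℝ≥0∞ := fun x => ∫⁻ z, ‖G (ρ • x + σ • z)‖ₑ ∂γ with hJ
  have hJm : Measurable J := measurable_lintegral_mehler ρ σ hGm.enorm
  have e : ∀ x : 𝔼, (∫⁻ z, ‖f (r • x + Real.sqrt s • z)‖ₑ ∂γ) ^ q =
      ENNReal.ofReal ((v / s) ^ ((n : ℝ) / 2)) ^ q *
        (ENNReal.ofReal (Real.exp (q * (l * (v / s) * r ^ 2) * ‖x‖ ^ 2 / 2)) *
          J (Real.sqrt τ • x) ^ q) := fun x => by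
    rw [lintegral_comp_mehler_eq hs hv h hk hσ hρ hf, ENNReal.mul_rpow_of_nonneg _ _ (by linarith),
      ENNReal.ofReal_mul (by positivity), ENNReal.mul_rpow_of_nonneg _ _ (by linarith),
      ENNReal.ofReal_rpow_of_pos (Real.exp_pos _), ← Real.exp_mul, mul_assoc, norm_smul, mul_pow,
      Real.norm_eq_abs, sq_abs]
    congr 4
    ring
  simp_rw [e]
  rw [lintegral_const_mul _ (by fun_prop), lintegral_exp_mul (by linarith)
    (H := fun x => J (Real.sqrt τ • x) ^ q) (by fun_prop), hτ, ← mul_assoc]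
  gcongr
  refine le_trans (le_of_eq ?_) (lintegral_mehler_rpow_le hp hq hρσ hσ0 hpq hGm)
  refine lintegral_congr fun x => ?_
  rw [smul_smul, Real.sqrt_eq_rpow, ← Real.rpow_add hτ0]
  norm_num
  rfl

theorem lintegral_comp_mehler_lt_top {ρ : ℝ} (h0 : 0 < ρ) (h1 : ρ < 1) {G : 𝔼 → ℝ}
    (hG : Measurable G) (hi : Integrable G γ) (x : 𝔼) :
    ∫⁻ z, ‖G (ρ • x + Real.sqrt (1 - ρ ^ 2) • z)‖ₑ ∂γ < ⊤ := by
  rw [lintegral_comp_mehler h0 h1 x hG.enorm]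
  refine (lintegral_mono fun y => mul_le_mul_left (ENNReal.ofReal_le_ofReal
    (mehlerKernel_le h0 h1 x y)) _).trans_lt ?_
  rw [lintegral_const_mul _ hG.enorm]
  exact ENNReal.mul_lt_top ENNReal.ofReal_lt_top hi.2

end NashBound

/-! ### Algebra and limit of the constant M. -/

section NashConstant

theorem nashConst_eq_ofReal {t a p q : ℝ} (ht : 0 < t) (hp : 1 < p) (hpq : p < q) :
    nashConst t a p q = ENNReal.ofReal
      (((p - 1) / Real.exp (-2 * t)) ^ (1 - 1 / p) * ((q - 1) / Real.exp (-a)) ^ (1 / q - 1) *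
        ((1 - Real.exp (-2 * t)) / (q - p)) ^ (1 / q - 1 / p)) := by
  have h1 : Real.exp (-(2 * t)) < 1 := exp_neg_lt_one (by linarith)
  rw [← neg_mul] at h1
  have hX : 0 < (p - 1) / Real.exp (-2 * t) := div_pos (by linarith) (Real.exp_pos _)
  have hY : 0 < (q - 1) / Real.exp (-a) := div_pos (by linarith) (Real.exp_pos _)
  have hZ : 0 < (1 - Real.exp (-2 * t)) / (q - p) := div_pos (by linarith) (by linarith)
  rw [nashConst, ENNReal.ofReal_rpow_of_pos hX, ENNReal.ofReal_rpow_of_pos hY,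
    ENNReal.ofReal_rpow_of_pos hZ, ← ENNReal.ofReal_mul (by positivity),
    ← ENNReal.ofReal_mul (by positivity)]

/-- X, Y, Z are the three bases in M and d = n/2. The normalising factors of the tilts and of the
two dilations combine to M^d. -/
theorem nash_exponents {X Y Z : ℝ} (hX : 0 < X) (hY : 0 < Y) (hZ : 0 < Z) (p q d : ℝ) :
    (X / Y) ^ d * ((1 / (Y * Z)) ^ (-d)) ^ (1 / q) =
      (X ^ (1 - 1 / p) * Y ^ (1 / q - 1) * Z ^ (1 / q - 1 / p)) ^ d *
        ((1 / (X * Z)) ^ (-d)) ^ (1 / p) := by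
  rw [← Real.exp_log hX, ← Real.exp_log hY, ← Real.exp_log hZ]
  simp only [one_mul, div_eq_mul_inv, ← Real.exp_neg, ← Real.exp_add, ← Real.exp_mul]
  congr 1
  ring

/-- Here R = e^{-2t} and E = e^{-a}. This evaluates the parameter w of
`lintegral_comp_dilation_rpow` as 1/(XZ); the next identity gives τ = 1/(YZ) on the output side. -/
theorem nash_dilation_identity {R p q E : ℝ} (hR : 0 < R) (hR1 : R < 1) (hp : 1 < p) (hpq : p < q)
    (h : R * (q - 1) = p * E - 1) :
    1 - p * (1 / (1 - R) - 1 / ((1 - R) * ((p - 1) / R / ((q - 1) / E)))) * E =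
      1 / ((p - 1) / R * ((1 - R) / (q - p))) := by
  have h1 : 0 < 1 - R := by linarith
  have h2 : 0 < p - 1 := by linarith
  have h3 : 0 < q - 1 := by linarith
  have h4 : 0 < q - p := by linarith
  have h5 : E = (1 + R * (q - 1)) / p := by field_simp; linarith
  have h6 : 0 < 1 + R * (q - 1) := by positivity
  rw [h5]
  field_simp
  ring

theorem nash_exponent_identity {R p q E : ℝ} (hR : 0 < R) (hR1 : R < 1) (hp : 1 < p) (hpq : p < q)
    (h : R * (q - 1) = p * E - 1) :
    1 - q * ((1 / (1 - R) - 1 / ((1 - R) * ((p - 1) / R / ((q - 1) / E)))) *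
        ((1 - R) * ((p - 1) / R / ((q - 1) / E)) / (1 - R)) * R) =
      1 / ((q - 1) / E * ((1 - R) / (q - p))) := by
  have h1 : 0 < 1 - R := by linarith
  have h2 : 0 < p - 1 := by linarith
  have h3 : 0 < q - 1 := by linarith
  have h4 : 0 < q - p := by linarith
  have h5 : E = (1 + R * (q - 1)) / p := by field_simp; linarith
  have h6 : 0 < 1 + R * (q - 1) := by positivity
  rw [h5]
  field_simp
  ring

theorem tendsto_nashConst {t : ℝ} (ht : 0 < t) (n : ℕ) {a : ℝ → ℝ}
    (ha : ∀ q ∈ Ioo (1 : ℝ) 2, (2 : ℝ) - 1 = Real.exp (2 * t) * (q * Real.exp (-(a q)) - 1)) :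
    Tendsto (fun q => -(a q)) (𝓝[>] 1) (𝓝 (Real.log (Real.exp (-2 * t) + 1))) ∧
    Tendsto (fun q => nashConst t (a q) q 2 ^ ((n : ℝ) / 2)) (𝓝[>] 1)
      (𝓝 (ENNReal.ofReal
        (((Real.exp (-2 * t) + 1) / (1 - Real.exp (-2 * t))) ^ ((n : ℝ) / 4)))) := by
  have h1 : Real.exp (-(2 * t)) < 1 := exp_neg_lt_one (by linarith)
  have hinv : Real.exp (-2 * t) * Real.exp (2 * t) = 1 := by
    rw [← Real.exp_add, neg_mul, neg_add_cancel, Real.exp_zero]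
  rw [← neg_mul] at h1
  set R := Real.exp (-2 * t) with hRdef
  have hR : 0 < R := Real.exp_pos _
  have h1R : 0 < 1 - R := by linarith
  have hexp : ∀ q ∈ Ioo (1 : ℝ) 2, Real.exp (-(a q)) = (R + 1) / q := fun q hq => by
    have hq0 : 0 < q := by linarith [hq.1]
    -- The constraint with q₂ = 2 solves to e^{-a} = (1+R)/q.
    have := congrArg (R * ·) (ha q hq)
    simp only [← mul_assoc, hinv] at this
    field_simp
    linarith
  have hmem : Ioo (1 : ℝ) 2 ∈ 𝓝[>] (1 : ℝ) := Ioo_mem_nhdsGT (by norm_num)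
  constructor
  · have hc : ContinuousAt (fun q : ℝ => Real.log ((R + 1) / q)) 1 :=
      ContinuousAt.log (by fun_prop (disch := norm_num)) (by simpa using by positivity)
    have hlim := hc.tendsto.mono_left (nhdsWithin_le_nhds (s := Ioi 1))
    rw [div_one] at hlim
    refine hlim.congr' ?_
    filter_upwards [hmem] with q hq
    rw [← hexp q hq, Real.log_exp]
  -- M as a function of q, with its first factor, of the form 0^0 at q = 1, written through x log x,
  -- which is continuous at 0.
  · set g : ℝ → ℝ := fun q =>
      Real.exp (((q - 1) * Real.log (q - 1) - (q - 1) * Real.log R) / q) *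
        (q / (R + 1)) ^ (1 / 2 - 1 : ℝ) * ((1 - R) / (2 - q)) ^ (1 / 2 - 1 / q) with hg
    have hgc : ContinuousAt (fun q => ENNReal.ofReal (g q ^ ((n : ℝ) / 2))) 1 := by
      refine ENNReal.continuous_ofReal.continuousAt.comp ?_
      have hml : ContinuousAt (fun q : ℝ => (q - 1) * Real.log (q - 1)) 1 :=
        (Real.continuous_mul_log.comp (continuous_id.sub continuous_const)).continuousAt
      refine ContinuousAt.rpow_const ?_ (Or.inr (by positivity))
      refine ContinuousAt.mul (ContinuousAt.mul ?_ ?_) ?_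
      · exact ((hml.sub (by fun_prop)).div continuousAt_id one_ne_zero).rexp
      · exact ContinuousAt.rpow_const (by fun_prop) (Or.inl (by positivity))
      · refine ContinuousAt.rpow (ContinuousAt.div (by fun_prop) (by fun_prop) (by norm_num))
          (continuousAt_const.sub (continuousAt_const.div continuousAt_id one_ne_zero))
          (Or.inl ?_)
        norm_num
        exact h1R.ne'
    have hg1 : g 1 ^ ((n : ℝ) / 2) = ((R + 1) / (1 - R)) ^ ((n : ℝ) / 4) := by
      have : g 1 = ((R + 1) / (1 - R)) ^ (1 / 2 : ℝ) := by
        simp only [hg, sub_self, zero_mul, zero_div, Real.exp_zero, one_mul]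
        rw [show (1 / 2 - 1 : ℝ) = -(1 / 2) by norm_num, show (1 / 2 - 1 / 1 : ℝ) = -(1 / 2) by
          norm_num, ← Real.mul_rpow (by positivity) (by norm_num; linarith),
          Real.rpow_neg (by norm_num; positivity),
          ← Real.inv_rpow (by norm_num; positivity)]
        congr 1
        norm_num
        field_simp
      rw [this, ← Real.rpow_mul (by positivity)]
      ring_nf
    have hlim := hgc.tendsto.mono_left (nhdsWithin_le_nhds (s := Ioi 1))
    simp only [hg1] at hlim
    refine hlim.congr' ?_
    filter_upwards [hmem] with q hq
    have hq0 : 0 < q := by linarith [hq.1]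
    have hq1 : 0 < q - 1 := by linarith [hq.1]
    have hq2 : 0 < 2 - q := by linarith [hq.2]
    rw [nashConst_eq_ofReal ht hq.1 hq.2, hexp q hq, ENNReal.ofReal_rpow_of_pos (by positivity)]
    congr 2
    simp only [hg]
    congr 1
    congr 1
    · rw [Real.rpow_def_of_pos (by positivity), Real.log_div hq1.ne' hR.ne']
      congr 1
      field_simp
    · congr 1
      field_simp
      norm_num

end NashConstant

/-! ### The dimensional hypercontractive bound. -/

section NashInequality

variable {n : ℕ}

local notation "𝔼" => EuclideanSpace ℝ (Fin n)
local notation "γ" => stdGaussian (EuclideanSpace ℝ (Fin n))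

theorem lintegral_mehler_rpow_le_nashConst {t a p q : ℝ} (ht : 0 < t) (hp : 1 < p) (hpq : p < q)
    (h : q - 1 = Real.exp (2 * t) * (p * Real.exp (-a) - 1)) {f : 𝔼 → ℝ} (hf : Measurable f) :
    (MemLp (dilation (-a) f) (ENNReal.ofReal p) γ →
      ∀ x, ∫⁻ y, ‖f (mehlerPoint t x y)‖ₑ ∂γ < ⊤) ∧
    (∫⁻ x, (∫⁻ y, ‖f (mehlerPoint t x y)‖ₑ ∂γ) ^ q ∂γ) ^ (1 / q) ≤
      nashConst t a p q ^ ((n : ℝ) / 2) * eLpNorm (dilation (-a) f) (ENNReal.ofReal p) γ := by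
  have hq : 1 < q := hp.trans hpq
  have hp1 : 0 < p - 1 := by linarith
  have hq1 : 0 < q - 1 := by linarith
  have hqp : 0 < q - p := by linarith
  have hinv : Real.exp (-2 * t) * Real.exp (2 * t) = 1 := by
    rw [← Real.exp_add, neg_mul, neg_add_cancel, Real.exp_zero]
  have hE := Real.exp_pos (-a)
  rw [nashConst_eq_ofReal ht hp hpq]
  have h' : Real.exp (-2 * t) * (q - 1) = p * Real.exp (-a) - 1 := by
    rw [h, ← mul_assoc, hinv, one_mul]
  have hr := Real.exp_pos (-t)
  have hs := one_sub_sq_pos hr (exp_neg_lt_one ht)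
  simp_rw [mehlerPoint_eq]
  rw [exp_neg_two_mul_eq] at h' ⊢
  set r := Real.exp (-t)
  set E := Real.exp (-a) with hEdef
  have hR : 0 < r ^ 2 := by positivity
  have hw := nash_dilation_identity hR (by linarith) hp hpq h'
  have hτ := nash_exponent_identity hR (by linarith) hp hpq h'
  set X := (p - 1) / r ^ 2 with hX
  set Y := (q - 1) / E with hY
  set Z := (1 - r ^ 2) / (q - p) with hZ
  have hX0 : 0 < X := by positivity
  have hY0 : 0 < Y := by positivity
  have hZ0 : 0 < Z := by positivity
  -- Variance after the tilt. The dilation k below is dictated by k²E = w = 1/(XZ).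
  set v := (1 - r ^ 2) * (X / Y) with hv
  have hv0 : 0 < v := by positivity
  have hvs : v / (1 - r ^ 2) = X / Y := by rw [hv]; field_simp
  set l := 1 / (1 - r ^ 2) - 1 / v with hl
  set k := Real.sqrt (1 / (X * Z * E)) with hk
  have hk0 : 0 < k := Real.sqrt_pos.2 (by positivity)
  -- The largest correlation for which Nelson's inequality holds from L^p to L^q.
  set ρ := Real.sqrt ((p - 1) / (q - 1)) with hρ
  have hρ0 : 0 < ρ := Real.sqrt_pos.2 (by positivity)
  have hρ2 : ρ ^ 2 = (p - 1) / (q - 1) := Real.sq_sqrt (by positivity)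
  have hρ1 : ρ < 1 := by
    rw [hρ, Real.sqrt_lt' one_pos, one_pow, div_lt_one hq1]; linarith
  have hσ0 := one_sub_sq_pos hρ0 hρ1
  have hkw : k ^ 2 * E = 1 / (X * Z) := by
    rw [hk, Real.sq_sqrt (by positivity)]; field_simp
  have hkσ : k * Real.sqrt v = Real.sqrt (1 - ρ ^ 2) := by
    rw [hk, ← Real.sqrt_mul (by positivity), hρ2, hv, hX, hY, hZ]
    congr 1
    field_simp
    ring
  have hkρ : k * (v / (1 - r ^ 2)) * r = ρ * Real.sqrt (1 / (Y * Z)) := by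
    rw [hvs, ← Real.sqrt_mul (by positivity), mul_assoc, hk,
      ← Real.sqrt_sq (show 0 ≤ X / Y * r by positivity), ← Real.sqrt_mul (by positivity)]
    congr 1
    rw [hX, hY, hZ]
    field_simp
  set G : 𝔼 → ℝ := fun x => f (k⁻¹ • x) * Real.exp (-(l * ‖k⁻¹ • x‖ ^ 2 / 2)) with hG
  have hGm : Measurable G := by fun_prop
  have hA : eLpNorm (dilation (-a) f) (ENNReal.ofReal p) γ =
      ENNReal.ofReal ((1 / (X * Z)) ^ (-(n : ℝ) / 2)) ^ (1 / p) *
        eLpNorm G (ENNReal.ofReal p) γ := by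
    rw [eLpNorm_eq_lintegral_rpow_enorm_toReal (by simpa using by linarith) (by simp),
      eLpNorm_eq_lintegral_rpow_enorm_toReal (by simpa using by linarith) (by simp),
      ENNReal.toReal_ofReal (by linarith),
      lintegral_comp_dilation_rpow hk0 (by linarith) (by positivity) hw hkw hf,
      ENNReal.mul_rpow_of_nonneg _ _ (by positivity)]
  constructor
  · intro hmem x
    have hGfin : eLpNorm G (ENNReal.ofReal p) γ < ⊤ := by
      have := hmem.2
      rw [hA] at this
      refine ENNReal.lt_top_of_mul_ne_top_right this.ne ?_
      rw [ENNReal.ofReal_rpow_of_pos (by positivity)]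
      exact (ENNReal.ofReal_pos.2 (by positivity)).ne'
    have hGi : Integrable G γ := MemLp.integrable (by simpa using hp.le)
      ⟨hGm.aestronglyMeasurable, hGfin⟩
    rw [lintegral_comp_mehler_eq hs hv0 hl hk0 hkσ hkρ hf]
    exact ENNReal.mul_lt_top ENNReal.ofReal_lt_top
      (lintegral_comp_mehler_lt_top hρ0 hρ1 hGm hGi _)
  · have hτ' : 1 - q * (l * (v / (1 - r ^ 2)) * r ^ 2) = 1 / (Y * Z) := hτ
    have key := lintegral_lintegral_comp_mehler_rpow_le hs hv0 hl hk0 hkσ (by positivity) hkρ hτ'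
      hp hq (by rw [Real.sq_sqrt hσ0.le]; ring)
      (by rw [hρ2, div_mul_cancel₀ _ hq1.ne']) hf
    rw [hvs] at key
    have hq0 : 0 < q := by linarith
    refine (ENNReal.rpow_le_rpow key (by positivity)).trans (le_of_eq ?_)
    rw [hA, ENNReal.mul_rpow_of_nonneg _ _ (by positivity),
      ENNReal.mul_rpow_of_nonneg _ _ (by positivity), ← ENNReal.rpow_mul, ← ENNReal.rpow_mul,
      mul_one_div_cancel hq0.ne', ENNReal.rpow_one, ENNReal.rpow_one, ← mul_assoc]
    congr 1
    rw [ENNReal.ofReal_rpow_of_pos (by positivity), ENNReal.ofReal_rpow_of_pos (by positivity),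
      ENNReal.ofReal_rpow_of_pos (by positivity), ← ENNReal.ofReal_mul (by positivity),
      ← ENNReal.ofReal_mul (by positivity), neg_div, nash_exponents hX0 hY0 hZ0 p q]

theorem nash_inequality_of_pos {t a p q : ℝ} (ht : 0 < t) (hp : 1 < p) (hpq : p < q)
    (h : q - 1 = Real.exp (2 * t) * (p * Real.exp (-a) - 1)) {f : 𝔼 → ℝ}
    (hf : AEStronglyMeasurable f γ) :
    (MemLp (dilation (-a) f) (ENNReal.ofReal p) γ →
      (∀ x, Integrable (fun y => f (mehlerPoint t x y)) γ) ∧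
        AEStronglyMeasurable (ouSemigroup t f) γ) ∧
    eLpNorm (ouSemigroup t f) (ENNReal.ofReal q) γ ≤
      nashConst t a p q ^ ((n : ℝ) / 2) * eLpNorm (dilation (-a) f) (ENNReal.ofReal p) γ := by
  have hg := hf.stronglyMeasurable_mk.measurable
  have hfg := hf.ae_eq_mk
  have hq : 0 < q := by linarith
  obtain ⟨hfin, hle⟩ := lintegral_mehler_rpow_le_nashConst ht hp hpq h hg
  rw [ouSemigroup_congr_ae ht hfg, eLpNorm_congr_ae (dilation_congr_ae (-a) hfg)]
  refine ⟨fun hmem => ⟨fun x => ?_, (measurable_ouSemigroup t hg).aestronglyMeasurable⟩, ?_⟩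
  · have hmp := quasiMeasurePreserving_mehlerPoint ht x
    refine Integrable.congr ⟨(hg.comp hmp.measurable).aestronglyMeasurable, ?_⟩
      (hmp.ae_eq hfg).symm
    exact hfin (hmem.ae_eq (dilation_congr_ae (-a) hfg)) x
  · refine le_trans ?_ hle
    rw [eLpNorm_eq_lintegral_rpow_enorm_toReal (by simpa using hq) (by simp),
      ENNReal.toReal_ofReal hq.le]
    gcongr with x
    exact enorm_integral_le_lintegral_enorm _

theorem mehlerPoint_zero (x y : 𝔼) : mehlerPoint 0 x y = x := by simp [mehlerPoint]

theorem ouSemigroup_zero (f : 𝔼 → ℝ) : ouSemigroup 0 f = f := by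
  funext x; simp [ouSemigroup, mehlerPoint_zero]

theorem nashConst_zero {a p q : ℝ} (hp : 1 < p) (hpq : p < q) : nashConst 0 a p q = ⊤ := by
  have hX : 0 < (p - 1) / Real.exp (-2 * 0) := div_pos (by linarith) (Real.exp_pos _)
  have hY : 0 < (q - 1) / Real.exp (-a) := div_pos (by linarith) (Real.exp_pos _)
  have hneg : 1 / q - 1 / p < 0 := sub_neg.2 (one_div_lt_one_div_of_lt (by linarith) hpq)
  rw [nashConst, ENNReal.ofReal_rpow_of_pos hX, ENNReal.ofReal_rpow_of_pos hY,
    ← ENNReal.ofReal_mul (by positivity)]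
  rw [mul_zero, Real.exp_zero, sub_self, zero_div, ENNReal.ofReal_zero,
    ENNReal.zero_rpow_of_neg hneg]
  refine ENNReal.mul_top (ENNReal.ofReal_pos.2 ?_).ne'
  rw [mul_zero, Real.exp_zero] at hX
  positivity

theorem dilation_dilation_neg (a : ℝ) (f : 𝔼 → ℝ) : dilation a (dilation (-a) f) = f := by
  funext x
  simp only [dilation]
  rw [smul_smul, ← Real.exp_add, neg_div, neg_add_cancel, Real.exp_zero, one_smul]

/-- As M = ∞, only two cases have content: n = 0, where ∞^0 = 1 and the space is a point, and a
vanishing right-hand norm, where ∞·0 = 0 and f = 0 almost everywhere. -/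
theorem nash_inequality_zero {a p q : ℝ} (hp : 1 < p) (hpq : p < q) {f : 𝔼 → ℝ}
    (hf : AEStronglyMeasurable f γ) :
    eLpNorm f (ENNReal.ofReal q) γ ≤
      nashConst 0 a p q ^ ((n : ℝ) / 2) * eLpNorm (dilation (-a) f) (ENNReal.ofReal p) γ := by
  have hp0 : ENNReal.ofReal p ≠ 0 := by simpa using by linarith
  have hq0 : ENNReal.ofReal q ≠ 0 := by simpa using by linarith
  rw [nashConst_zero hp hpq]
  rcases Nat.eq_zero_or_pos n with rfl | hn
  · have hc : ∀ g : EuclideanSpace ℝ (Fin 0) → ℝ, g = fun _ => g 0 := fun g =>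
      funext fun x => congrArg g (Subsingleton.elim x 0)
    rw [hc f, hc (dilation (-a) fun _ => f 0), eLpNorm_const _ hq0 (NeZero.ne _),
      eLpNorm_const _ hp0 (NeZero.ne _)]
    simp [dilation]
  · rw [ENNReal.top_rpow_of_pos (by positivity)]
    rcases eq_or_ne (eLpNorm (dilation (-a) f) (ENNReal.ofReal p) γ) 0 with h0 | h0
    · have hm : AEStronglyMeasurable (dilation (-a) f) γ :=
        hf.comp_quasiMeasurePreserving (quasiMeasurePreserving_smul (Real.exp_pos _))
      have hz := dilation_congr_ae a ((eLpNorm_eq_zero_iff hm hp0).1 h0)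
      rw [dilation_dilation_neg] at hz
      rw [eLpNorm_congr_ae (hz.trans (ae_of_all _ fun x => rfl : _ =ᵐ[γ] (0 : 𝔼 → ℝ))),
        eLpNorm_zero]
      exact bot_le
    · rw [ENNReal.top_mul h0]
      exact le_top

end NashInequality

/-! ### Assembly of the results. -/

theorem mainTheorem8 (n : ℕ) :
    -- the dimensional hypercontractive bound
    (∀ t a q₁ q₂ : ℝ, 0 ≤ t → 1 < q₁ → q₁ < q₂ →
      q₂ - 1 = Real.exp (2 * t) * (q₁ * Real.exp (-a) - 1) →
      ∀ f : EuclideanSpace ℝ (Fin n) → ℝ,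
        AEStronglyMeasurable f (stdGaussian (EuclideanSpace ℝ (Fin n))) →
        (MemLp (dilation (-a) f) (ENNReal.ofReal q₁) (stdGaussian (EuclideanSpace ℝ (Fin n))) →
          (∀ x, Integrable (fun y => f (mehlerPoint t x y))
            (stdGaussian (EuclideanSpace ℝ (Fin n)))) ∧
          AEStronglyMeasurable (ouSemigroup t f) (stdGaussian (EuclideanSpace ℝ (Fin n)))) ∧
        eLpNorm (ouSemigroup t f) (ENNReal.ofReal q₂) (stdGaussian (EuclideanSpace ℝ (Fin n))) ≤
          nashConst t a q₁ q₂ ^ ((n : ℝ) / 2) *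
            eLpNorm (dilation (-a) f) (ENNReal.ofReal q₁)
              (stdGaussian (EuclideanSpace ℝ (Fin n)))) ∧
    -- the parameters in the limit `q₁ → 1`, `q₂ = 2`
    (∀ t : ℝ, 0 < t → ∀ a : ℝ → ℝ,
      (∀ q ∈ Ioo (1 : ℝ) 2, (2 : ℝ) - 1 = Real.exp (2 * t) * (q * Real.exp (-(a q)) - 1)) →
      Tendsto (fun q => -(a q)) (𝓝[>] 1) (𝓝 (Real.log (Real.exp (-2 * t) + 1))) ∧
      Tendsto (fun q => nashConst t (a q) q 2 ^ ((n : ℝ) / 2)) (𝓝[>] 1)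
        (𝓝 (ENNReal.ofReal
          (((Real.exp (-2 * t) + 1) / (1 - Real.exp (-2 * t))) ^ ((n : ℝ) / 4))))) ∧
    -- the limiting bound, and its weighted form
    (∀ t : ℝ, 0 < t → ∀ f : EuclideanSpace ℝ (Fin n) → ℝ,
      AEStronglyMeasurable f (stdGaussian (EuclideanSpace ℝ (Fin n))) →
      (Integrable (fun y => f y * ouWeight t y) (stdGaussian (EuclideanSpace ℝ (Fin n))) →
        (∀ x, Integrable (fun y => f (mehlerPoint t x y))
          (stdGaussian (EuclideanSpace ℝ (Fin n)))) ∧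
        AEStronglyMeasurable (ouSemigroup t f) (stdGaussian (EuclideanSpace ℝ (Fin n)))) ∧
      eLpNorm (ouSemigroup t f) 2 (stdGaussian (EuclideanSpace ℝ (Fin n))) ≤
        ENNReal.ofReal
          (((Real.exp (-2 * t) + 1) / (1 - Real.exp (-2 * t))) ^ ((n : ℝ) / 4)) *
          eLpNorm (dilation (Real.log (Real.exp (-2 * t) + 1)) f) 1
            (stdGaussian (EuclideanSpace ℝ (Fin n))) ∧
      ENNReal.ofReal
          (((Real.exp (-2 * t) + 1) / (1 - Real.exp (-2 * t))) ^ ((n : ℝ) / 4)) *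
          eLpNorm (dilation (Real.log (Real.exp (-2 * t) + 1)) f) 1
            (stdGaussian (EuclideanSpace ℝ (Fin n))) =
        ∫⁻ y, ‖f y‖ₑ * ENNReal.ofReal (ouWeight t y)
          ∂(stdGaussian (EuclideanSpace ℝ (Fin n))) ∧
      eLpNorm (ouSemigroup t f) 2 (stdGaussian (EuclideanSpace ℝ (Fin n))) ≤
        ∫⁻ y, ‖f y‖ₑ * ENNReal.ofReal (ouWeight t y)
          ∂(stdGaussian (EuclideanSpace ℝ (Fin n)))) ∧
    -- sharpness of the weighted bound: `V_t` is the least admissible weight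
    (∀ t : ℝ, 0 < t → ∀ V : EuclideanSpace ℝ (Fin n) → ℝ≥0∞, Measurable V →
      (∀ f : EuclideanSpace ℝ (Fin n) → ℝ, Measurable f → (∃ C : ℝ, ∀ x, |f x| ≤ C) →
        eLpNorm (ouSemigroup t f) 2 (stdGaussian (EuclideanSpace ℝ (Fin n))) ≤
          ∫⁻ y, ‖f y‖ₑ * V y ∂(stdGaussian (EuclideanSpace ℝ (Fin n)))) →
      ∀ᵐ y ∂(stdGaussian (EuclideanSpace ℝ (Fin n))), ENNReal.ofReal (ouWeight t y) ≤ V y) ∧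
    -- the kernel exists and is unique
    (∀ t : ℝ, 0 < t →
      ∃! k : EuclideanSpace ℝ (Fin n) → EuclideanSpace ℝ (Fin n) → ℝ, IsOUKernel t k) ∧
    -- kernel bounds, with equality on the diagonal
    (∀ t : ℝ, 0 < t →
      ∀ k : EuclideanSpace ℝ (Fin n) → EuclideanSpace ℝ (Fin n) → ℝ, IsOUKernel (2 * t) k →
        (∀ x y, k x y ≤ ouWeight t x * ouWeight t y) ∧
        (∀ x, k x x ≤ ouWeight t x ^ 2) ∧
        (∀ x, k x x = ouWeight t x ^ 2)) ∧
    -- the trace as the integral of the kernel over the diagonal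
    (∀ t : ℝ, 0 < t →
      ∀ k : EuclideanSpace ℝ (Fin n) → EuclideanSpace ℝ (Fin n) → ℝ, IsOUKernel t k →
        Integrable (fun x => k x x) (stdGaussian (EuclideanSpace ℝ (Fin n))) ∧
        ∫ x, k x x ∂(stdGaussian (EuclideanSpace ℝ (Fin n))) =
          ∫ x, ouWeight (t / 2) x ^ 2 ∂(stdGaussian (EuclideanSpace ℝ (Fin n))) ∧
        ∫ x, k x x ∂(stdGaussian (EuclideanSpace ℝ (Fin n))) =
          ((1 - Real.exp (-t)) ^ n)⁻¹) ∧
    -- it is the trace of the positive operator `N_t` on `L²(γ)`, in every Hilbert basis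
    (∀ t : ℝ, 0 < t →
      ∃ A : Lp ℝ 2 (stdGaussian (EuclideanSpace ℝ (Fin n))) →L[ℝ]
          Lp ℝ 2 (stdGaussian (EuclideanSpace ℝ (Fin n))),
        (∀ f : Lp ℝ 2 (stdGaussian (EuclideanSpace ℝ (Fin n))),
          (A f : EuclideanSpace ℝ (Fin n) → ℝ)
            =ᵐ[stdGaussian (EuclideanSpace ℝ (Fin n))] ouSemigroup t f) ∧
        A.IsPositive ∧
        ∀ (ι : Type*) (b : HilbertBasis ι ℝ (Lp ℝ 2 (stdGaussian (EuclideanSpace ℝ (Fin n))))),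
          HasSum (fun i => inner ℝ (b i) (A (b i))) ((1 - Real.exp (-t)) ^ n)⁻¹) := by
  refine ⟨fun t a p q ht hp hpq h f hf => ?_, fun t ht a ha => tendsto_nashConst ht n ha,
    fun t ht f hf => ?_, fun t ht V hV h => ouWeight_le_of_eLpNorm_two_le ht hV h,
    fun t ht => ⟨_, isOUKernel_mehlerKernel ht, fun k hk => hk.eq (isOUKernel_mehlerKernel ht)⟩,
    fun t ht k hk => ?_, fun t ht k hk => ?_, fun t ht => ?_⟩
  · rcases ht.eq_or_lt with rfl | ht
    · rw [ouSemigroup_zero]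
      refine ⟨fun _ => ⟨fun x => ?_, hf⟩, nash_inequality_zero hp hpq hf⟩
      simp_rw [mehlerPoint_zero]
      exact integrable_const _
    · exact nash_inequality_of_pos ht hp hpq h hf
  · have hle := eLpNorm_two_ouSemigroup_le ht hf
    have heq := eLpNorm_dilation_eq_lintegral_ouWeight ht hf
    refine ⟨fun hi => ⟨integrable_comp_mehlerPoint ht
      (integrable_of_integrable_mul_ouWeight ht hf hi), aestronglyMeasurable_ouSemigroup ht hf⟩,
      hle.trans_eq heq.symm, heq, hle⟩
  · have ht2 : 0 < 2 * t := by linarith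
    obtain rfl := hk.eq (isOUKernel_mehlerKernel ht2)
    have e : Real.exp (-(2 * t)) = Real.exp (-t) ^ 2 := by rw [← exp_neg_two_mul_eq, neg_mul]
    rw [e]
    exact ⟨mehlerKernel_sq_le ht, fun x => (mehlerKernel_sq_self ht x).le, mehlerKernel_sq_self ht⟩
  · obtain rfl := hk.eq (isOUKernel_mehlerKernel ht)
    have ht2 : 0 < t / 2 := by linarith
    have e : Real.exp (-(t / 2)) ^ 2 = Real.exp (-t) := by
      rw [← exp_neg_two_mul_eq]; ring_nf
    refine ⟨integrable_mehlerKernel_self ht, integral_congr_ae (ae_of_all _ fun x => ?_),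
      integral_mehlerKernel_self ht⟩
    simp only []
    rw [← mehlerKernel_sq_self ht2, e]
  -- Positivity and trace both use the square root N_s of N_t.
  · obtain ⟨s, rfl⟩ : ∃ s, t = 2 * s := ⟨t / 2, by ring⟩
    have hs : 0 < s := by linarith
    exact ⟨ouOperator ht, coeFn_ouOperator ht, isPositive_ouOperator_two_mul hs ht,
      fun ι b => hasSum_inner_ouOperator b hs ht⟩
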